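/- All spaces are over $\mathbb C$. Let $\Gamma=\mathbb Z^2$ and $\det(\mathbf m,\mathbf n)=m_1n_2-m_2n_1$. The Virasoro-like algebra $L$ is the Lie algebra with basis $D(\mathbf m)$ $(\mathbf 0\ne\mathbf m\in\Gamma)$, $c_1,c_2$, where $c_1,c_2$ are central and, with $D(\mathbf 0)=0$ and $h(\mathbf m)=m_1c_1+m_2c_2$, $$[D(\mathbf m),D(\mathbf n)]=-\det(\mathbf m,\mathbf n)\,D(\mathbf m+\mathbf n)+\delta_{\mathbf m+\mathbf n,\mathbf 0}\,h(\mathbf m).$$ A $\mathbb Z^2$-graded $L$-module is an $L$-module $V=\bigoplus_{\mathbf m\in\mathbb Z^2}V_{\mathbf m}$ with $D(\mathbf m)V_{\mathbf n}\subseteq V_{\mathbf m+\mathbf n}$. It belongs to $\mathcal O_{\mathbb Z^2}$ if all $V_{\mathbf m}$ are finite dimensional and $V$ is irreducible as a graded module ($V\neq0$, and $0$ and $V$ are its only graded submodules). It is uniformly bounded if the dimensions of all $V_{\mathbf m}$ are bounded by one number. Let $\{\mathbf b_1,\mathbf b_2\}$ be a $\mathbb Z$-basis of $\Gamma$. Put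 $L_j=\langle D(j\mathbf b_1+m\mathbf b_2)\mid m\in\mathbb Z\rangle\oplus\delta_{j,0}\langle c_1,c_2\rangle$ and $L_+=\bigoplus_{j>0}L_j$. An exp-polynomial function over $L_0$ is a nonzero linear function $\psi:L_0\to\mathbb C$ with $\psi(h(\mathbf b_2))=0$ for which there are polynomials $p_1,\dots,p_r\in\mathbb C[x]$ and $\alpha_1,\dots,\alpha_r\in\mathbb C\setminus\{0\}$ with $$\psi(D(k\mathbf b_2))=\frac1k\sum_{j=1}^r p_j(k)\alpha_j^k\quad(0\ne k\in\mathbb Z),\qquad \psi(h(\mathbf b_1))=-\det(\mathbf b_1,\mathbf b_2)\sum_{j=1}^r p_j(0).$$ For such $\psi$ let $\widehat V^+(\psi)$ be the quotient of the induced module $U(L)\otimes_{U(L_0+L_+)}\mathbb Cv_0$, where $L_+v_0=0$ and $xv_0=\psi(x)v_0$ for $x\in L_0$, by its largest proper $\mathbb Z$-graded submodule ($v_0$ has degree $0$ and $L_j$ has degree $j$). Let $V(\psi)=\widehat V^+(\psi)\otimes\mathbb C[t^{\pm1}]$, with $$D(i\mathbf b_1+j\mathbf b_2)(v\otimes t^k)=\bigl(D(i\mathbf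 b_1+j\mathbf b_2)v\bigr)\otimes t^{k+j},\qquad c_l(v\otimes t^k)=(c_lv)\otimes t^k\quad(l=1,2),$$ where $v\otimes t^k$ has degree $m\mathbf b_1+k\mathbf b_2$ if $v$ has degree $m$. Let $\mathscr H=\langle D(k\mathbf b_2),h(\mathbf b_2)\mid k\in\mathbb Z\rangle$. For $i\in\mathbb Z$ put $W_i=U(\mathscr H)(v_0\otimes t^i)$, and let $s$ be the positive integer with $W_i=v_0\otimes t^i\,\mathbb C[t^{\pm s}]$. Let $\overline V(\psi,i,s)$ be the quotient of $V(\psi)$ by its largest graded submodule that intersects $W_i$ trivially, with the induced $\mathbb Z^2$-grading. **Theorem 4.7.** Let $V\in\mathcal O_{\mathbb Z^2}$. Then one and only one of the following holds. 1. $V$ is uniformly bounded. 2. There are a $\mathbb Z$-basis $\{\mathbf b_1,\mathbf b_2\}$ of $\Gamma$, an exp-polynomial function $\psi$ over $L_0$, $i\in\mathbb Z$ and a positive integer $s$ as above such that $V$ is isomorphic to $\overline V(\psi,i,s)$ as a graded $L$-module, up to a shift of the degrees by an element of $\mathbb Z^2$. -/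

import Mathlib

open scoped TensorProduct

noncomputable section

namespace VirLike

/-! ### The Virasoro-like algebra -/

/-- The determinant form on `Γ = ℤ²`. -/
def det (m n : ℤ × ℤ) : ℤ := m.1 * n.2 - m.2 * n.1

/-- The Virasoro-like algebra `L`: the complex vector space with basis `D(m)`, `0 ≠ m ∈ ℤ²`,
together with two further basis vectors `c₁, c₂`. -/
def L : Type := ({m : ℤ × ℤ // m ≠ 0} →₀ ℂ) × (ℂ × ℂ)

instance : AddCommGroup L := inferInstanceAs (AddCommGroup (({m : ℤ × ℤ // m ≠ 0} →₀ ℂ) × (ℂ × ℂ)))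
instance : Module ℂ L := inferInstanceAs (Module ℂ (({m : ℤ × ℤ // m ≠ 0} →₀ ℂ) × (ℂ × ℂ)))

/-- The coefficients of the `D(m)`. -/
def dPart : L →ₗ[ℂ] ({m : ℤ × ℤ // m ≠ 0} →₀ ℂ) := LinearMap.fst ℂ _ _

/-- The coefficients of `c₁, c₂`. -/
def cPart : L →ₗ[ℂ] (ℂ × ℂ) := LinearMap.snd ℂ _ _

/-- The element `a c₁ + b c₂`. -/
def cen : (ℂ × ℂ) →ₗ[ℂ] L := LinearMap.inr ℂ _ _

/-- The inclusion of the span of the `D(m)`. -/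
def dIncl : ({m : ℤ × ℤ // m ≠ 0} →₀ ℂ) →ₗ[ℂ] L := LinearMap.inl ℂ _ _

/-- The element `D(m)`, with the convention `D(0) = 0`. -/
def D (m : ℤ × ℤ) : L := if hm : m = 0 then 0 else dIncl (Finsupp.single ⟨m, hm⟩ 1)

/-- `h(m) = m₁ c₁ + m₂ c₂`. -/
def h (m : ℤ × ℤ) : L := cen ((m.1 : ℂ), (m.2 : ℂ))

@[simp] theorem D_zero : D 0 = 0 := by simp [D]

/-- The value prescribed for `[D(m), D(n)]`. -/
def br (m n : ℤ × ℤ) : L := -(det m n : ℂ) • D (m + n) + if m + n = 0 then h m else 0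

/-- The bilinear extension of the bracket of the `D(m)`. -/
def brLin : ({m : ℤ × ℤ // m ≠ 0} →₀ ℂ) →ₗ[ℂ] ({m : ℤ × ℤ // m ≠ 0} →₀ ℂ) →ₗ[ℂ] L :=
  Finsupp.linearCombination ℂ fun m => Finsupp.linearCombination ℂ fun n => br m.1 n.1

instance : Bracket L L := ⟨fun x y => brLin (dPart x) (dPart y)⟩

theorem bracket_def (x y : L) : ⁅x, y⁆ = brLin (dPart x) (dPart y) := rfl

@[simp] theorem dPart_cen (z : ℂ × ℂ) : dPart (cen z) = 0 := rfl

@[simp] theorem dPart_h (m : ℤ × ℤ) : dPart (h m) = 0 := rfl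

theorem dPart_D_of_ne {m : ℤ × ℤ} (hm : m ≠ 0) : dPart (D m) = Finsupp.single ⟨m, hm⟩ 1 := by
  simp [D, hm]; rfl

theorem h_add (m n : ℤ × ℤ) : h (m + n) = h m + h n := by
  simp only [h, ← map_add]; simp

@[simp] theorem h_zero : h 0 = 0 := by
  have := h_add 0 0; simpa using this

theorem h_neg (m : ℤ × ℤ) : h (-m) = -h m := by
  have := h_add (-m) m
  rw [neg_add_cancel, h_zero] at this
  exact eq_neg_of_add_eq_zero_left this.symm

theorem br_neg (m n : ℤ × ℤ) : br m n = -br n m := by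
  unfold br
  have h1 : (det m n : ℂ) = -(det n m : ℂ) := by
    rw [← Int.cast_neg]; congr 1; simp only [det]; ring
  rw [add_comm n m, h1]
  split_ifs with h0
  · rw [eq_neg_of_add_eq_zero_left h0, h_neg]; module
  · module

/-- The defining relations of `L`; moreover the `cen z` are central by `lie_cen_left`. -/
theorem lie_D_D (m n : ℤ × ℤ) :
    ⁅D m, D n⁆ = -(det m n : ℂ) • D (m + n) + if m + n = 0 then h m else 0 := by
  rw [bracket_def]
  by_cases hm : m = 0
  · subst hm; simp [det]
  by_cases hn : n = 0
  · subst hn; simp [det, hm]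
  rw [dPart_D_of_ne hm, dPart_D_of_ne hn]
  simp [brLin, br]

theorem brLin_flip (f g : {m : ℤ × ℤ // m ≠ 0} →₀ ℂ) : brLin f g = -brLin g f := by
  have : brLin = -brLin.flip := by
    ext m n : 4
    simp [brLin, br_neg m.1 n.1]
  conv_lhs => rw [this]
  simp

/-- `L` is spanned by the `D(m)` and the centre. -/
theorem L_induction {p : L → Prop} (hD : ∀ m, p (D m)) (hc : ∀ z, p (cen z))
    (hadd : ∀ x y, p x → p y → p (x + y)) (hsmul : ∀ (a : ℂ) x, p x → p (a • x)) (x : L) :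
    p x := by
  have key : ∀ f : {m : ℤ × ℤ // m ≠ 0} →₀ ℂ, p (dIncl f) := by
    intro f
    induction f using Finsupp.induction_linear with
    | zero => simpa using hc 0
    | add f g hf hg => simpa using hadd _ _ hf hg
    | single m a =>
      have := hsmul a _ (hD m.1)
      rwa [D, dif_neg m.2, ← map_smul, Finsupp.smul_single, smul_eq_mul, mul_one] at this
  have hx : x = dIncl (dPart x) + cen (cPart x) :=
    Prod.ext (add_zero x.1).symm (zero_add x.2).symm
  rw [hx]
  exact hadd _ _ (key _) (hc _)

theorem lie_cen_left (z : ℂ × ℂ) (y : L) : ⁅cen z, y⁆ = 0 := by simp [bracket_def]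

theorem lie_cen_right (z : ℂ × ℂ) (y : L) : ⁅y, cen z⁆ = 0 := by simp [bracket_def]

theorem lie_ite_h_left (P : Prop) [Decidable P] (m : ℤ × ℤ) (y : L) :
    ⁅(if P then h m else 0 : L), y⁆ = 0 := by split_ifs <;> simp [bracket_def]

theorem lie_ite_h_right (P : Prop) [Decidable P] (m : ℤ × ℤ) (y : L) :
    ⁅y, (if P then h m else 0 : L)⁆ = 0 := by split_ifs <;> simp [bracket_def]

theorem jacobi_D (l m n : ℤ × ℤ) : ⁅D l, ⁅D m, D n⁆⁆ = ⁅⁅D l, D m⁆, D n⁆ + ⁅D m, ⁅D l, D n⁆⁆ := by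
  have addr : ∀ x y z : L, ⁅x, y + z⁆ = ⁅x, y⁆ + ⁅x, z⁆ := fun x y z => by simp [bracket_def]
  have addl : ∀ x y z : L, ⁅x + y, z⁆ = ⁅x, z⁆ + ⁅y, z⁆ := fun x y z => by simp [bracket_def]
  have smr : ∀ (a : ℂ) (x y : L), ⁅x, a • y⁆ = a • ⁅x, y⁆ := fun a x y => by simp [bracket_def]
  have sml : ∀ (a : ℂ) (x y : L), ⁅a • x, y⁆ = a • ⁅x, y⁆ := fun a x y => by simp [bracket_def]
  rw [lie_D_D m n, lie_D_D l m, lie_D_D l n]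
  simp only [addr, addl, smr, sml, lie_ite_h_left, lie_ite_h_right, lie_D_D, add_zero]
  have e1 : m + (l + n) = l + (m + n) := by abel
  have e2 : l + m + n = l + (m + n) := by abel
  rw [e1, e2]
  by_cases h0 : l + (m + n) = 0
  · rw [if_pos h0, if_pos h0, if_pos h0, h0, D_zero, h_add]
    have : l = -(m + n) := eq_neg_of_add_eq_zero_left h0
    subst this
    have d1 : det (-(m + n)) m = det m n := by simp [det]; ring
    have d2 : det (-(m + n)) n = -det m n := by simp [det]; ring
    rw [d1, d2, h_neg, h_add]
    push_cast
    module
  · rw [if_neg h0, if_neg h0, if_neg h0]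
    simp only [add_zero, smul_smul, ← add_smul]
    congr 1
    simp only [det, Prod.fst_add, Prod.snd_add]
    push_cast
    ring

instance : LieRing L where
  add_lie x y z := by simp [bracket_def]
  lie_add x y z := by simp [bracket_def]
  lie_self x := by
    have := brLin_flip (dPart x) (dPart x)
    rw [bracket_def]
    have h2 : (2 : ℂ) • brLin (dPart x) (dPart x) = 0 := by
      rw [two_smul]; nth_rewrite 1 [this]; exact neg_add_cancel _
    exact (smul_eq_zero.mp h2).resolve_left two_ne_zero
  leibniz_lie x y z := by
    have addr : ∀ x y z : L, ⁅x, y + z⁆ = ⁅x, y⁆ + ⁅x, z⁆ := fun x y z => by simp [bracket_def]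
    have addl : ∀ x y z : L, ⁅x + y, z⁆ = ⁅x, z⁆ + ⁅y, z⁆ := fun x y z => by simp [bracket_def]
    have smr : ∀ (a : ℂ) (x y : L), ⁅x, a • y⁆ = a • ⁅x, y⁆ := fun a x y => by simp [bracket_def]
    have sml : ∀ (a : ℂ) (x y : L), ⁅a • x, y⁆ = a • ⁅x, y⁆ := fun a x y => by simp [bracket_def]
    have zr : ∀ x : L, ⁅x, (0 : L)⁆ = 0 := fun x => by simp [bracket_def]
    have zl : ∀ x : L, ⁅(0 : L), x⁆ = 0 := fun x => by simp [bracket_def]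
    induction x using L_induction with
    | hc w => simp only [lie_cen_left, zl, zr, add_zero]
    | hadd a b ha hb => simp only [addl, addr, ha, hb]; abel
    | hsmul a b hb => simp only [sml, smr, hb, smul_add]
    | hD l =>
      induction y using L_induction with
      | hc w => simp only [lie_cen_left, lie_cen_right, zl, zr, add_zero]
      | hadd a b ha hb => simp only [addl, addr, ha, hb]; abel
      | hsmul a b hb => simp only [sml, smr, hb, smul_add]
      | hD m =>
        induction z using L_induction with
        | hc w => simp only [lie_cen_right, zr, add_zero]
        | hadd a b ha hb => simp only [addr, ha, hb]; abel
        | hsmul a b hb => simp only [smr, hb, smul_add]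
        | hD n => exact jacobi_D l m n

instance : LieAlgebra ℂ L where
  lie_smul a x y := by simp [bracket_def]

/-! ### Graded modules -/

section Graded

variable {V : Type*} [AddCommGroup V] [Module ℂ V] [LieRingModule L V] [LieModule ℂ L V]

/-- An `L`-submodule is graded with respect to a family of subspaces if it is the sum of its
intersections with them. -/
def IsGradedSub {ι : Type*} (G : ι → Submodule ℂ V) (N : LieSubmodule ℂ L V) : Prop :=
  N.toSubmodule = ⨆ k, N.toSubmodule ⊓ G k

/-- The family `G` makes `V` a `ℤ²`-graded `L`-module. -/
structure IsZ2Graded (G : ℤ × ℤ → Submodule ℂ V) : Prop where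
  internal : DirectSum.IsInternal G
  lie_mem : ∀ m n : ℤ × ℤ, ∀ v ∈ G n, ⁅D m, v⁆ ∈ G (m + n)

/-- `V`, graded by `G`, belongs to `𝒪_{ℤ²}`: it is a nonzero `ℤ²`-graded `L`-module without
graded submodules other than `0` and `V`, and its homogeneous subspaces are finite dimensional. -/
structure IsInO (G : ℤ × ℤ → Submodule ℂ V) : Prop extends IsZ2Graded G where
  nontrivial : Nontrivial V
  irreducible : ∀ N : LieSubmodule ℂ L V, IsGradedSub G N → N = ⊥ ∨ N = ⊤
  finiteDimensional : ∀ m, FiniteDimensional ℂ (G m)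

/-- The dimensions of the homogeneous subspaces are finite and bounded by one number. -/
def IsUniformlyBounded (G : ℤ × ℤ → Submodule ℂ V) : Prop :=
  ∃ n : ℕ, ∀ m, FiniteDimensional ℂ (G m) ∧ Module.finrank ℂ (G m) ≤ n

/-- Isomorphism of `ℤ²`-graded `L`-modules up to a shift of the degrees. -/
def GradedIso {V' : Type*} [AddCommGroup V'] [Module ℂ V'] [LieRingModule L V'] [LieModule ℂ L V']
    (G : ℤ × ℤ → Submodule ℂ V) (G' : ℤ × ℤ → Submodule ℂ V') : Prop :=
  ∃ (e : V ≃ₗ⁅ℂ,L⁆ V') (d : ℤ × ℤ), ∀ m, (G m).map (e : V →ₗ[ℂ] V') = G' (m + d)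

end Graded

/-! ### The `ℤ`-grading of `L` attached to a `ℤ`-basis `b 0 = 𝐛₁`, `b 1 = 𝐛₂` of `Γ` -/

section Highest

attribute [local instance] LieRing.ofAssociativeRing

variable (b : Module.Basis (Fin 2) ℤ (ℤ × ℤ))

/-- `L_j = ⟨D(j 𝐛₁ + m 𝐛₂) | m ∈ ℤ⟩ ⊕ δ_{j,0} ⟨c₁, c₂⟩`. -/
def Ldeg (j : ℤ) : Submodule ℂ L :=
  Submodule.span ℂ (Set.range fun m : ℤ => D (j • b 0 + m • b 1)) ⊔
    if j = 0 then LinearMap.range cen else ⊥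

/-- `D(k 𝐛₂)` as an element of `L_0`. -/
def D0 (k : ℤ) : Ldeg b 0 :=
  ⟨D (k • b 1), Submodule.mem_sup_left (Submodule.subset_span ⟨k, by simp⟩)⟩

/-- `h(m)` as an element of `L_0`. -/
def h0 (m : ℤ × ℤ) : Ldeg b 0 :=
  ⟨h m, Submodule.mem_sup_right (by simp [h])⟩

/-- Exp-polynomial functions over `L_0`. The polynomial `p j` is `b_{j0} + b_{j1} k + ⋯`. -/
def IsExpPolynomial (ψ : Ldeg b 0 →ₗ[ℂ] ℂ) : Prop :=
  ψ ≠ 0 ∧ ψ (h0 b (b 1)) = 0 ∧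
    ∃ (r : ℕ) (p : Fin r → Polynomial ℂ) (α : Fin r → ℂ), (∀ j, α j ≠ 0) ∧
      (∀ k : ℤ, k ≠ 0 → ψ (D0 b k) = (∑ j, (p j).eval (k : ℂ) * α j ^ k) / (k : ℂ)) ∧
      ψ (h0 b (b 0)) = -(det (b 0) (b 1) : ℂ) * ∑ j, (p j).coeff 0

/-! ### The highest weight modules -/

variable (ψ : Ldeg b 0 →ₗ[ℂ] ℂ)

/-- The left ideal of `U(L)` generated by `L_j`, `j > 0`, and by `x - ψ(x)`, `x ∈ L_0`. -/
def vermaIdeal : Ideal (UniversalEnvelopingAlgebra ℂ L) :=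
  Ideal.span
    ({u | ∃ j : ℤ, 0 < j ∧ ∃ x ∈ Ldeg b j, u = UniversalEnvelopingAlgebra.ι ℂ x} ∪
     {u | ∃ x : Ldeg b 0, u = UniversalEnvelopingAlgebra.ι ℂ (x : L) -
        algebraMap ℂ (UniversalEnvelopingAlgebra ℂ L) (ψ x)})

/-- The module `U(L) ⊗_{U(L_0 + L_+)} ℂ v₀` induced from the one-dimensional module on which
`L_+` acts as `0` and `L_0` through `ψ`, realised as the quotient of `U(L)` by the left ideal
`vermaIdeal` that annihilates `v₀`. -/
def Verma : Type := UniversalEnvelopingAlgebra ℂ L ⧸ vermaIdeal b ψ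

instance : AddCommGroup (Verma b ψ) :=
  inferInstanceAs (AddCommGroup (UniversalEnvelopingAlgebra ℂ L ⧸ vermaIdeal b ψ))
instance : Module (UniversalEnvelopingAlgebra ℂ L) (Verma b ψ) :=
  inferInstanceAs (Module _ (UniversalEnvelopingAlgebra ℂ L ⧸ vermaIdeal b ψ))
instance : Module ℂ (Verma b ψ) :=
  inferInstanceAs (Module ℂ (UniversalEnvelopingAlgebra ℂ L ⧸ vermaIdeal b ψ))
instance : IsScalarTower ℂ (UniversalEnvelopingAlgebra ℂ L) (Verma b ψ) :=
  inferInstanceAs (IsScalarTower ℂ (UniversalEnvelopingAlgebra ℂ L)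
    (UniversalEnvelopingAlgebra ℂ L ⧸ vermaIdeal b ψ))

instance : LieRingModule L (Verma b ψ) where
  bracket x v := UniversalEnvelopingAlgebra.ι ℂ x • v
  add_lie x y v := by
    change UniversalEnvelopingAlgebra.ι ℂ (x + y) • v = _
    rw [map_add, add_smul]
  lie_add x v w := smul_add _ _ _
  leibniz_lie x y v := by
    change UniversalEnvelopingAlgebra.ι ℂ x • UniversalEnvelopingAlgebra.ι ℂ y • v =
      UniversalEnvelopingAlgebra.ι ℂ ⁅x, y⁆ • v +
      UniversalEnvelopingAlgebra.ι ℂ y • UniversalEnvelopingAlgebra.ι ℂ x • v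
    rw [LieHom.map_lie, LieRing.of_associative_ring_bracket, sub_smul, mul_smul, mul_smul]
    abel

instance : LieModule ℂ L (Verma b ψ) where
  smul_lie a x v := by
    change UniversalEnvelopingAlgebra.ι ℂ (a • x) • v = a • UniversalEnvelopingAlgebra.ι ℂ x • v
    rw [map_smul, smul_assoc]
  lie_smul a x v := by
    change UniversalEnvelopingAlgebra.ι ℂ x • a • v = a • UniversalEnvelopingAlgebra.ι ℂ x • v
    rw [← algebraMap_smul (UniversalEnvelopingAlgebra ℂ L) a v,
      ← algebraMap_smul (UniversalEnvelopingAlgebra ℂ L) a (_ • v), ← mul_smul, ← mul_smul,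
      Algebra.commutes]

/-- The generator `v₀` of the induced module. -/
def vermaVec : Verma b ψ := Submodule.Quotient.mk 1

/-- The homogeneous subspace of degree `n`, when `v₀` has degree `0`: the span of the vectors
`x₁ ⋯ x_k v₀` with `x_i ∈ L_{d_i}` and `d₁ + ⋯ + d_k = n`. -/
def vermaDeg (n : ℤ) : Submodule ℂ (Verma b ψ) :=
  Submodule.span ℂ {w | ∃ l : List (ℤ × L), (∀ p ∈ l, p.2 ∈ Ldeg b p.1) ∧
    (l.map Prod.fst).sum = n ∧
    w = (l.map fun p => UniversalEnvelopingAlgebra.ι ℂ p.2).prod • vermaVec b ψ}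

/-- The largest proper graded submodule `J` of the induced module. -/
def vermaMax : LieSubmodule ℂ L (Verma b ψ) :=
  sSup {N | IsGradedSub (vermaDeg b ψ) N ∧ N ≠ ⊤}

/-- The irreducible highest weight module `V̂⁺(ψ)`. -/
abbrev HW : Type := Verma b ψ ⧸ vermaMax b ψ

/-- The highest weight vector `v₀` of `V̂⁺(ψ)`. -/
def hwVec : HW b ψ := LieSubmodule.Quotient.mk (vermaVec b ψ)

/-- The `ℤ`-grading of `V̂⁺(ψ)`. -/
def hwDeg (n : ℤ) : Submodule ℂ (HW b ψ) :=
  (vermaDeg b ψ n).map (LieSubmodule.Quotient.mk' (vermaMax b ψ) : Verma b ψ →ₗ[ℂ] HW b ψ)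

end Highest

/-! ### The `ℤ²`-graded modules -/

section Loop

variable (b : Module.Basis (Fin 2) ℤ (ℤ × ℤ))
variable (M : Type*) [AddCommGroup M] [Module ℂ M] [LieRingModule L M] [LieModule ℂ L M]

/-- The action of `x ∈ L` on `M ⊗ ℂ[t^{±1}]`: for `m = i 𝐛₁ + j 𝐛₂`, the element `D(m)` acts by
`v ⊗ t^k ↦ D(m) v ⊗ t^{k+j}`, and the centre acts on the left factor. -/
def loopAct : L →ₗ[ℂ] Module.End ℂ (M ⊗[ℂ] LaurentPolynomial ℂ) :=
  (Finsupp.linearCombination ℂ fun m : {m : ℤ × ℤ // m ≠ 0} =>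
    TensorProduct.map (LieModule.toEnd ℂ L M (D m.1))
      (LinearMap.mulLeft ℂ (LaurentPolynomial.T (R := ℂ) (b.repr m.1 1)))) ∘ₗ dPart +
  (TensorProduct.mapBilinear (.id ℂ) M (LaurentPolynomial ℂ) M (LaurentPolynomial ℂ)).flip
      LinearMap.id ∘ₗ
    (LieModule.toEnd ℂ L M : L →ₗ[ℂ] Module.End ℂ M) ∘ₗ cen ∘ₗ cPart

theorem loopAct_D (m : ℤ × ℤ) :
    loopAct b M (D m) = TensorProduct.map (LieModule.toEnd ℂ L M (D m))
      (LinearMap.mulLeft ℂ (LaurentPolynomial.T (R := ℂ) (b.repr m 1))) := by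
  by_cases hm : m = 0
  · subst hm; simp
  · have hc : cPart (D m) = 0 := by simp only [D, dif_neg hm]; rfl
    simp [loopAct, dPart_D_of_ne hm, hc]

theorem loopAct_cen (z : ℂ × ℂ) :
    loopAct b M (cen z) = TensorProduct.map (LieModule.toEnd ℂ L M (cen z)) LinearMap.id := by
  have hc : cPart (cen z) = z := rfl
  simp [loopAct, hc]

theorem loopAct_lie (x y : L) :
    loopAct b M ⁅x, y⁆ = loopAct b M x * loopAct b M y - loopAct b M y * loopAct b M x := by
  have hsub : ∀ (a : ℂ) (f g : Module.End ℂ (M ⊗[ℂ] LaurentPolynomial ℂ)),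
      a • (f - g) = a • f - a • g := fun a f g => smul_sub a f g
  induction x using L_induction with
  | hadd x x' hx hx' => rw [add_lie, map_add, hx, hx', map_add]; noncomm_ring
  | hsmul a x hx =>
    rw [smul_lie, map_smul, hx, map_smul, smul_mul_assoc, mul_smul_comm, smul_sub]
  | hc z =>
    rw [lie_cen_left, map_zero]
    induction y using L_induction with
    | hadd y y' hy hy' =>
      rw [map_add, mul_add, add_mul, add_sub_add_comm, ← hy, ← hy', add_zero]
    | hsmul a y hy =>
      rw [map_smul, smul_mul_assoc, mul_smul_comm, ← hsub, ← hy, smul_zero]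
    | hc w =>
      refine (sub_eq_zero.mpr ?_).symm
      rw [loopAct_cen, loopAct_cen]
      refine TensorProduct.ext' fun v p => ?_
      have := leibniz_lie (cen z) (cen w) v
      rw [lie_cen_left, zero_lie, zero_add] at this
      simp [this]
    | hD n =>
      refine (sub_eq_zero.mpr ?_).symm
      rw [loopAct_cen, loopAct_D]
      refine TensorProduct.ext' fun v p => ?_
      have := leibniz_lie (cen z) (D n) v
      rw [lie_cen_left, zero_lie, zero_add] at this
      simp [this]
  | hD m =>
    induction y using L_induction with
    | hadd y y' hy hy' =>
      rw [lie_add, map_add, map_add, mul_add, add_mul, add_sub_add_comm, ← hy, ← hy']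
    | hsmul a y hy =>
      rw [lie_smul, map_smul, map_smul, smul_mul_assoc, mul_smul_comm, ← hsub, ← hy]
    | hc w =>
      rw [lie_cen_right, map_zero]
      refine (sub_eq_zero.mpr ?_).symm
      rw [loopAct_cen, loopAct_D]
      refine TensorProduct.ext' fun v p => ?_
      have := leibniz_lie (cen w) (D m) v
      rw [lie_cen_left, zero_lie, zero_add] at this
      simp [this]
    | hD n =>
      have hT : ∀ p : LaurentPolynomial ℂ, LaurentPolynomial.T (b.repr m 1) *
          (LaurentPolynomial.T (b.repr n 1) * p) = LaurentPolynomial.T (b.repr (m + n) 1) * p := by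
        intro p
        rw [← mul_assoc, ← LaurentPolynomial.T_add]; simp
      have hT' : ∀ p : LaurentPolynomial ℂ, LaurentPolynomial.T (b.repr n 1) *
          (LaurentPolynomial.T (b.repr m 1) * p) = LaurentPolynomial.T (b.repr (m + n) 1) * p := by
        intro p
        rw [← hT, mul_left_comm]
      refine TensorProduct.ext' fun v p => ?_
      have hl : loopAct b M ⁅D m, D n⁆ (v ⊗ₜ p) =
          ⁅⁅D m, D n⁆, v⁆ ⊗ₜ (LaurentPolynomial.T (b.repr (m + n) 1) * p) := by
        rw [lie_D_D]
        split_ifs with h0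
        · rw [h0]; simp [h, loopAct_cen]
        · simp [loopAct_D, TensorProduct.smul_tmul', TensorProduct.neg_tmul]
      rw [hl, lie_lie, TensorProduct.sub_tmul]
      simp only [loopAct_D, TensorProduct.map_tmul, LinearMap.sub_apply, Module.End.mul_apply,
        LieModule.toEnd_apply_apply, LinearMap.mulLeft_apply, hT, hT']

/-- The `L`-module `M ⊗ ℂ[t^{±1}]`. -/
def Loop (_b : Module.Basis (Fin 2) ℤ (ℤ × ℤ)) (M : Type*) [AddCommGroup M] [Module ℂ M] :
    Type _ := M ⊗[ℂ] LaurentPolynomial ℂ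

instance : AddCommGroup (Loop b M) := inferInstanceAs (AddCommGroup (M ⊗[ℂ] LaurentPolynomial ℂ))
instance : Module ℂ (Loop b M) := inferInstanceAs (Module ℂ (M ⊗[ℂ] LaurentPolynomial ℂ))

instance : LieRingModule L (Loop b M) where
  bracket x w := loopAct b M x w
  add_lie x y w := by
    change loopAct b M (x + y) w = _
    rw [map_add]; rfl
  lie_add x v w := map_add (loopAct b M x) v w
  leibniz_lie x y w := by
    change loopAct b M x (loopAct b M y w) =
      loopAct b M ⁅x, y⁆ w + loopAct b M y (loopAct b M x w)
    rw [loopAct_lie]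
    exact (sub_add_cancel _ _).symm

instance : LieModule ℂ L (Loop b M) where
  smul_lie a x w := by
    change loopAct b M (a • x) w = _
    rw [map_smul]; rfl
  lie_smul a x w := map_smul (loopAct b M x) a w

/-- The vector `v ⊗ t^k`. -/
def loopTmul (k : ℤ) : M →ₗ[ℂ] Loop b M :=
  (TensorProduct.mk ℂ M (LaurentPolynomial ℂ)).flip (LaurentPolynomial.T k)

variable {M} in
/-- The action on `M ⊗ ℂ[t^{±1}]`: `D(m) (v ⊗ t^k) = D(m) v ⊗ t^{k+j}` for `m = i 𝐛₁ + j 𝐛₂`. -/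
theorem lie_D_loopTmul (i j k : ℤ) (v : M) :
    ⁅D (i • b 0 + j • b 1), loopTmul b M k v⁆ =
      loopTmul b M (k + j) ⁅D (i • b 0 + j • b 1), v⁆ := by
  change loopAct b M _ (v ⊗ₜ LaurentPolynomial.T k) = _ ⊗ₜ LaurentPolynomial.T (k + j)
  have hj : b.repr (i • b 0 + j • b 1) 1 = j := by simp [-zsmul_eq_mul]
  rw [loopAct_D, hj, TensorProduct.map_tmul, LinearMap.mulLeft_apply, ← LaurentPolynomial.T_add,
    add_comm j k]
  rfl

variable {M} in
theorem lie_cen_loopTmul (z : ℂ × ℂ) (k : ℤ) (v : M) :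
    ⁅cen z, loopTmul b M k v⁆ = loopTmul b M k ⁅cen z, v⁆ := by
  change loopAct b M _ (v ⊗ₜ LaurentPolynomial.T k) = _ ⊗ₜ LaurentPolynomial.T k
  rw [loopAct_cen]
  simp

variable {M} in
/-- If `v` has degree `m`, then `v ⊗ t^k` has degree `m 𝐛₁ + k 𝐛₂`. -/
def loopDeg (G : ℤ → Submodule ℂ M) (γ : ℤ × ℤ) : Submodule ℂ (Loop b M) :=
  (G (b.repr γ 0)).map (loopTmul b M (b.repr γ 1))

variable (ψ : Ldeg b 0 →ₗ[ℂ] ℂ) (i : ℤ)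

/-- The module `V(ψ) = V̂⁺(ψ) ⊗ ℂ[t^{±1}]`. -/
abbrev VLoop : Type := Loop b (HW b ψ)

theorem heis_lie_mem (x y : L)
    (hx : x ∈ Submodule.span ℂ (Set.range (fun k : ℤ => D (k • b 1)) ∪ {h (b 1)}))
    (hy : y ∈ Submodule.span ℂ (Set.range (fun k : ℤ => D (k • b 1)) ∪ {h (b 1)})) :
    ⁅x, y⁆ ∈ Submodule.span ℂ (Set.range (fun k : ℤ => D (k • b 1)) ∪ {h (b 1)}) := by
  have hmem : h (b 1) ∈ Submodule.span ℂ (Set.range (fun k : ℤ => D (k • b 1)) ∪ {h (b 1)}) :=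
    Submodule.subset_span (Set.mem_union_right _ (Set.mem_singleton _))
  induction hx, hy using Submodule.span_induction₂ with
  | mem_mem x y hx hy =>
    rcases hx with ⟨k, rfl⟩ | hx
    · rcases hy with ⟨l, rfl⟩ | hy
      · have hd : det (k • b 1) (l • b 1) = 0 := by simp [det]; ring
        have hh : h (k • b 1) = (k : ℂ) • h (b 1) := by
          simp only [h, ← map_smul]; simp
        rw [lie_D_D, hd, hh, Int.cast_zero, neg_zero, zero_smul, zero_add]
        split_ifs
        · exact Submodule.smul_mem _ _ hmem
        · exact Submodule.zero_mem _
      · rw [Set.mem_singleton_iff.mp hy, h, lie_cen_right]; exact Submodule.zero_mem _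
    · rw [Set.mem_singleton_iff.mp hx, h, lie_cen_left]; exact Submodule.zero_mem _
  | zero_left y hy => rw [zero_lie]; exact Submodule.zero_mem _
  | zero_right x hx => rw [lie_zero]; exact Submodule.zero_mem _
  | add_left x y z _ _ _ h1 h2 => rw [add_lie]; exact Submodule.add_mem _ h1 h2
  | add_right x y z _ _ _ h1 h2 => rw [lie_add]; exact Submodule.add_mem _ h1 h2
  | smul_left a x y _ _ h1 => rw [smul_lie]; exact Submodule.smul_mem _ _ h1
  | smul_right a x y _ _ h1 => rw [lie_smul]; exact Submodule.smul_mem _ _ h1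

/-- The Heisenberg algebra `⟨D(k 𝐛₂), h(𝐛₂) | k ∈ ℤ⟩`. -/
def heis : LieSubalgebra ℂ L where
  toSubmodule := Submodule.span ℂ (Set.range (fun k : ℤ => D (k • b 1)) ∪ {h (b 1)})
  lie_mem' := heis_lie_mem b _ _

/-- The vector `v₀ ⊗ t^i` of `V(ψ)`. -/
def topVec : VLoop b ψ := loopTmul b (HW b ψ) i (hwVec b ψ)

/-- The submodule `W_i = U(ℋ)(v₀ ⊗ t^i)` over the Heisenberg algebra `ℋ`. -/
def W : LieSubmodule ℂ (heis b) (VLoop b ψ) := LieSubmodule.lieSpan ℂ (heis b) {topVec b ψ i}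

/-- The largest graded submodule of `V(ψ)` that intersects `W_i` trivially. -/
def WMax : LieSubmodule ℂ L (VLoop b ψ) :=
  sSup {N | IsGradedSub (loopDeg b (hwDeg b ψ)) N ∧
    N.toSubmodule ⊓ (W b ψ i).toSubmodule = ⊥}

/-- The module `V̄(ψ, i, s)`; the number `s` is determined by `ψ` through `IsPeriod`. -/
abbrev VBar : Type := VLoop b ψ ⧸ WMax b ψ i

/-- The `ℤ²`-grading of `V̄(ψ, i, s)`. -/
def vBarDeg (γ : ℤ × ℤ) : Submodule ℂ (VBar b ψ i) :=
  (loopDeg b (hwDeg b ψ) γ).map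
    (LieSubmodule.Quotient.mk' (WMax b ψ i) : VLoop b ψ →ₗ[ℂ] VBar b ψ i)

/-- The condition on `s` in `V̄(ψ, i, s)`: `W_i = v₀ ⊗ t^i ℂ[t^{±s}]`. -/
def IsPeriod (s : ℕ) : Prop :=
  (W b ψ i).toSubmodule = Submodule.span ℂ (Set.range fun n : ℤ => topVec b ψ (i + n * s))

end Loop

end VirLike

end

/-!
The proof that a module `V` in `𝒪_{ℤ²}` that is not uniformly bounded is one of the modules
`V̄(ψ, i, s)` finds a half-plane of directions in which `V` is bounded above, describes the top
level, and recovers `V` from its top level.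

*The half-plane.* A direction `m` is called killing (`IsKilling`) if an open cone around it acts
locally nilpotently. A nonzero vector annihilated by all `D(m + f)` with `f` in a small box makes
`m` killing (`isKilling_of_box`), so that a non-killing `m` bounds dimensions: `dim V_n` is at most
the sum of the dimensions of the finitely many `V_{n+m+f}` (`finrank_le_sum_box`). If `m` is
killing and `V` is not uniformly bounded, then `D(-m)` is injective (`IsKilling.eq_zero`);
moreover, for two noncollinear killing directions, dimensions grow strictly in the direction
opposite to their sum (`IsKilling.finrank_lt`). The latter compares `D(-u₁-u₂)` with
`D(-u₁) D(-u₂)` on `V_n`; eigenvalues of their quotient confine the extremal degrees acting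
nontrivially on `V_n` to hyperbolas. These facts force the killing directions to be an open
half-plane with rational boundary (`exists_halfPlane`), and strict growth shows that degrees are
bounded on its side. This gives a basis `𝐛₁, 𝐛₂` and a top level, annihilated by `L_+`
(`exists_top`).

*The top level.* On it the `D(k 𝐛₂)` form a Heisenberg algebra, whose level is zero, as otherwise
the number operators would produce homogeneous subspaces of unbounded dimension
(`heisenberg_level_eq_zero`, `h_one_eq_zero`). So the `D(k 𝐛₂)` commute, and a graded irreducible
module over commuting operators has a basis `u l`, `l ∈ sℤ`, on which the operators act as weighted
shifts (`exists_shift_basis`, `exists_isString`). Here `s ≠ 0` (`period_ne_zero`). Finite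
dimensionality one level below turns into a linear recurrence for the weights
(`exists_recurrence`), that is, they are exp-polynomial (`mem_expSpan_of_recurrence`) and define
the function `psiOf` on `L_0`.

*The comparison.* The universal property of the induced module (`exists_vermaLift`) shows that its
homogeneous subspaces form a direct sum (`isInternal_vermaDeg`). It is not zero, because the
quotient of `V` by the submodule generated by all `u (l + s) - u l` contains a nonzero highest
weight vector of weight `ψ` (`vermaVec_psiOf_ne_zero`). The submodule of `V × V(ψ)` generated by
the pairs `(u l, v₀ ⊗ t ^ l)` is the graph of a homomorphism modulo the submodule of `V(ψ)` divided
out in `V̄(ψ, i, s)`, and the homomorphism is bijective (`exists_model_equiv`).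

*Exclusivity.* In `V̄(ψ, i, s)` the vectors `D(-a 𝐛₁) D(-(N - a) 𝐛₁) (v₀ ⊗ t ^ i)`,
`0 < a < N / 2`, are linearly independent, because they pair diagonally with the elements
`D((N - c) 𝐛₁ + q 𝐛₂) D(c 𝐛₁ + p 𝐛₂)` (`IsString.lie_quadruple`). Here `p` and `q` lie in the
support of the weights, and either `p = q = 0` or `p + q` does not lie in it; such a pair exists
because the support generates `sℤ`. So dimensions are unbounded (`not_isUniformlyBounded_vBarDeg`).
-/

open scoped TensorProduct

noncomputable section

set_option linter.unusedSectionVars false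

namespace VirLike

/-! ### Brackets and homogeneous components -/

section Action

variable {V : Type*} [AddCommGroup V] [Module ℂ V] [LieRingModule L V] [LieModule ℂ L V]

theorem lie_D_lie_D (z u : ℤ × ℤ) (w : V) :
    ⁅D z, ⁅D u, w⁆⁆ = -(det z u : ℂ) • ⁅D (z + u), w⁆ +
      (if z + u = 0 then ⁅h z, w⁆ else 0) + ⁅D u, ⁅D z, w⁆⁆ := by
  rw [leibniz_lie, lie_D_D, add_lie, smul_lie]
  split_ifs <;> simp

theorem lie_D_lie_D_of_ne {z u : ℤ × ℤ} (hzu : z + u ≠ 0) (w : V) :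
    ⁅D z, ⁅D u, w⁆⁆ = -(det z u : ℂ) • ⁅D (z + u), w⁆ + ⁅D u, ⁅D z, w⁆⁆ := by
  rw [lie_D_lie_D, if_neg hzu, add_zero]

theorem det_self (z : ℤ × ℤ) : det z z = 0 := by simp [det]; ring

theorem det_neg_right (z u : ℤ × ℤ) : det z (-u) = -det z u := by simp [det]; ring

theorem det_neg_left (z u : ℤ × ℤ) : det (-z) u = -det z u := by simp [det]; ring

theorem det_swap (z u : ℤ × ℤ) : det z u = -det u z := by simp [det]; ring

theorem det_add_left (z y u : ℤ × ℤ) : det (z + y) u = det z u + det y u := by simp [det]; ring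

theorem det_add_right (u z y : ℤ × ℤ) : det u (z + y) = det u z + det u y := by simp [det]; ring

theorem det_sub_left (z y u : ℤ × ℤ) : det (z - y) u = det z u - det y u := by simp [det]; ring

theorem det_sub_right (u z y : ℤ × ℤ) : det u (z - y) = det u z - det u y := by simp [det]; ring

theorem det_zsmul_left (a : ℤ) (z u : ℤ × ℤ) : det (a • z) u = a * det z u := by
  simp [det]; ring

theorem det_zsmul_right (a : ℤ) (z u : ℤ × ℤ) : det z (a • u) = a * det z u := by
  simp [det]; ring

theorem ne_zero_of_det_ne_zero {z u : ℤ × ℤ} (hd : det z u ≠ 0) : z + u ≠ 0 := by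
  intro h0
  rw [eq_neg_of_add_eq_zero_left h0, det_neg_left, det_self] at hd
  simp at hd

/-- The degrees of two `D`'s annihilating `w` may be added unless they are collinear. -/
theorem lie_D_add_eq_zero {z u : ℤ × ℤ} (hd : det z u ≠ 0) {w : V} (hz : ⁅D z, w⁆ = 0)
    (hu : ⁅D u, w⁆ = 0) : ⁅D (z + u), w⁆ = 0 := by
  have := lie_D_lie_D_of_ne (ne_zero_of_det_ne_zero hd) w
  rw [hz, hu, lie_zero, lie_zero, add_zero] at this
  exact (smul_eq_zero.mp this.symm).resolve_left (by simpa using hd)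

theorem cen_eq (z : ℂ × ℂ) : cen z = z.1 • h (1, 0) + z.2 • h (0, 1) := by
  rw [h, h, ← map_smul, ← map_smul, ← map_add]
  congr 1
  ext <;> simp

theorem lie_h_eq (m : ℤ × ℤ) (w : V) : ⁅h m, w⁆ = ⁅D m, ⁅D (-m), w⁆⁆ - ⁅D (-m), ⁅D m, w⁆⁆ := by
  rw [lie_D_lie_D m (-m)]
  simp [det_neg_right, det_self]

/-- A subspace stable under all `D(m)` is a submodule, since the brackets `[D(m), D(-m)]` span the
centre. -/
theorem lie_mem_of_D {N : Submodule ℂ V} (hN : ∀ m, ∀ w ∈ N, ⁅D m, w⁆ ∈ N) (x : L) {w : V}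
    (hw : w ∈ N) : ⁅x, w⁆ ∈ N := by
  have hh : ∀ m, ⁅h m, w⁆ ∈ N := fun m => by
    rw [lie_h_eq]
    exact N.sub_mem (hN _ _ (hN _ _ hw)) (hN _ _ (hN _ _ hw))
  induction x using L_induction with
  | hD m => exact hN m w hw
  | hc z =>
    rw [cen_eq, add_lie, smul_lie, smul_lie]
    exact N.add_mem (N.smul_mem _ (hh _)) (N.smul_mem _ (hh _))
  | hadd x y hx hy => rw [add_lie]; exact N.add_mem hx hy
  | hsmul a x hx => rw [smul_lie]; exact N.smul_mem _ hx

/-- The submodule with a given underlying space that is stable under all `D(m)`. -/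
def subOfD (N : Submodule ℂ V) (hN : ∀ m, ∀ w ∈ N, ⁅D m, w⁆ ∈ N) : LieSubmodule ℂ L V :=
  { N with lie_mem := fun {x _} hw => lie_mem_of_D hN x hw }

end Action

section Components

variable {V : Type*} [AddCommGroup V] [Module ℂ V] {ι : Type*} [DecidableEq ι]
  {G : ι → Submodule ℂ V}

/-- The component of degree `n` with respect to a direct sum decomposition. -/
def comp (hG : DirectSum.IsInternal G) (n : ι) : V →ₗ[ℂ] V :=
  (G n).subtype ∘ₗ DirectSum.component ℂ ι (fun i => G i) n ∘ₗ
    (LinearEquiv.ofBijective (DirectSum.coeLinearMap G) hG).symm.toLinearMap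

variable (hG : DirectSum.IsInternal G)

theorem comp_mem (n : ι) (w : V) : comp hG n w ∈ G n := by
  simp [comp]

theorem comp_same {n : ι} {w : V} (hw : w ∈ G n) : comp hG n w = w := by
  have := hG.ofBijective_coeLinearMap_same ⟨w, hw⟩
  simp only [comp, LinearMap.comp_apply, LinearEquiv.coe_coe]
  exact congrArg Subtype.val this

theorem comp_of_ne {n m : ι} (hmn : m ≠ n) {w : V} (hw : w ∈ G m) : comp hG n w = 0 := by
  have := hG.ofBijective_coeLinearMap_of_ne hmn ⟨w, hw⟩
  simp only [comp, LinearMap.comp_apply, LinearEquiv.coe_coe]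
  exact congrArg Subtype.val this

theorem exists_sum_comp (w : V) : ∃ s : Finset ι, w = ∑ n ∈ s, comp hG n w := by
  have hw : w ∈ ⨆ i, G i := by rw [hG.submodule_iSup_eq_top]; trivial
  obtain ⟨f, hf, rfl⟩ := (Submodule.mem_iSup_iff_exists_finsupp _ _).mp hw
  refine ⟨f.support, ?_⟩
  simp only [Finsupp.sum]
  refine Finset.sum_congr rfl fun n hn => ?_
  rw [map_sum, Finset.sum_eq_single n (fun m _ hm => comp_of_ne hG hm (hf m)),
    comp_same hG (hf n)]
  intro h0
  exact absurd hn h0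

theorem eq_zero_of_comp {w : V} (hw : ∀ n, comp hG n w = 0) : w = 0 := by
  obtain ⟨s, hs⟩ := exists_sum_comp hG w
  rw [hs]
  exact Finset.sum_eq_zero fun n _ => hw n

theorem mem_of_comp_mem {N : Submodule ℂ V} {w : V} (hw : ∀ n, comp hG n w ∈ N) : w ∈ N := by
  obtain ⟨s, hs⟩ := exists_sum_comp hG w
  rw [hs]
  exact N.sum_mem fun n _ => hw n

end Components

section GradedModule

variable {V : Type*} [AddCommGroup V] [Module ℂ V] [LieRingModule L V] [LieModule ℂ L V]
  {G : ℤ × ℤ → Submodule ℂ V}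

theorem lie_D_comp (hG : IsZ2Graded G) (m n : ℤ × ℤ) (w : V) :
    comp hG.internal (m + n) ⁅D m, w⁆ = ⁅D m, comp hG.internal n w⁆ := by
  have hw : w ∈ ⨆ i, G i := by rw [hG.internal.submodule_iSup_eq_top]; trivial
  induction hw using Submodule.iSup_induction' with
  | mem k w hw =>
    by_cases hk : k = n
    · subst hk
      rw [comp_same hG.internal hw, comp_same hG.internal (hG.lie_mem m k w hw)]
    · rw [comp_of_ne hG.internal hk hw, lie_zero,
        comp_of_ne hG.internal _ (hG.lie_mem m k w hw)]
      simpa using hk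
  | zero => simp
  | add x y _ _ hx hy => rw [lie_add, map_add, map_add, lie_add, hx, hy]

theorem isGradedSub_of_comp (hG : IsZ2Graded G) {N : LieSubmodule ℂ L V}
    (hN : ∀ w ∈ N, ∀ n, comp hG.internal n w ∈ N) : IsGradedSub G N := by
  refine le_antisymm (fun w hw => ?_) (iSup_le fun k => inf_le_left)
  exact mem_of_comp_mem hG.internal fun n =>
    Submodule.mem_iSup_of_mem n ⟨hN w hw n, comp_mem hG.internal n w⟩

theorem eq_top_of_comp (hO : IsInO G) {N : LieSubmodule ℂ L V}
    (hN : ∀ w ∈ N, ∀ n, comp hO.internal n w ∈ N) {w : V} (hw : w ∈ N) (hw0 : w ≠ 0) : N = ⊤ := by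
  refine (hO.irreducible N (isGradedSub_of_comp hO.toIsZ2Graded hN)).resolve_left ?_
  rintro rfl
  exact hw0 (by simpa using hw)

theorem lie_h_mem (hG : IsZ2Graded G) (m : ℤ × ℤ) {n : ℤ × ℤ} {w : V} (hw : w ∈ G n) :
    ⁅h m, w⁆ ∈ G n := by
  rw [lie_h_eq]
  have h1 := hG.lie_mem m _ _ (hG.lie_mem (-m) _ _ hw)
  have h2 := hG.lie_mem (-m) _ _ (hG.lie_mem m _ _ hw)
  rw [add_neg_cancel_left] at h1
  rw [neg_add_cancel_left] at h2
  exact Submodule.sub_mem _ h1 h2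

/-- The submodule generated by homogeneous vectors is graded. -/
theorem comp_mem_lieSpan (hG : IsZ2Graded G) {s : Set V} (hs : ∀ w ∈ s, ∃ n, w ∈ G n) {w : V}
    (hw : w ∈ LieSubmodule.lieSpan ℂ L s) (n : ℤ × ℤ) :
    comp hG.internal n w ∈ LieSubmodule.lieSpan ℂ L s := by
  let N : Submodule ℂ V :=
    { carrier := {w | w ∈ LieSubmodule.lieSpan ℂ L s ∧
        ∀ n, comp hG.internal n w ∈ LieSubmodule.lieSpan ℂ L s}
      add_mem' := fun ha hb => ⟨add_mem ha.1 hb.1, fun n => by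
        rw [map_add]; exact add_mem (ha.2 n) (hb.2 n)⟩
      zero_mem' := ⟨zero_mem _, fun n => by rw [map_zero]; exact zero_mem _⟩
      smul_mem' := fun c x hx => ⟨Submodule.smul_mem (LieSubmodule.toSubmodule _) c hx.1, fun n => by
        rw [map_smul]; exact Submodule.smul_mem (LieSubmodule.toSubmodule _) c (hx.2 n)⟩ }
  have hN : ∀ m, ∀ w ∈ N, ⁅D m, w⁆ ∈ N := fun m w hw => ⟨LieSubmodule.lie_mem _ hw.1, fun n => by
    have := lie_D_comp hG m (n - m) w
    rw [add_sub_cancel] at this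
    rw [this]
    exact LieSubmodule.lie_mem _ (hw.2 _)⟩
  have hle : LieSubmodule.lieSpan ℂ L s ≤ subOfD N hN := by
    refine LieSubmodule.lieSpan_le.mpr fun w hw => ?_
    refine ⟨LieSubmodule.subset_lieSpan hw, fun n => ?_⟩
    obtain ⟨k, hk⟩ := hs w hw
    by_cases hkn : k = n
    · subst hkn; rw [comp_same hG.internal hk]; exact LieSubmodule.subset_lieSpan hw
    · rw [comp_of_ne hG.internal hkn hk]; exact zero_mem _
  exact (hle hw).2 n

theorem lieSpan_singleton_eq_top (hO : IsInO G) {n : ℤ × ℤ} {w : V} (hw : w ∈ G n) (hw0 : w ≠ 0) :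
    LieSubmodule.lieSpan ℂ L {w} = ⊤ :=
  eq_top_of_comp hO (fun _ hx k => comp_mem_lieSpan hO.toIsZ2Graded
    (fun y hy => ⟨n, by rwa [Set.mem_singleton_iff.mp hy]⟩) hx k)
    (LieSubmodule.mem_lieSpan.mpr fun N hN => hN rfl) hw0

theorem exists_ne_bot (hO : IsInO G) : ∃ n, G n ≠ ⊥ := by
  by_contra! hb
  have := hO.internal.submodule_iSup_eq_top
  have hnt := hO.nontrivial
  rw [show G = fun _ => ⊥ from funext hb, iSup_bot] at this
  exact bot_ne_top this

theorem exists_comp_ne_zero (hG : IsZ2Graded G) {w : V} (hw : w ≠ 0) :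
    ∃ n, comp hG.internal n w ≠ 0 := by
  by_contra! h0
  exact hw (eq_zero_of_comp hG.internal h0)

/-- Unless the module is uniformly bounded, no nonzero vector is annihilated by all `D(m)`. -/
theorem eq_zero_of_lie_D_eq_zero (hO : IsInO G) (hU : ¬ IsUniformlyBounded G) {w : V}
    (hw : ∀ m, ⁅D m, w⁆ = 0) : w = 0 := by
  by_contra hw0
  have hG := hO.toIsZ2Graded
  obtain ⟨k, hk⟩ := exists_comp_ne_zero hG hw0
  set x := comp hG.internal k w with hx
  have hxk : x ∈ G k := comp_mem hG.internal k w
  have hDx : ∀ m, ⁅D m, x⁆ = 0 := fun m => by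
    rw [hx, ← lie_D_comp hG, hw m, map_zero]
  let N := subOfD (ℂ ∙ x) (fun m y hy => by
    obtain ⟨c, rfl⟩ := Submodule.mem_span_singleton.mp hy
    rw [lie_smul, hDx, smul_zero]; exact zero_mem _)
  have htop : LieSubmodule.lieSpan ℂ L {x} ≤ N :=
    LieSubmodule.lieSpan_le.mpr
      (Set.singleton_subset_iff.mpr (Submodule.mem_span_singleton_self (R := ℂ) x))
  rw [lieSpan_singleton_eq_top hO hxk hk] at htop
  have hall : ∀ y : V, y ∈ (ℂ ∙ x) := fun y => htop (LieSubmodule.mem_top y)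
  refine hU ⟨1, fun m => ⟨hO.finiteDimensional m, ?_⟩⟩
  calc Module.finrank ℂ (G m) ≤ Module.finrank ℂ (ℂ ∙ x) :=
        Submodule.finrank_mono fun y _ => hall y
    _ ≤ 1 := finrank_span_singleton hk |>.le

end GradedModule

/-! ### Cones of locally nilpotent directions -/

/-- The supremum norm on `ℤ²`. -/
def nm (v : ℤ × ℤ) : ℕ := max v.1.natAbs v.2.natAbs

theorem nm_le {v : ℤ × ℤ} {k : ℕ} : nm v ≤ k ↔ |v.1| ≤ k ∧ |v.2| ≤ k := by
  simp only [nm, max_le_iff, Int.abs_eq_natAbs]; omega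

theorem nm_add_le (u v : ℤ × ℤ) : nm (u + v) ≤ nm u + nm v := by
  simp only [nm, Prod.fst_add, Prod.snd_add]; omega

theorem nm_zsmul (k : ℤ) (v : ℤ × ℤ) : nm (k • v) = k.natAbs * nm v := by
  simp [nm, Int.natAbs_mul, Nat.mul_max_mul_left]

theorem one_le_nm {v : ℤ × ℤ} (hv : v ≠ 0) : 1 ≤ nm v := by
  by_contra! h0
  apply hv
  simp only [nm] at h0
  ext <;> simp <;> omega

/-- Every nonzero lattice vector is linearly independent of one of the two unit vectors. -/
theorem exists_unit_det_ne_zero {y : ℤ × ℤ} (hy : y ≠ 0) : ∃ f, nm f ≤ 1 ∧ det f y ≠ 0 := by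
  by_cases h2 : y.2 = 0
  · refine ⟨(0, 1), by simp [nm], ?_⟩
    have : y.1 ≠ 0 := fun h1 => hy (Prod.ext h1 h2)
    simpa [det]
  · exact ⟨(1, 0), by simp [nm], by simpa [det]⟩

section

variable (V : Type*) [AddCommGroup V] [Module ℂ V] [LieRingModule L V] [LieModule ℂ L V]

/-- The direction `m ≠ 0` is killing if some open cone around `m` acts locally nilpotently in the
strong sense that each vector is annihilated by all but the elements close to the apex:
`D(k m + v) w = 0` as soon as `k` exceeds a fixed multiple of `‖v‖` by a constant depending on `w`.
-/
def IsKilling (m : ℤ × ℤ) : Prop :=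
  m ≠ 0 ∧ ∃ s : ℕ, ∀ w : V, ∃ r : ℕ, ∀ (k : ℕ) (v : ℤ × ℤ), s * nm v + r ≤ k →
    ⁅D ((k : ℤ) • m + v), w⁆ = 0

end

section

variable {V : Type*} [AddCommGroup V] [Module ℂ V] [LieRingModule L V] [LieModule ℂ L V]

/-- Two degrees may be added even when they are collinear, provided that all their neighbours
annihilate `w`. -/
theorem lie_D_add_eq_zero_of_near {z u : ℤ × ℤ} {w : V} (hz : ∀ f, nm f ≤ 1 → ⁅D (z + f), w⁆ = 0)
    (hu : ∀ f, nm f ≤ 1 → ⁅D (u + f), w⁆ = 0) : ⁅D (z + u), w⁆ = 0 := by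
  by_cases h0 : z + u = 0
  · rw [h0, D_zero, zero_lie]
  by_cases hd : det z u = 0
  · obtain ⟨f, hf, hfd⟩ := exists_unit_det_ne_zero h0
    have hnf : nm (-f) ≤ 1 := by simpa [nm] using hf
    have := lie_D_add_eq_zero (z := z + f) (u := u + -f) (w := w) ?_ (hz f hf) (hu _ hnf)
    · rwa [show z + f + (u + -f) = z + u by abel] at this
    · rw [det_add_left, det_add_right, det_add_right, hd, det_neg_right, det_neg_right, det_self,
        det_swap z f]
      rw [det_add_right] at hfd
      intro h1
      apply hfd
      linarith
  · have h1 := hz 0 (by simp [nm])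
    have h2 := hu 0 (by simp [nm])
    rw [add_zero] at h1 h2
    exact lie_D_add_eq_zero hd h1 h2

theorem IsKilling.add {m n : ℤ × ℤ} (hm : IsKilling V m) (hn : IsKilling V n) (h0 : m + n ≠ 0) :
    IsKilling V (m + n) := by
  obtain ⟨-, s, hs⟩ := hm
  obtain ⟨-, s', hs'⟩ := hn
  refine ⟨h0, s + s', fun w => ?_⟩
  obtain ⟨r, hr⟩ := hs w
  obtain ⟨r', hr'⟩ := hs' w
  refine ⟨r + r' + s + s', fun k v hk => ?_⟩
  rw [show (k : ℤ) • (m + n) + v = ((k : ℤ) • m + v) + ((k : ℤ) • n) by module]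
  refine lie_D_add_eq_zero_of_near (fun f hf => ?_) (fun f hf => ?_)
  · rw [add_assoc]
    refine hr k _ ?_
    have := (nm_add_le v f).trans (Nat.add_le_add_left hf _)
    nlinarith [Nat.zero_le (s' * nm v)]
  · refine hr' k _ ?_
    nlinarith [Nat.zero_le (s' * nm v), Nat.zero_le (s * nm v)]

theorem IsKilling.zsmul {m : ℤ × ℤ} (hm : IsKilling V m) {k : ℕ} (hk : 0 < k) :
    IsKilling V ((k : ℤ) • m) := by
  obtain ⟨h0, s, hs⟩ := hm
  refine ⟨smul_ne_zero (by exact_mod_cast hk.ne') h0, s, fun w => ?_⟩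
  obtain ⟨r, hr⟩ := hs w
  refine ⟨r, fun l v hl => ?_⟩
  rw [smul_smul, ← Nat.cast_mul]
  exact hr _ _ (hl.trans (Nat.le_mul_of_pos_right l hk))

theorem IsKilling.of_zsmul {m : ℤ × ℤ} {k : ℕ} (hk : 0 < k) (hm : IsKilling V ((k : ℤ) • m)) :
    IsKilling V m := by
  obtain ⟨h0, s, hs⟩ := hm
  refine ⟨fun h => h0 (by rw [h, smul_zero]), k * s, fun w => ?_⟩
  obtain ⟨r, hr⟩ := hs w
  refine ⟨k * (s * (k * nm m) + r + 1), fun l v hl => ?_⟩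
  have hdm := Nat.div_add_mod l k
  have hlt := Nat.mod_lt l hk
  have hz : ((l : ℕ) : ℤ) • m + v =
      ((l / k : ℕ) : ℤ) • ((k : ℤ) • m) + (((l % k : ℕ) : ℤ) • m + v) := by
    have : (l : ℤ) = (k : ℤ) * ((l / k : ℕ) : ℤ) + ((l % k : ℕ) : ℤ) := by exact_mod_cast hdm.symm
    rw [this]; module
  rw [hz]
  refine hr _ _ ?_
  have h1 : nm (((l % k : ℕ) : ℤ) • m + v) ≤ k * nm m + nm v := by
    refine (nm_add_le _ _).trans (Nat.add_le_add_right ?_ _)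
    rw [nm_zsmul, Int.natAbs_natCast]
    exact Nat.mul_le_mul_right _ hlt.le
  refine (Nat.add_le_add_right (Nat.mul_le_mul_left s h1) r).trans ?_
  rw [Nat.le_div_iff_mul_le hk]
  nlinarith

/-- The set of killing directions is open: it contains every perturbation of a large multiple. -/
theorem IsKilling.open {m : ℤ × ℤ} (hm : IsKilling V m) (v : ℤ × ℤ) :
    ∃ k₀ : ℕ, ∀ k : ℕ, k₀ ≤ k → (k : ℤ) • m + v ≠ 0 → IsKilling V ((k : ℤ) • m + v) := by
  obtain ⟨-, s, hs⟩ := hm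
  refine ⟨s * nm v + 1, fun k hk h0 => ⟨h0, s, fun w => ?_⟩⟩
  obtain ⟨r, hr⟩ := hs w
  refine ⟨r, fun l u hl => ?_⟩
  rw [show (l : ℤ) • ((k : ℤ) • m + v) + u = ((l * k : ℕ) : ℤ) • m + ((l : ℤ) • v + u) by
    push_cast; module]
  refine hr _ _ ?_
  have h1 := nm_add_le ((l : ℤ) • v) u
  rw [nm_zsmul, Int.natAbs_natCast] at h1
  calc s * nm ((l : ℤ) • v + u) + r ≤ s * (l * nm v + nm u) + r := by gcongr
    _ = l * (s * nm v) + (s * nm u + r) := by ring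
    _ ≤ l * (s * nm v) + l := by gcongr
    _ = l * (s * nm v + 1) := by ring
    _ ≤ l * k := by gcongr

/-- If all `D(m + f)` with `f` in a box annihilate `w`, then so does a whole cone around `m`. -/
theorem lie_D_cone_eq_zero {m : ℤ × ℤ} {w : V} (hm : ∀ f, nm f ≤ 2 → ⁅D (m + f), w⁆ = 0) (k : ℕ) :
    ∀ v, nm v ≤ k + 1 → ⁅D (((k + 1 : ℕ) : ℤ) • m + v), w⁆ = 0 := by
  induction k with
  | zero => intro v hv; simpa using hm v (by omega)
  | succ k ih =>
    intro v hv
    set z := ((k + 1 + 1 : ℕ) : ℤ) • m + v with hz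
    by_cases h0 : z = 0
    · rw [h0, D_zero, zero_lie]
    -- In each coordinate two consecutive summands are available, so that a summand `f` making the
    -- two degrees linearly independent exists.
    have two : ∀ x : ℤ, |x| ≤ ((k + 1 + 1 : ℕ) : ℤ) → ∃ p : ℤ, |p| ≤ 2 ∧ |p + 1| ≤ 2 ∧
        |x - p| ≤ ((k + 1 : ℕ) : ℤ) ∧ |x - (p + 1)| ≤ ((k + 1 : ℕ) : ℤ) := by
      intro x hx
      push_cast at hx ⊢
      rw [abs_le] at hx
      rcases lt_trichotomy x 0 with h | h | h
      · refine ⟨-2, ?_⟩; simp only [abs_le]; omega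
      · refine ⟨0, ?_⟩; simp only [abs_le]; omega
      · refine ⟨1, ?_⟩; simp only [abs_le]; omega
    obtain ⟨hv1, hv2⟩ := nm_le.mp hv
    obtain ⟨p, hp⟩ := two _ hv1
    obtain ⟨q, hq⟩ := two _ hv2
    have key : ∀ f, nm f ≤ 2 → nm (v - f) ≤ k + 1 → det z (m + f) ≠ 0 → ⁅D z, w⁆ = 0 := by
      intro f hf hvf hd
      have hzz : z = (((k + 1 : ℕ) : ℤ) • m + (v - f)) + (m + f) := by
        rw [hz]; push_cast; module
      rw [hzz]
      refine lie_D_add_eq_zero ?_ (ih _ hvf) (hm f hf)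
      rwa [show (((k + 1 : ℕ) : ℤ) • m + (v - f)) = z - (m + f) by rw [hzz]; abel, det_sub_left,
        det_self, sub_zero]
    by_contra hne
    have e1 : det z (m + (p, q)) = 0 := by
      by_contra hd
      exact hne (key (p, q) (nm_le.mpr ⟨hp.1, hq.1⟩) (nm_le.mpr ⟨hp.2.2.1, hq.2.2.1⟩) hd)
    have e2 : det z (m + (p + 1, q)) = 0 := by
      by_contra hd
      exact hne (key (p + 1, q) (nm_le.mpr ⟨hp.2.1, hq.1⟩) (nm_le.mpr ⟨hp.2.2.2, hq.2.2.1⟩) hd)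
    have e3 : det z (m + (p, q + 1)) = 0 := by
      by_contra hd
      exact hne (key (p, q + 1) (nm_le.mpr ⟨hp.1, hq.2.1⟩) (nm_le.mpr ⟨hp.2.2.1, hq.2.2.2⟩) hd)
    simp only [det, Prod.fst_add, Prod.snd_add] at e1 e2 e3
    exact h0 (Prod.ext (by simp only [Prod.fst_zero]; linarith)
      (by simp only [Prod.snd_zero]; linarith))

variable {G : ℤ × ℤ → Submodule ℂ V}

/-- A single nonzero vector annihilated by all `D(m + f)` with `f` in a box makes `m` killing: the
vectors annihilated by some cone around `m` form a graded submodule, which is then everything. -/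
theorem isKilling_of_box (hO : IsInO G) {m : ℤ × ℤ} (hm0 : m ≠ 0) {w : V}
    (hw0 : w ≠ 0) (hm : ∀ f, nm f ≤ 2 → ⁅D (m + f), w⁆ = 0) : IsKilling V m := by
  let N : Submodule ℂ V :=
    { carrier := {x | ∃ r : ℕ, ∀ (k : ℕ) (v : ℤ × ℤ), nm v + r ≤ k → ⁅D ((k : ℤ) • m + v), x⁆ = 0}
      add_mem' := by
        rintro x y ⟨r, hr⟩ ⟨r', hr'⟩
        refine ⟨r + r', fun k v hk => ?_⟩
        rw [lie_add, hr k v (by omega), hr' k v (by omega), add_zero]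
      zero_mem' := ⟨0, fun k v _ => lie_zero _⟩
      smul_mem' := by
        rintro c x ⟨r, hr⟩
        exact ⟨r, fun k v hk => by rw [lie_smul, hr k v hk, smul_zero]⟩ }
  have hN : ∀ u, ∀ x ∈ N, ⁅D u, x⁆ ∈ N := by
    rintro u x ⟨r, hr⟩
    refine ⟨r + nm u + 1, fun k v hk => ?_⟩
    have hvu := nm_add_le v u
    rw [lie_D_lie_D_of_ne, hr k v (by omega), add_assoc, hr k (v + u) (by omega)]
    · simp
    · intro h0
      have h1 : (k : ℤ) • m = (-1 : ℤ) • (v + u) := by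
        rw [add_assoc] at h0
        rw [eq_neg_of_add_eq_zero_left h0]; module
      have h2 := congrArg nm h1
      rw [nm_zsmul, nm_zsmul] at h2
      have h3 : k ≤ k * nm m := Nat.le_mul_of_pos_right k (one_le_nm hm0)
      simp only [Int.natAbs_natCast, Int.natAbs_neg, Int.natAbs_one, one_mul] at h2
      omega
  have htop : subOfD N hN = ⊤ := by
    refine eq_top_of_comp hO (w := w) ?_ ?_ hw0
    · rintro x ⟨r, hr⟩ i
      exact ⟨r, fun k v hk => by
        rw [← lie_D_comp hO.toIsZ2Graded, hr k v hk, map_zero]⟩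
    · refine ⟨1, fun k v hk => ?_⟩
      obtain ⟨k, rfl⟩ : ∃ l, k = l + 1 := ⟨k - 1, by omega⟩
      exact lie_D_cone_eq_zero hm k v (by omega)
  refine ⟨hm0, 1, fun x => ?_⟩
  have hx : x ∈ subOfD N hN := by rw [htop]; trivial
  obtain ⟨r, hr⟩ := hx
  exact ⟨r, fun k v hk => hr k v (by omega)⟩

/-- In the direction opposite to a killing one, `D` acts injectively: a vector annihilated by
`D(-m)` and by the far elements of the cone around `m` is annihilated by all of `L`. -/
theorem IsKilling.eq_zero (hO : IsInO G) (hU : ¬ IsUniformlyBounded G) {m : ℤ × ℤ}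
    (hm : IsKilling V m) {w : V} (hw : ⁅D (-m), w⁆ = 0) : w = 0 := by
  obtain ⟨hm0, s, hs⟩ := hm
  obtain ⟨r, hr⟩ := hs w
  have descend : ∀ (k : ℕ) (y : ℤ × ℤ), det y m ≠ 0 → ⁅D ((k : ℤ) • m + y), w⁆ = 0 →
      ⁅D y, w⁆ = 0 := by
    intro k
    induction k with
    | zero => intro y _ h0; simpa using h0
    | succ k ih =>
      intro y hy h0
      have h1 := ih (y + m) (by rwa [det_add_left, det_self, add_zero])
        (by rw [← h0]; congr 2; push_cast; module)
      have := lie_D_add_eq_zero (z := y + m) (u := -m)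
        (by rwa [det_neg_right, det_add_left, det_self, add_zero, neg_ne_zero]) h1 hw
      rwa [add_neg_cancel_right] at this
  have noncol : ∀ y, det y m ≠ 0 → ⁅D y, w⁆ = 0 := fun y hy =>
    descend (s * nm y + r) y hy (hr _ _ le_rfl)
  refine eq_zero_of_lie_D_eq_zero hO hU fun y => ?_
  by_cases hy : det y m = 0
  · by_cases hy0 : y = 0
    · rw [hy0, D_zero, zero_lie]
    obtain ⟨f, -, hf⟩ := exists_unit_det_ne_zero hm0
    have hfy : det f y ≠ 0 := by
      intro h0
      have h1 : y.1 * det f m = 0 := by simp only [det] at *; linear_combination m.1 * h0 + f.1 * hy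
      have h2 : y.2 * det f m = 0 := by simp only [det] at *; linear_combination m.2 * h0 + f.2 * hy
      exact hy0 (Prod.ext ((mul_eq_zero.mp h1).resolve_right hf)
        ((mul_eq_zero.mp h2).resolve_right hf))
    have := lie_D_add_eq_zero (z := f) (u := y - f) (w := w)
      (by rwa [det_sub_right, det_self, sub_zero]) (noncol f hf)
      (noncol _ (by rwa [det_sub_left, hy, zero_sub, neg_ne_zero]))
    rwa [add_sub_cancel] at this
  · exact noncol y hy

theorem IsKilling.not_neg (hO : IsInO G) (hU : ¬ IsUniformlyBounded G) {m : ℤ × ℤ}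
    (hm : IsKilling V m) : ¬ IsKilling V (-m) := by
  rintro ⟨-, s, hs⟩
  have hnt := hO.nontrivial
  obtain ⟨w, hw⟩ := exists_ne (0 : V)
  obtain ⟨r, hr⟩ := hs w
  have h1 := hr (r + 1) 0 (by simp [nm])
  rw [add_zero, smul_neg] at h1
  exact hw ((hm.zsmul r.succ_pos).eq_zero hO hU h1)

theorem IsKilling.add' (hO : IsInO G) (hU : ¬ IsUniformlyBounded G) {m n : ℤ × ℤ}
    (hm : IsKilling V m) (hn : IsKilling V n) : IsKilling V (m + n) :=
  hm.add hn fun h0 => hm.not_neg hO hU (by rwa [← eq_neg_of_add_eq_zero_right h0])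

/-- The map `D(m) : V_n → V_{m+n}`. -/
def actHom (hG : IsZ2Graded G) (m n : ℤ × ℤ) : G n →ₗ[ℂ] G (m + n) :=
  (LieModule.toEnd ℂ L V (D m)).restrict (hG.lie_mem m n)

theorem IsKilling.actHom_injective (hO : IsInO G) (hU : ¬ IsUniformlyBounded G) {m : ℤ × ℤ}
    (hm : IsKilling V m) (n : ℤ × ℤ) : Function.Injective (actHom hO.toIsZ2Graded (-m) n) := by
  rw [injective_iff_map_eq_zero]
  intro w hw
  exact Subtype.ext (hm.eq_zero hO hU (congrArg Subtype.val hw))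

theorem IsKilling.finrank_le (hO : IsInO G) (hU : ¬ IsUniformlyBounded G) {m : ℤ × ℤ}
    (hm : IsKilling V m) (n : ℤ × ℤ) :
    Module.finrank ℂ (G n) ≤ Module.finrank ℂ (G (-m + n)) :=
  have := hO.finiteDimensional (-m + n)
  LinearMap.finrank_le_finrank_of_injective (hm.actHom_injective hO hU n)

/-- The box of vectors of norm at most two. -/
def box : Finset (ℤ × ℤ) := Finset.Icc (-2, -2) (2, 2)

theorem mem_box {f : ℤ × ℤ} : f ∈ box ↔ nm f ≤ 2 := by
  rw [box, Finset.mem_Icc, nm_le, abs_le, abs_le, Prod.le_def, Prod.le_def]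
  push_cast
  tauto

attribute [irreducible] box

/-- If `m` is not killing, then the `D(m + f)`, `f` in the box, have no common kernel. -/
theorem finrank_le_sum_box (hO : IsInO G) {m : ℤ × ℤ} (hm0 : m ≠ 0) (hm : ¬ IsKilling V m)
    (n : ℤ × ℤ) :
    Module.finrank ℂ (G n) ≤ ∑ f ∈ box, Module.finrank ℂ (G (m + f + n)) := by
  have := hO.finiteDimensional
  rw [← Finset.sum_coe_sort, ← Module.finrank_pi_fintype]
  let φ : G n →ₗ[ℂ] (f : box) → G (m + f + n) :=
    LinearMap.pi fun f => actHom hO.toIsZ2Graded (m + f) n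
  refine LinearMap.finrank_le_finrank_of_injective (f := φ) ?_
  rw [injective_iff_map_eq_zero]
  intro w hw
  by_contra hw0
  refine hm (isKilling_of_box hO hm0 (w := w) (by simpa using hw0) fun f hf => ?_)
  exact congrArg Subtype.val (congrFun hw ⟨f, mem_box.mpr hf⟩)

end

/-! ### Strict growth of the dimensions -/

/-- The integral points of a hyperbola `(a - μ)(b + δ + μ) = -μ(μ + δ)` with large `a` lie on its
degenerate components. -/
theorem hyperbola_bound (δ : ℤ) (μ : ℂ) : ∃ B : ℤ, ∀ a b : ℤ, B < a →
    -((b : ℂ) + δ) * a = μ * (a - b) → b = 0 ∨ b = -δ := by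
  by_cases hc : μ * (μ + δ) = 0
  · refine ⟨|δ|, fun a b ha hab => ?_⟩
    have h0 : 0 < a := (abs_nonneg δ).trans_lt ha
    rcases mul_eq_zero.mp hc with h | h
    · right
      rw [h, zero_mul] at hab
      have h1 : (-(b + δ)) * a = 0 := by exact_mod_cast hab
      have := (mul_eq_zero.mp h1).resolve_right h0.ne'
      omega
    · left
      rw [eq_neg_of_add_eq_zero_left h] at hab
      have h1 : -(b + δ) * a = -δ * (a - b) := by exact_mod_cast hab
      have h2 : b * (a + δ) = 0 := by linear_combination -h1
      refine (mul_eq_zero.mp h2).resolve_right fun h3 => ?_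
      have := neg_abs_le δ
      omega
  · set c := ‖μ * (μ + δ)‖ with hcdef
    set M := max ‖μ‖ c with hM
    obtain ⟨N, hN⟩ := exists_nat_gt (c + ‖(δ : ℂ)‖ + ‖μ‖)
    let F : Finset ℤ := Finset.Icc (-N) N
    let g : ℤ → ℝ := fun b => ‖μ‖ + ‖μ * (μ + δ) / ((b : ℂ) + δ + μ)‖ + 1
    obtain ⟨K, hK⟩ := exists_nat_gt (∑ b ∈ F, g b + ‖μ‖ + 1)
    refine ⟨K, fun a b ha hab => ?_⟩
    exfalso
    have hg : ∀ b, 0 ≤ g b := fun b => by positivity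
    have hprod : ((a : ℂ) - μ) * ((b : ℂ) + δ + μ) = -(μ * (μ + δ)) := by
      linear_combination -hab
    have ha' : (∑ b ∈ F, g b + ‖μ‖ + 1) < ‖(a : ℂ)‖ := by
      rw [Complex.norm_intCast]
      have : (K : ℝ) < (a : ℝ) := by exact_mod_cast ha
      exact hK.trans (this.trans_le (le_abs_self _))
    have h1 : ‖(a : ℂ)‖ ≤ ‖(a : ℂ) - μ‖ + ‖μ‖ := norm_le_norm_sub_add _ _
    have hF : 0 ≤ ∑ b ∈ F, g b := Finset.sum_nonneg fun b _ => hg b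
    have hge : 1 ≤ ‖(a : ℂ) - μ‖ := by linarith
    have hnorm : ‖(a : ℂ) - μ‖ * ‖(b : ℂ) + δ + μ‖ = c := by
      rw [← norm_mul, hprod, norm_neg]
    have hb1 : ‖(b : ℂ) + δ + μ‖ ≤ c := by
      nlinarith [norm_nonneg ((b : ℂ) + δ + μ)]
    have hb2 : ‖(b : ℂ)‖ ≤ c + ‖(δ : ℂ)‖ + ‖μ‖ := by
      have h2 : (b : ℂ) = ((b : ℂ) + δ + μ) - δ - μ := by ring
      rw [h2]
      refine (norm_sub_le _ _).trans (add_le_add_left ((norm_sub_le _ _).trans ?_) _)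
      linarith
    have hbF : b ∈ F := by
      rw [Finset.mem_Icc, ← abs_le]
      rw [Complex.norm_intCast] at hb2
      have : |(b : ℝ)| < N := hb2.trans_lt hN
      exact_mod_cast this.le
    have hne : (b : ℂ) + δ + μ ≠ 0 := by
      intro h0
      rw [h0, mul_zero] at hprod
      exact hc (neg_eq_zero.mp hprod.symm)
    have hav : (a : ℂ) = μ + -(μ * (μ + δ) / ((b : ℂ) + δ + μ)) := by
      field_simp
      linear_combination hprod
    have h3 : ‖(a : ℂ)‖ ≤ g b := by
      rw [hav]
      refine (norm_add_le _ _).trans ?_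
      rw [norm_neg]
      simp only [g]
      linarith
    have h4 : g b ≤ ∑ b ∈ F, g b := Finset.single_le_sum (fun b _ => hg b) hbF
    linarith [norm_nonneg μ]

section

variable {V : Type*} [AddCommGroup V] [Module ℂ V] [LieRingModule L V] [LieModule ℂ L V]
  {G : ℤ × ℤ → Submodule ℂ V}

/-- A killing direction annihilates the vectors of a finite dimensional subspace uniformly. -/
theorem IsKilling.uniform {m : ℤ × ℤ} (hm : IsKilling V m) (N : Submodule ℂ V)
    [FiniteDimensional ℂ N] : ∃ s r : ℕ, ∀ w ∈ N, ∀ (k : ℕ) (v : ℤ × ℤ), s * nm v + r ≤ k →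
      ⁅D ((k : ℤ) • m + v), w⁆ = 0 := by
  obtain ⟨-, s, hs⟩ := hm
  choose r hr using hs
  obtain ⟨S, hS⟩ := (Module.Finite.iff_fg (N := N)).mp inferInstance
  refine ⟨s, ∑ x ∈ S, r x, fun w hw k v hk => ?_⟩
  rw [← hS] at hw
  induction hw using Submodule.span_induction with
  | mem x hx =>
    refine hr x k v (le_trans (Nat.add_le_add_left ?_ _) hk)
    exact Finset.single_le_sum (f := r) (fun _ _ => Nat.zero_le _) hx
  | zero => exact lie_zero _
  | add x y _ _ hx hy => rw [lie_add, hx, hy, add_zero]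
  | smul c x _ hx => rw [lie_smul, hx, smul_zero]

/-- In the sector spanned by two killing directions all but finitely many elements of a coset
annihilate a given finite dimensional subspace. -/
theorem IsKilling.sector {u₁ u₂ : ℤ × ℤ} (h₁ : IsKilling V u₁) (h₂ : IsKilling V u₂)
    (N : Submodule ℂ V) [FiniteDimensional ℂ N] (z : ℤ × ℤ) :
    ∃ I : ℕ, ∀ i j : ℕ, I ≤ i + j → ∀ w ∈ N, ⁅D (z + (i : ℤ) • u₁ + (j : ℤ) • u₂), w⁆ = 0 := by
  obtain ⟨s₁, r₁, h₁⟩ := h₁.uniform N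
  obtain ⟨s₂, r₂, h₂⟩ := h₂.uniform N
  set I₁ := s₁ * (nm z + 1) + r₁ with hI₁
  set J₁ := s₂ + r₂ with hJ₁
  set I₂ := s₁ * (nm z + J₁ * nm u₂) + r₁ with hI₂
  set J₂ := s₂ * (nm z + I₁ * nm u₁) + r₂ with hJ₂
  refine ⟨I₁ + J₁ + I₂ + J₂, fun i j hij w hw => ?_⟩
  by_cases hj : j < J₁
  · rw [show z + (i : ℤ) • u₁ + (j : ℤ) • u₂ = (i : ℤ) • u₁ + (z + (j : ℤ) • u₂) by abel]
    refine h₁ w hw _ _ (le_trans (Nat.add_le_add_right (Nat.mul_le_mul_left _ ?_) _)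
      (show I₂ ≤ i by omega))
    refine (nm_add_le _ _).trans ?_
    rw [nm_zsmul, Int.natAbs_natCast]
    gcongr
  by_cases hi : i < I₁
  · rw [show z + (i : ℤ) • u₁ + (j : ℤ) • u₂ = (j : ℤ) • u₂ + (z + (i : ℤ) • u₁) by abel]
    refine h₂ w hw _ _ (le_trans (Nat.add_le_add_right (Nat.mul_le_mul_left _ ?_) _)
      (show J₂ ≤ j by omega))
    refine (nm_add_le _ _).trans ?_
    rw [nm_zsmul, Int.natAbs_natCast]
    gcongr
  refine lie_D_add_eq_zero_of_near (fun f hf => ?_) (fun f hf => ?_)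
  · rw [show z + (i : ℤ) • u₁ + f = (i : ℤ) • u₁ + (z + f) by abel]
    refine h₁ w hw _ _ (le_trans ?_ (not_lt.mp hi))
    have := nm_add_le z f
    rw [hI₁]
    gcongr
    omega
  · refine h₂ w hw _ _ (le_trans ?_ (not_lt.mp hj))
    rw [hJ₁]
    have := Nat.mul_le_mul_left s₂ hf
    omega

/-- The products `D(-u₁) D(-u₂)` and `D(-u₁-u₂)` are compared through an element `D(z + u₁ + u₂)`
that annihilates the vector together with its two neighbours. -/
theorem lie_D_lie_D_lie_D_of_extreme {u₁ u₂ z : ℤ × ℤ} {w : V} (h0 : z ≠ 0) (h1 : z + u₁ ≠ 0)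
    (h2 : z + u₂ ≠ 0) (k0 : ⁅D (z + u₁ + u₂), w⁆ = 0) (k1 : ⁅D (z + u₁), w⁆ = 0)
    (k2 : ⁅D (z + u₂), w⁆ = 0) :
    ⁅D (z + u₁ + u₂), ⁅D (-u₁), ⁅D (-u₂), w⁆⁆⁆ =
      ((det (z + u₂) u₁ * det z u₂ : ℤ) : ℂ) • ⁅D z, w⁆ := by
  have e1 : z + u₁ + u₂ + -u₁ = z + u₂ := by abel
  have e2 : z + u₂ + -u₂ = z := by abel
  have e3 : z + u₁ + u₂ + -u₂ = z + u₁ := by abel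
  rw [lie_D_lie_D_of_ne (by rwa [e1]), e1, lie_D_lie_D_of_ne (by rwa [e2]), e2, k2,
    lie_D_lie_D_of_ne (z := z + u₁ + u₂) (u := -u₂) (by rwa [e3]), e3, k0, k1]
  have d1 : det (z + u₁ + u₂) (-u₁) = -det (z + u₂) u₁ := by simp [det]; ring
  have d2 : det (z + u₂) (-u₂) = -det z u₂ := by simp [det]; ring
  rw [d1, d2]
  push_cast
  simp only [lie_zero, smul_zero, add_zero, neg_neg, smul_smul]

/-- For two noncollinear killing directions, dimensions grow strictly in the direction opposite to
their sum. If they did not, then the endomorphism `A = D(-u₁-u₂)⁻¹ D(-u₁) D(-u₂)` of `V_n` would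
confine the extremal degrees `z` with `D(z) V_n ≠ 0` to finitely many hyperbolas whose asymptotes
are parallel to `u₁` and `u₂`; but there are extremal degrees arbitrarily far in the direction of
`u₁`, and far out on such an asymptote `D(z)` annihilates `V_n`. -/
theorem IsKilling.finrank_lt (hO : IsInO G) (hU : ¬ IsUniformlyBounded G) {u₁ u₂ : ℤ × ℤ}
    (h₁ : IsKilling V u₁) (h₂ : IsKilling V u₂) (hd : 0 < det u₁ u₂) {n : ℤ × ℤ} (hn : G n ≠ ⊥) :
    Module.finrank ℂ (G n) < Module.finrank ℂ (G (-(u₁ + u₂) + n)) := by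
  have hu : IsKilling V (u₁ + u₂) := h₁.add' hO hU h₂
  have hG := hO.toIsZ2Graded
  have hfd := hO.finiteDimensional
  refine lt_of_le_of_ne (hu.finrank_le hO hU n) fun heq => ?_
  set φ := actHom hG (-(u₁ + u₂)) n with hφ
  have hφi : Function.Injective φ := hu.actHom_injective hO hU n
  have hφs : Function.Surjective φ := (LinearMap.injective_iff_surjective_of_finrank_eq_finrank
    heq).mp hφi
  have hmem : ∀ w : G n, ⁅D (-u₁), ⁅D (-u₂), (w : V)⁆⁆ ∈ G (-(u₁ + u₂) + n) := fun w => by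
    have := hG.lie_mem (-u₁) _ _ (hG.lie_mem (-u₂) _ _ w.2)
    rwa [show -u₁ + (-u₂ + n) = -(u₁ + u₂) + n by abel] at this
  let ρ : G n →ₗ[ℂ] G (-(u₁ + u₂) + n) :=
    ((LieModule.toEnd ℂ L V (D (-u₁)) ∘ₗ LieModule.toEnd ℂ L V (D (-u₂))) ∘ₗ
      (G n).subtype).codRestrict _ hmem
  let A : Module.End ℂ (G n) := (LinearEquiv.ofBijective φ ⟨hφi, hφs⟩).symm.toLinearMap ∘ₗ ρ
  have hA : ∀ w : G n, ⁅D (-(u₁ + u₂)), (A w : V)⁆ = ⁅D (-u₁), ⁅D (-u₂), (w : V)⁆⁆ := fun w =>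
    congrArg Subtype.val ((LinearEquiv.ofBijective φ ⟨hφi, hφs⟩).apply_symm_apply (ρ w))
  set δ := det u₁ u₂ with hδ
  obtain ⟨B, hB⟩ : ∃ B : ℤ, ∀ μ ∈ spectrum ℂ A, ∀ a b : ℤ, B < a →
      -((b : ℂ) + δ) * a = μ * (a - b) → b = 0 ∨ b = -δ := by
    choose β hβ using hyperbola_bound δ
    have hfin := Module.End.finite_spectrum A
    obtain ⟨B, hB⟩ := (hfin.image β).bddAbove
    exact ⟨B, fun μ hμ a b ha => hβ μ a b ((hB ⟨μ, hμ, rfl⟩).trans_lt ha)⟩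
  -- All degrees with `b ∈ {0, -δ}` and large `a` annihilate `V_n`.
  obtain ⟨s, r, hsr⟩ := h₁.uniform (G n)
  have hray : ∃ C : ℤ, ∀ z : ℤ × ℤ, C < det z u₂ → (det u₁ z = 0 ∨ det u₁ z = -δ) →
      ∀ w ∈ G n, ⁅D z, w⁆ = 0 := by
    refine ⟨δ * (s * (nm u₁ + nm u₂) + r + 1), fun z hz hb w hw => ?_⟩
    have hcr : δ • z = det z u₂ • u₁ + det u₁ z • u₂ := by
      ext <;> simp [hδ, det] <;> ring
    have hdm := Int.mul_ediv_add_emod (det z u₂) δ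
    have hm0 := Int.emod_nonneg (det z u₂) hd.ne'
    have hm1 := Int.emod_lt_of_pos (det z u₂) hd
    set q := det z u₂ / δ with hq
    have hq1 : (s * (nm u₁ + nm u₂) + r : ℤ) < q := by
      by_contra! hcon
      have := mul_le_mul_of_nonneg_left hcon hd.le
      linarith
    obtain ⟨k, hk⟩ := Int.eq_ofNat_of_zero_le (a := q)
      (le_trans (by positivity) hq1.le)
    have hz' : z = (k : ℤ) • u₁ + (z - q • u₁) := by rw [← hk]; abel
    rw [hz']
    refine hsr w hw k _ ?_
    have hv : δ • (z - q • u₁) = (det z u₂ % δ) • u₁ + det u₁ z • u₂ := by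
      rw [smul_sub, hcr, Int.emod_def, ← hq]
      module
    have hnv : nm (z - q • u₁) ≤ nm u₁ + nm u₂ := by
      have h3 := nm_add_le ((det z u₂ % δ) • u₁) (det u₁ z • u₂)
      rw [← hv, nm_zsmul, nm_zsmul, nm_zsmul] at h3
      have h4 : (det z u₂ % δ).natAbs ≤ δ.natAbs := by omega
      have h5 : (det u₁ z).natAbs ≤ δ.natAbs := by omega
      have h6 : 0 < δ.natAbs := by omega
      have h7 := Nat.mul_le_mul_right (nm u₁) h4
      have h8 := Nat.mul_le_mul_right (nm u₂) h5
      refine Nat.le_of_mul_le_mul_left (c := δ.natAbs) ?_ h6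
      linarith
    have h9 := Nat.mul_le_mul_left s hnv
    have h10 : (s * (nm u₁ + nm u₂) + r) < k := by
      rw [hk] at hq1
      exact_mod_cast hq1
    omega
  obtain ⟨C, hC⟩ := hray
  -- A degree opposite to a killing one with huge `a`.
  set M : ℤ := max (max B C) 0 + 1 with hM
  obtain ⟨k₀, hk₀⟩ := h₂.open (-M • u₁)
  have hdet : ∀ k : ℤ, det (k • u₂ + -M • u₁) u₂ = -M * δ := fun k => by
    rw [det_add_left, det_zsmul_left, det_zsmul_left, det_self, hδ]; ring
  have hMpos : 0 < M := by positivity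
  have hc := hk₀ k₀ le_rfl (fun h0 => by
    have := hdet k₀
    rw [h0] at this
    have h1 : 0 < M * δ := mul_pos hMpos hd
    simp [det] at this
    rcases this with h | h <;> omega)
  set z₀ : ℤ × ℤ := -((k₀ : ℤ) • u₂ + -M • u₁) with hz₀
  have hz₀a : det z₀ u₂ = M * δ := by rw [hz₀, det_neg_left, hdet]; ring
  let S : Set (ℕ × ℕ) := {p | ¬ ∀ w ∈ G n, ⁅D (z₀ + (p.1 : ℤ) • u₁ + (p.2 : ℤ) • u₂), w⁆ = 0}
  obtain ⟨I, hI⟩ := h₁.sector h₂ (G n) z₀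
  have hSfin : S.Finite := by
    refine (Set.finite_Iic ((I, I) : ℕ × ℕ)).subset fun p hp => ?_
    by_contra hcon
    refine hp (hI p.1 p.2 ?_)
    rw [Set.mem_Iic, Prod.le_def] at hcon
    simp only at hcon
    omega
  have hSne : (0, 0) ∈ S := by
    intro hall
    obtain ⟨w, hw, hw0⟩ := (Submodule.ne_bot_iff _).mp hn
    refine hw0 (hc.eq_zero hO hU (w := w) ?_)
    rw [← hz₀]
    simpa only [Nat.cast_zero, zero_smul, add_zero] using hall w hw
  obtain ⟨⟨i, j⟩, hp, hmax⟩ := hSfin.exists_maximalFor (fun p => p.1 + p.2) S ⟨_, hSne⟩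
  set z := z₀ + (i : ℤ) • u₁ + (j : ℤ) • u₂ with hz
  have hkill : ∀ i' j' : ℕ, 0 < i' + j' → ∀ w ∈ G n,
      ⁅D (z + (i' : ℤ) • u₁ + (j' : ℤ) • u₂), w⁆ = 0 := by
    intro i' j' hpos
    by_contra hcon
    have : ((i + i', j + j') : ℕ × ℕ) ∈ S := by
      intro hall
      apply hcon
      intro w hw
      rw [← hall w hw]
      congr 2
      rw [hz]; push_cast; module
    have := hmax this (by simp only; omega)
    simp only at this
    omega
  set a := det z u₂ with ha
  set b := det u₁ z with hb
  have hab : M * δ ≤ a := by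
    rw [ha, hz, det_add_left, det_add_left, det_zsmul_left, det_zsmul_left, det_self, hz₀a,
      mul_zero, add_zero]
    have : 0 ≤ (i : ℤ) * det u₁ u₂ := by positivity
    linarith
  have hMa : M ≤ a := le_trans (le_mul_of_one_le_right hMpos.le hd) hab
  have hδa : δ ≤ a := le_trans (le_mul_of_one_le_left hd.le hMpos) hab
  have hbC : b ≠ 0 ∧ b ≠ -δ := by
    refine not_or.mp fun hcon => hp (hC z ?_ hcon)
    have := le_max_left (max B C) 0
    have := le_max_right B C
    omega
  have hz0 : z ≠ 0 := fun h0 => by rw [ha, h0] at hMa; simp [det] at hMa; omega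
  have hz1 : z + u₁ ≠ 0 := fun h0 => by
    rw [ha, eq_neg_of_add_eq_zero_left h0, det_neg_left] at hMa; omega
  have hz2 : z + u₂ ≠ 0 := fun h0 => by
    rw [ha, eq_neg_of_add_eq_zero_left h0, det_neg_left, det_self] at hMa; omega
  have k1 : ∀ w ∈ G n, ⁅D (z + u₁), w⁆ = 0 := by simpa using hkill 1 0 (by omega)
  have k2 : ∀ w ∈ G n, ⁅D (z + u₂), w⁆ = 0 := by simpa using hkill 0 1 (by omega)
  have k0 : ∀ w ∈ G n, ⁅D (z + u₁ + u₂), w⁆ = 0 := by simpa using hkill 1 1 (by omega)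
  have hrel : ∀ w : G n, ⁅D z, (((-((b : ℂ) + δ) * a) • w - ((a : ℂ) - b) • A w : G n) : V)⁆ = 0 := by
    intro w
    have e := lie_D_lie_D_lie_D_of_extreme hz0 hz1 hz2 (k0 w w.2) (k1 w w.2) (k2 w w.2)
    rw [← hA, lie_D_lie_D_of_ne (by rwa [add_assoc z, add_neg_cancel_right]),
      k0 _ (A w).2, lie_zero, add_zero, add_assoc z, add_neg_cancel_right] at e
    have d1 : det (z + (u₁ + u₂)) (-(u₁ + u₂)) = -(a - b) := by simp [ha, hb, det]; ring
    have d2 : det (z + u₂) u₁ * det z u₂ = -(b + δ) * a := by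
      rw [det_add_left, det_swap z u₁, det_swap u₂ u₁]; ring
    rw [d1, d2] at e
    push_cast at e
    rw [neg_neg] at e
    simp only [Submodule.coe_sub, Submodule.coe_smul, lie_sub, lie_smul, e]
    rw [sub_self]
  set q : ℂ := -((b : ℂ) + δ) * a with hq
  by_cases ht : a = b
  · -- Here `q ≠ 0`, so that `D(z)` annihilates `V_n`.
    refine hp fun w hw => ?_
    have := hrel ⟨w, hw⟩
    rw [ht] at this
    simp only [sub_self, zero_smul, sub_zero, Submodule.coe_smul, lie_smul] at this
    refine (smul_eq_zero.mp this).resolve_left ?_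
    rw [hq]
    refine mul_ne_zero ?_ (by exact_mod_cast (hMpos.trans_le hMa).ne')
    rw [neg_ne_zero]
    exact_mod_cast fun h0 => hbC.2 (by omega)
  · have ht' : (a : ℂ) - b ≠ 0 := sub_ne_zero.mpr (by exact_mod_cast ht)
    have hspec : q / (a - b) ∈ spectrum ℂ A := by
      rw [spectrum.mem_iff]
      intro hunit
      refine hp fun w hw => ?_
      have hbij := (Module.End.isUnit_iff _).mp hunit
      obtain ⟨y, hy⟩ := hbij.2 ⟨w, hw⟩
      have h1 := hrel y
      have h2 : q • y - ((a : ℂ) - b) • A y = ((a : ℂ) - b) • (⟨w, hw⟩ : G n) := by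
        rw [← hy, LinearMap.sub_apply, Module.algebraMap_end_apply, smul_sub, smul_smul,
          mul_div_cancel₀ _ ht']
      rw [h2] at h1
      simp only [Submodule.coe_smul, lie_smul] at h1
      exact (smul_eq_zero.mp h1).resolve_left ht'
    have := hB _ hspec a b (by
      have := le_max_left (max B C) 0
      have := le_max_left B C
      omega) (by rw [div_mul_cancel₀ _ ht'])
    exact this.elim hbC.1 hbC.2

end

/-! ### The half-plane of killing directions -/

section

variable {V : Type*} [AddCommGroup V] [Module ℂ V] [LieRingModule L V] [LieModule ℂ L V]
  {G : ℤ × ℤ → Submodule ℂ V}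

theorem IsKilling.finrank_lt_of_ne (hO : IsInO G) (hU : ¬ IsUniformlyBounded G) {u₁ u₂ : ℤ × ℤ}
    (h₁ : IsKilling V u₁) (h₂ : IsKilling V u₂) (hd : det u₁ u₂ ≠ 0) {n : ℤ × ℤ} (hn : G n ≠ ⊥) :
    Module.finrank ℂ (G n) < Module.finrank ℂ (G (-(u₁ + u₂) + n)) := by
  rcases hd.lt_or_gt with hlt | hgt
  · rw [add_comm u₁]
    refine h₂.finrank_lt hO hU h₁ ?_ hn
    rw [det_swap]
    omega
  · exact h₁.finrank_lt hO hU h₂ hgt hn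

/-- Some pair of opposite directions consists of non-killing ones: otherwise killing directions
would form the positive cone of a dense total order of `ℤ²`, so that every killing direction is the
sum of arbitrarily many pairs of noncollinear ones, and dimensions would be infinite. -/
theorem exists_not_killing (hO : IsInO G) (hU : ¬ IsUniformlyBounded G) :
    ∃ e : ℤ × ℤ, e ≠ 0 ∧ ¬ IsKilling V e ∧ ¬ IsKilling V (-e) := by
  by_contra! htot
  have split : ∀ u, IsKilling V u → ∃ w, IsKilling V w ∧ IsKilling V (u - w) ∧
      det w (u - w) ≠ 0 := by
    intro u hu
    obtain ⟨v, hv, hvu⟩ : ∃ v, IsKilling V v ∧ det v u ≠ 0 := by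
      obtain ⟨f, -, hf⟩ := exists_unit_det_ne_zero hu.1
      have hf0 : f ≠ 0 := by rintro rfl; simp [det] at hf
      by_cases hk : IsKilling V f
      · exact ⟨f, hk, hf⟩
      · exact ⟨-f, htot f hf0 hk, by rwa [det_neg_left, neg_ne_zero]⟩
    have hdet : ∀ k : ℤ, det (k • u - v) u ≠ 0 := fun k => by
      rwa [det_sub_left, det_zsmul_left, det_self, mul_zero, zero_sub, neg_ne_zero]
    have hne : ∀ k : ℤ, k • u - v ≠ 0 := fun k h0 => hdet k (by rw [h0]; simp [det])
    have hex : ∃ k : ℕ, IsKilling V ((k : ℤ) • u - v) := by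
      obtain ⟨k, hk⟩ := hu.open (-v)
      exact ⟨k, by rw [sub_eq_add_neg]; exact hk k le_rfl (by rw [← sub_eq_add_neg]; exact hne k)⟩
    classical
    obtain ⟨k, hk, hmin⟩ : ∃ k : ℕ, IsKilling V ((k : ℤ) • u - v) ∧
        ∀ l < k, ¬ IsKilling V ((l : ℤ) • u - v) :=
      ⟨Nat.find hex, Nat.find_spec hex, fun l hl => Nat.find_min hex hl⟩
    obtain ⟨k, rfl⟩ : ∃ l, k = l + 1 := by
      refine ⟨k - 1, ?_⟩
      rcases Nat.eq_zero_or_pos k with rfl | h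
      · rw [Nat.cast_zero, zero_smul, zero_sub] at hk
        exact absurd hk (hv.not_neg hO hU)
      · omega
    have hw := htot _ (hne k) (hmin k (by omega))
    refine ⟨_, hw, ?_, ?_⟩
    · convert hk using 1
      push_cast
      module
    · rw [det_sub_right, det_self, sub_zero, det_neg_left, neg_ne_zero]
      exact hdet k
  obtain ⟨n, hn⟩ := exists_ne_bot hO
  have hfd := hO.finiteDimensional
  have grow : ∀ k : ℕ, ∀ u, IsKilling V u → k < Module.finrank ℂ (G (-u + n)) := by
    intro k
    induction k with
    | zero =>
      intro u hu
      obtain ⟨w, hw, hw', hd⟩ := split u hu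
      have := hw.finrank_lt_of_ne hO hU hw' hd hn
      rw [add_sub_cancel] at this
      omega
    | succ k ih =>
      intro u hu
      obtain ⟨w, hw, hw', hd⟩ := split u hu
      have h1 := ih w hw
      have hne : G (-w + n) ≠ ⊥ := fun h0 => by rw [h0, finrank_bot] at h1; omega
      obtain ⟨y, hy, hy', hd'⟩ := split _ hw'
      have h2 := hy.finrank_lt_of_ne hO hU hy' hd' hne
      rw [add_sub_cancel, show -(u - w) + (-w + n) = -u + n by abel] at h2
      omega
  obtain ⟨u, hu⟩ : ∃ u, IsKilling V u := by
    by_cases h : IsKilling V (1, 0)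
    · exact ⟨_, h⟩
    · exact ⟨_, htot (1, 0) (by simp) h⟩
  exact lt_irrefl _ (grow _ u hu)

theorem finrank_le_sum_box_of_neg (hO : IsInO G) {m : ℤ × ℤ} (hm0 : m ≠ 0)
    (hm : ¬ IsKilling V (-m)) :
    Module.finrank ℂ (G m) ≤ ∑ f ∈ box, Module.finrank ℂ (G f) :=
  (finrank_le_sum_box hO (neg_ne_zero.mpr hm0) hm m).trans_eq
    (Finset.sum_congr rfl fun f _ => by rw [show -m + f + m = f by abel])

/-- Without killing directions all dimensions are bounded by the dimensions over the box around the
origin. -/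
theorem exists_killing (hO : IsInO G) (hU : ¬ IsUniformlyBounded G) : ∃ c, IsKilling V c := by
  by_contra! hno
  refine hU ⟨max (Module.finrank ℂ (G 0)) (∑ f ∈ box, Module.finrank ℂ (G f)),
    fun m => ⟨hO.finiteDimensional m, ?_⟩⟩
  by_cases hm : m = 0
  · rw [hm]; exact le_max_left _ _
  · refine le_trans ?_ (le_max_right _ _)
    exact finrank_le_sum_box_of_neg hO hm (hno (-m))

/-- The killing directions form an open half-plane with rational boundary. The boundary is the line
of the opposite pair `±e` of non-killing directions. If one side of it contained a non-killing
direction `z`, then `finrank_le_sum_box`, applied first to a large multiple of `z` and then to the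
opposite of the degree reached, would bound all dimensions. -/
theorem exists_halfPlane (hO : IsInO G) (hU : ¬ IsUniformlyBounded G) :
    ∃ e : ℤ × ℤ, e ≠ 0 ∧ ∀ z, IsKilling V z ↔ 0 < det e z := by
  obtain ⟨e, he0, he, he'⟩ := exists_not_killing hO hU
  have hne : ∀ c, IsKilling V c → det e c ≠ 0 := by
    intro c hc hdet
    obtain ⟨a, b, ha, hab, hb⟩ : ∃ a b : ℤ, 0 < a ∧ a • e = b • c ∧ b ≠ 0 := by
      simp only [det] at hdet
      have hc0 := hc.1
      have aux : ∀ x y : ℤ, y ≠ 0 → x • c = y • e → ∃ a b : ℤ, 0 < a ∧ a • e = b • c ∧ b ≠ 0 := by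
        intro x y hy hxy
        have hx : x ≠ 0 := by
          rintro rfl
          rw [zero_smul] at hxy
          exact (smul_ne_zero hy he0) hxy.symm
        rcases hy.lt_or_gt with h | h
        · exact ⟨-y, -x, by omega, by rw [neg_smul, neg_smul, hxy], by omega⟩
        · exact ⟨y, x, h, hxy.symm, hx⟩
      by_cases h1 : c.1 = 0
      · have h2 : c.2 ≠ 0 := fun h2 => hc0 (Prod.ext h1 h2)
        refine aux e.2 c.2 h2 (Prod.ext ?_ ?_)
        · simp only [Prod.smul_fst, smul_eq_mul]; linear_combination -hdet
        · simp only [Prod.smul_snd, smul_eq_mul]; ring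
      · refine aux e.1 c.1 h1 (Prod.ext ?_ ?_)
        · simp only [Prod.smul_fst, smul_eq_mul]; ring
        · simp only [Prod.smul_snd, smul_eq_mul]; linear_combination hdet
    obtain ⟨a, rfl⟩ := Int.eq_ofNat_of_zero_le ha.le
    have ha' : 0 < a := by exact_mod_cast ha
    rcases hb.lt_or_gt with h | h
    · obtain ⟨b', hb'⟩ := Int.eq_ofNat_of_zero_le (a := -b) (by omega)
      refine he' (IsKilling.of_zsmul ha' ?_)
      have := hc.zsmul (k := b') (by omega)
      rwa [← hb', neg_smul, ← hab, ← smul_neg] at this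
    · obtain ⟨b', hb'⟩ := Int.eq_ofNat_of_zero_le h.le
      refine he (IsKilling.of_zsmul ha' ?_)
      have := hc.zsmul (k := b') (by omega)
      rwa [← hb', ← hab] at this
  have hsame : ∀ c c', IsKilling V c → IsKilling V c' → 0 < det e c → 0 < det e c' := by
    intro c c' hc hc' h
    by_contra hcon
    have hlt : det e c' < 0 := lt_of_le_of_ne (not_lt.mp hcon) (hne c' hc')
    obtain ⟨p, hp⟩ := Int.eq_ofNat_of_zero_le h.le
    obtain ⟨q, hq⟩ := Int.eq_ofNat_of_zero_le (a := -det e c') (by omega)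
    have h1 := (hc'.zsmul (k := p) (by omega)).add' hO hU (hc.zsmul (k := q) (by omega))
    refine hne _ h1 ?_
    rw [det_add_right, det_zsmul_right, det_zsmul_right, ← hp, ← hq]
    ring
  -- Choose the sign of `e`.
  obtain ⟨e, he0, hpos⟩ : ∃ e : ℤ × ℤ, e ≠ 0 ∧ ∀ c, IsKilling V c → 0 < det e c := by
    obtain ⟨c, hc⟩ := exists_killing hO hU
    rcases (hne c hc).lt_or_gt with h | h
    · refine ⟨-e, neg_ne_zero.mpr he0, fun c' hc' => ?_⟩
      rw [det_neg_left]
      by_contra hcon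
      have := hsame c' c hc' hc (lt_of_le_of_ne (by omega) (hne c' hc').symm)
      omega
    · exact ⟨e, he0, fun c' hc' => hsame c c' hc hc' h⟩
  refine ⟨e, he0, fun z => ⟨hpos z, fun hz => ?_⟩⟩
  by_contra hzk
  set M := ∑ f ∈ box, Module.finrank ℂ (G f) with hM
  have hup : ∀ m, 0 < det e m → Module.finrank ℂ (G m) ≤ M := by
    intro m hm
    have hm0 : m ≠ 0 := by rintro rfl; simp [det] at hm
    have hk : ¬ IsKilling V (-m) := fun hk => by
      have := hpos _ hk
      rw [det_neg_right] at this
      omega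
    exact finrank_le_sum_box_of_neg hO hm0 hk
  refine hU ⟨∑ f ∈ box, M, fun n => ⟨hO.finiteDimensional n, ?_⟩⟩
  set k : ℕ := ∑ f ∈ box, (det e (f + n)).natAbs + 1 with hk
  have hz0 : (k : ℤ) • z ≠ 0 := smul_ne_zero (by omega) (by rintro rfl; simp [det] at hz)
  refine (finrank_le_sum_box hO hz0 (fun h => hzk (h.of_zsmul (by omega))) n).trans ?_
  refine Finset.sum_le_sum fun f hf => hup _ ?_
  rw [add_assoc, det_add_right, det_zsmul_right]
  have h1 : (det e (f + n)).natAbs ≤ ∑ f ∈ box, (det e (f + n)).natAbs :=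
    Finset.single_le_sum (f := fun f => (det e (f + n)).natAbs) (fun _ _ => Nat.zero_le _) hf
  have h2 : (k : ℤ) ≤ k * det e z := le_mul_of_one_le_right (by omega) hz
  omega

/-- The basis of `ℤ²` formed by two vectors of determinant one; the coordinates are given by
Cramer's rule. -/
def basisOfDet (x y : ℤ × ℤ) (hxy : det y x = 1) : Module.Basis (Fin 2) ℤ (ℤ × ℤ) :=
  Module.Basis.ofEquivFun
    { toFun := fun z => ![det y z, det z x]
      map_add' := fun z w => by ext i; fin_cases i <;> simp [det] <;> ring
      map_smul' := fun a z => by ext i; fin_cases i <;> simp [det] <;> ring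
      invFun := fun c => c 0 • x + c 1 • y
      left_inv := fun z => by
        simp only [det] at hxy
        refine Prod.ext ?_ ?_ <;> simp [det]
        · linear_combination z.1 * hxy
        · linear_combination z.2 * hxy
      right_inv := fun c => by
        simp only [det] at hxy
        ext i
        fin_cases i <;> simp [det]
        · linear_combination c 0 * hxy
        · linear_combination c 1 * hxy }

theorem basisOfDet_repr_zero (x y : ℤ × ℤ) (hxy : det y x = 1) (z : ℤ × ℤ) :
    (basisOfDet x y hxy).repr z 0 = det y z := by
  rw [← Module.Basis.equivFun_apply]; simp [basisOfDet]

theorem exists_det_eq_one (e : ℤ × ℤ) (he : e ≠ 0) :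
    ∃ (g : ℤ) (x y : ℤ × ℤ), 0 < g ∧ e = g • y ∧ det y x = 1 := by
  have hg : 0 < Int.gcd e.1 e.2 := by
    refine Int.gcd_pos_iff.mpr ?_
    by_contra! h
    exact he (Prod.ext h.1 h.2)
  obtain ⟨p, q, hpq, h1, h2⟩ := Int.exists_gcd_one hg
  have hb := Int.gcd_eq_gcd_ab p q
  rw [Int.isCoprime_iff_gcd_eq_one.mp (by simpa [Int.isCoprime_iff_gcd_eq_one] using hpq)] at hb
  refine ⟨Int.gcd e.1 e.2, (-Int.gcdB p q, Int.gcdA p q), (p, q), by exact_mod_cast hg,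
    Prod.ext (h1.trans (mul_comm _ _)) (h2.trans (mul_comm _ _)), ?_⟩
  · simp only [det]
    push_cast at hb
    linarith

/-- A module in `𝒪_{ℤ²}` that is not uniformly bounded has a top level with respect to some basis:
towards the side of the killing directions, dimensions decrease strictly until they vanish. -/
theorem exists_top (hO : IsInO G) (hU : ¬ IsUniformlyBounded G) :
    ∃ (b : Module.Basis (Fin 2) ℤ (ℤ × ℤ)) (n₀ : ℤ × ℤ), G n₀ ≠ ⊥ ∧
      (∀ n, b.repr n₀ 0 < b.repr n 0 → G n = ⊥) ∧ ∀ z, 0 < b.repr z 0 → IsKilling V z := by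
  obtain ⟨e, he0, he⟩ := exists_halfPlane hO hU
  obtain ⟨g, x, y, hg, rfl, hxy⟩ := exists_det_eq_one e he0
  have hfd := hO.finiteDimensional
  have hk : ∀ z, IsKilling V z ↔ 0 < det y z := fun z => by
    rw [he, det_zsmul_left, mul_pos_iff_of_pos_left hg]
  refine ⟨basisOfDet x y hxy, ?_⟩
  simp only [basisOfDet_repr_zero]
  have h₁ : IsKilling V (x + y) := by
    rw [hk, det_add_right, det_self, hxy]; norm_num
  have h₂ : IsKilling V (x - y) := by
    rw [hk, det_sub_right, det_self, hxy]; norm_num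
  have hd : det (x + y) (x - y) ≠ 0 := by
    have : det (x + y) (x - y) = 2 * det y x := by simp [det]; ring
    rw [this, hxy]; norm_num
  obtain ⟨n, hn⟩ := exists_ne_bot hO
  have decay : ∀ k : ℕ, ∀ m, det y n + 2 * k < det y m → G m ≠ ⊥ →
      Module.finrank ℂ (G m) + k ≤ Module.finrank ℂ (G n) := by
    intro k
    induction k with
    | zero =>
      intro m hm _
      have hkm : IsKilling V (m - n) := by rw [hk, det_sub_right]; push_cast at hm; omega
      have := hkm.finrank_le hO hU m
      rwa [neg_sub, sub_add_cancel] at this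
    | succ k ih =>
      intro m hm hm0
      have h1 := h₁.finrank_lt_of_ne hO hU h₂ hd hm0
      have hne : G (-(x + y + (x - y)) + m) ≠ ⊥ := fun h0 => by
        rw [h0, finrank_bot] at h1; omega
      have h2 := ih _ (by
        rw [det_add_right, det_neg_right, det_add_right, det_add_right, det_sub_right, det_self,
          hxy]
        push_cast at hm
        omega) hne
      omega
  obtain ⟨j, ⟨n₀, hn₀, rfl⟩, hj⟩ := Int.exists_greatest_of_bdd
    (P := fun j => ∃ m, G m ≠ ⊥ ∧ det y m = j)
    ⟨det y n + 2 * (Module.finrank ℂ (G n) : ℕ), by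
      rintro j ⟨m, hm, rfl⟩
      by_contra! hlt
      have h1 := decay _ m hlt hm
      exact hm (Submodule.finrank_eq_zero.mp (by omega))⟩ ⟨_, n, hn, rfl⟩
  refine ⟨n₀, hn₀, fun m hm => ?_, fun z => (hk z).mpr⟩
  by_contra hm0
  exact absurd (hj _ ⟨m, hm0, rfl⟩) (by omega)

end

/-! ### The triangular decomposition with respect to a basis -/

section Triangular

variable (b : Module.Basis (Fin 2) ℤ (ℤ × ℤ))

/-- The element `D(j 𝐛₁ + x 𝐛₂)`. -/
def Db (j x : ℤ) : L := D (j • b 0 + x • b 1)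

/-- The determinant of a basis. -/
def bdet : ℤ := det (b 0) (b 1)

theorem bdet_ne_zero : bdet b ≠ 0 := by
  intro h0
  have h1 : ∀ z : ℤ × ℤ, z = b.repr z 0 • b 0 + b.repr z 1 • b 1 := fun z => by
    conv_lhs => rw [← b.sum_repr z]
    rw [Fin.sum_univ_two]
  have h2 : det ((1, 0) : ℤ × ℤ) (0, 1) = 0 := by
    rw [h1 (1, 0), h1 (0, 1)]
    simp only [det_add_left, det_add_right, det_zsmul_left, det_zsmul_right, det_self]
    rw [det_swap (b 1) (b 0), show det (b 0) (b 1) = 0 from h0]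
    ring
  simp [det] at h2

theorem bdet_ne_zero' : (bdet b : ℂ) ≠ 0 := by exact_mod_cast bdet_ne_zero b

theorem repr_add_smul (j x : ℤ) (i : Fin 2) :
    b.repr (j • b 0 + x • b 1) i = if i = 0 then j else x := by
  fin_cases i <;> simp [-zsmul_eq_mul]

theorem eq_repr (z : ℤ × ℤ) : z = b.repr z 0 • b 0 + b.repr z 1 • b 1 := by
  conv_lhs => rw [← b.sum_repr z]
  rw [Fin.sum_univ_two]

theorem D_eq_Db (z : ℤ × ℤ) : D z = Db b (b.repr z 0) (b.repr z 1) := by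
  rw [Db, ← eq_repr]

theorem det_Db (j x k y : ℤ) :
    det (j • b 0 + x • b 1) (k • b 0 + y • b 1) = (j * y - k * x) * bdet b := by
  simp only [det_add_left, det_add_right, det_zsmul_left, det_zsmul_right, det_self, bdet]
  rw [det_swap (b 1) (b 0)]
  ring

theorem smul_basis_eq_zero {j x : ℤ} : j • b 0 + x • b 1 = 0 ↔ j = 0 ∧ x = 0 := by
  constructor
  · intro h0
    have h1 := repr_add_smul b j x 0
    have h2 := repr_add_smul b j x 1
    rw [h0] at h1 h2
    simp at h1 h2
    exact ⟨h1.symm, h2.symm⟩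
  · rintro ⟨rfl, rfl⟩
    simp

theorem Db_zero : Db b 0 0 = 0 := by simp [Db]

theorem h_zsmul (k : ℤ) (m : ℤ × ℤ) : h (k • m) = (k : ℂ) • h m := by
  simp only [h, ← map_smul]; simp

variable {M : Type*} [AddCommGroup M] [Module ℂ M] [LieRingModule L M] [LieModule ℂ L M]

theorem lie_Db_lie_Db (j x k y : ℤ) (w : M) :
    ⁅Db b j x, ⁅Db b k y, w⁆⁆ = -((((j * y - k * x) * bdet b : ℤ) : ℂ)) • ⁅Db b (j + k) (x + y), w⁆ +
      (if j + k = 0 ∧ x + y = 0 then (j : ℂ) • ⁅h (b 0), w⁆ + (x : ℂ) • ⁅h (b 1), w⁆ else 0) +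
      ⁅Db b k y, ⁅Db b j x, w⁆⁆ := by
  have e : j • b 0 + x • b 1 + (k • b 0 + y • b 1) = (j + k) • b 0 + (x + y) • b 1 := by module
  simp only [Db]
  rw [lie_D_lie_D, det_Db, e]
  simp only [smul_basis_eq_zero, h_add, h_zsmul, add_lie, smul_lie]

theorem lie_Db_lie_Db_of_ne {j x k y : ℤ} (hne : j + k ≠ 0) (w : M) :
    ⁅Db b j x, ⁅Db b k y, w⁆⁆ = -((((j * y - k * x) * bdet b : ℤ) : ℂ)) • ⁅Db b (j + k) (x + y), w⁆ +
      ⁅Db b k y, ⁅Db b j x, w⁆⁆ := by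
  rw [lie_Db_lie_Db, if_neg (fun h => hne h.1), add_zero]

theorem lie_h_comm (m : ℤ × ℤ) (x : L) (w : M) : ⁅h m, ⁅x, w⁆⁆ = ⁅x, ⁅h m, w⁆⁆ := by
  rw [leibniz_lie, h, lie_cen_left, zero_lie, zero_add]

/-- The vectors obtained from those of `S` by applying elements `D(j 𝐛₁ + x 𝐛₂)` with `j < 0`. -/
inductive Low (S : Submodule ℂ M) : M → Prop
  | base (w : M) (hw : w ∈ S) : Low S w
  | step (j x : ℤ) (hj : j < 0) (w : M) (hw : Low S w) : Low S ⁅Db b j x, w⁆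

/-- If `S` is annihilated by `L_+` and stable under `L_0`, then the submodule generated by `S` is
`U(L_-) S`, so that it adds to `S` only vectors of lower levels. -/
theorem lieSpan_le_of_top {Lv : ℤ → Submodule ℂ M} {n₀ : ℤ}
    (hLv : ∀ j x n, ∀ w ∈ Lv n, ⁅Db b j x, w⁆ ∈ Lv (j + n)) {S : Submodule ℂ M} (hS : S ≤ Lv n₀)
    (hS₀ : ∀ x, ∀ w ∈ S, ⁅Db b 0 x, w⁆ ∈ S) (hSh : ∀ m, ∀ w ∈ S, ⁅h m, w⁆ ∈ S)
    (hSp : ∀ j x, 0 < j → ∀ w ∈ S, ⁅Db b j x, w⁆ = 0) :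
    (LieSubmodule.lieSpan ℂ L (S : Set M)).toSubmodule ≤ S ⊔ ⨆ n : {n : ℤ // n < n₀}, Lv n := by
  have hh : ∀ m w, Low b S w → Low b S ⁅h m, w⁆ := by
    intro m w hw
    induction hw with
    | base w hw => exact .base _ (hSh m w hw)
    | step j x hj w _ ih => rw [lie_h_comm]; exact .step j x hj _ ih
  set N := Submodule.span ℂ {w | Low b S w} with hN
  have hsub : ∀ {w}, Low b S w → w ∈ N := fun hw => Submodule.subset_span hw
  have hneg : ∀ j x, j < 0 → ∀ w ∈ N, ⁅Db b j x, w⁆ ∈ N := by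
    intro j x hj w hw
    induction hw using Submodule.span_induction with
    | mem w hw => exact hsub (.step j x hj w hw)
    | zero => rw [lie_zero]; exact zero_mem _
    | add x y _ _ hx hy => rw [lie_add]; exact add_mem hx hy
    | smul c x _ hx => rw [lie_smul]; exact N.smul_mem c hx
  have hstep : ∀ w, Low b S w → ∀ j x, ⁅Db b j x, w⁆ ∈ N := by
    intro w hw
    induction hw with
    | base w hw =>
      intro j x
      rcases lt_trichotomy j 0 with hj | rfl | hj
      · exact hsub (.step j x hj w (.base w hw))
      · exact hsub (.base _ (hS₀ x w hw))
      · rw [hSp j x hj w hw]; exact zero_mem _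
    | step i y hi w hw ih =>
      intro j x
      rw [lie_Db_lie_Db]
      refine add_mem (add_mem (N.smul_mem _ (ih _ _)) ?_) (hneg i y hi _ (ih _ _))
      split_ifs
      · exact add_mem (N.smul_mem _ (hsub (hh _ _ hw))) (N.smul_mem _ (hsub (hh _ _ hw)))
      · exact zero_mem _
  have hD : ∀ m, ∀ w ∈ N, ⁅D m, w⁆ ∈ N := by
    intro m w hw
    rw [D_eq_Db b]
    induction hw using Submodule.span_induction with
    | mem w hw => exact hstep w hw _ _
    | zero => rw [lie_zero]; exact zero_mem _
    | add x y _ _ hx hy => rw [lie_add]; exact add_mem hx hy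
    | smul c x _ hx => rw [lie_smul]; exact N.smul_mem c hx
  have h1 : LieSubmodule.lieSpan ℂ L (S : Set M) ≤ subOfD N hD :=
    LieSubmodule.lieSpan_le.mpr fun w hw => hsub (.base w hw)
  have h2 : ∀ w, Low b S w → w ∈ S ∨ ∃ n < n₀, w ∈ Lv n := by
    intro w hw
    induction hw with
    | base w hw => exact .inl hw
    | step j x hj w _ ih =>
      right
      rcases ih with hw | ⟨n, hn, hw⟩
      · exact ⟨j + n₀, by omega, hLv j x _ w (hS hw)⟩
      · exact ⟨j + n, by omega, hLv j x _ w hw⟩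
  refine le_trans (show _ ≤ N from h1) (Submodule.span_le.mpr fun w hw => ?_)
  rcases h2 w hw with h | ⟨n, hn, h⟩
  · exact Submodule.mem_sup_left h
  · exact Submodule.mem_sup_right (Submodule.mem_iSup_of_mem (⟨n, hn⟩ : {n : ℤ // n < n₀}) h)

end Triangular

/-! ### Heisenberg algebras of nonzero level -/

section Heisenberg

variable {V : Type*} [AddCommGroup V] [Module ℂ V]

theorem exists_eigenvector_mem (N : Module.End ℂ V) {U : Submodule ℂ V} [FiniteDimensional ℂ U]
    (hU : U ≠ ⊥) (hN : ∀ w ∈ U, N w ∈ U) : ∃ (ν : ℂ) (v : V), v ∈ U ∧ v ≠ 0 ∧ N v = ν • v := by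
  have : Nontrivial U := Submodule.nontrivial_iff_ne_bot.mpr hU
  obtain ⟨ν, hν⟩ := Module.End.exists_eigenvalue (N.restrict hN)
  obtain ⟨v, hv⟩ := hν.exists_hasEigenvector
  exact ⟨ν, v, v.2, by simpa using hv.2, congrArg Subtype.val hv.apply_eq_smul⟩

variable {E : ℤ → Module.End ℂ V} {μ : ℂ}

theorem number_op_pow
    (hE : ∀ k l w, E k (E l w) = (if k + l = 0 then (k : ℂ) * μ else 0) • w + E l (E k w))
    {k ε : ℤ} (hε : ε = 1 ∨ ε = -1) {ν : ℂ} {w : V}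
    (hw : E (-k) (E k w) = ν • w) (c : ℕ) :
    E (-k) (E k ((E (ε * k) ^ c) w)) = (ν - ε * c * k * μ) • (E (ε * k) ^ c) w := by
  induction c with
  | zero => simpa using hw
  | succ c ih =>
    rw [pow_succ', Module.End.mul_apply]
    generalize (E (ε * k) ^ c) w = y at ih ⊢
    rcases hε with rfl | rfl
    · rw [one_mul] at ⊢
      rw [hE (-k) k (E k y), if_pos (neg_add_cancel k), ih, map_smul, ← add_smul]
      congr 1
      push_cast
      ring
    · rw [neg_one_mul]
      rw [hE k (-k) y, if_pos (add_neg_cancel k), map_add, map_smul, ih, map_smul, ← add_smul]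
      congr 1
      push_cast
      ring

/-- For an eigenvector of the number operator `E₋ₖ Eₖ`, either all powers of `Eₖ` or all powers of
`E₋ₖ` produce nonzero vectors; which one depends on the eigenvalue only. -/
theorem exists_sign
    (hE : ∀ k l w, E k (E l w) = (if k + l = 0 then (k : ℂ) * μ else 0) • w + E l (E k w))
    (hμ : μ ≠ 0) {k : ℤ} (hk : k ≠ 0) (ν : ℂ) :
    ∃ ε : ℤ, (ε = 1 ∨ ε = -1) ∧ ∀ w : V, w ≠ 0 → E (-k) (E k w) = ν • w →
      ∀ c : ℕ, (E (ε * k) ^ c) w ≠ 0 := by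
  have hk' : (k : ℂ) ≠ 0 := by exact_mod_cast hk
  by_cases hν : ∃ c : ℕ, ν = c * k * μ
  · obtain ⟨c₀, hc₀⟩ := hν
    refine ⟨-1, .inr rfl, fun w hw0 hw c => ?_⟩
    induction c with
    | zero => simpa using hw0
    | succ c ih =>
      rw [pow_succ', Module.End.mul_apply]
      have hy := number_op_pow hE (.inr rfl) hw c
      rw [neg_one_mul] at *
      intro h0
      have h1 := hE k (-k) ((E (-k) ^ c) w)
      rw [h0, map_zero, if_pos (add_neg_cancel k), hy, ← add_smul] at h1
      refine (smul_ne_zero ?_ ih) h1.symm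
      rw [hc₀]
      have : ((c₀ + c + 1 : ℕ) : ℂ) ≠ 0 := by exact_mod_cast Nat.succ_ne_zero (c₀ + c)
      have h2 := mul_ne_zero (mul_ne_zero this hk') hμ
      push_cast at h2 ⊢
      convert h2 using 1
      ring
  · push Not at hν
    refine ⟨1, .inl rfl, fun w hw0 hw c => ?_⟩
    induction c with
    | zero => simpa using hw0
    | succ c ih =>
      rw [pow_succ', Module.End.mul_apply]
      have hy := number_op_pow hE (.inl rfl) hw c
      rw [one_mul] at *
      intro h0
      rw [h0, map_zero] at hy
      refine (smul_ne_zero ?_ ih) hy.symm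
      rw [sub_ne_zero]
      simpa using hν c

/-- A `ℤ`-graded representation of the Heisenberg algebra of nonzero level has homogeneous
subspaces of unbounded dimension: two number operators have a common eigenvector, and the
elements of degrees `±1` and `±2` move it to many joint eigenvectors of the same degree. -/
theorem heisenberg_level_eq_zero
    (hE : ∀ k l w, E k (E l w) = (if k + l = 0 then (k : ℂ) * μ else 0) • w + E l (E k w))
    {T : ℤ → Submodule ℂ V} (hfd : ∀ l, FiniteDimensional ℂ (T l))
    (hT : ∀ k l, ∀ w ∈ T l, E k w ∈ T (l + k)) {B : ℕ} (hB : ∀ l, Module.finrank ℂ (T l) ≤ B)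
    {l : ℤ} (hl : T l ≠ ⊥) : μ = 0 := by
  by_contra hμ
  have hpow : ∀ (k : ℤ) (c : ℕ) (l : ℤ), ∀ w ∈ T l, (E k ^ c) w ∈ T (l + c * k) := by
    intro k c
    induction c with
    | zero => intro l w hw; simpa using hw
    | succ c ih =>
      intro l w hw
      rw [pow_succ', Module.End.mul_apply]
      have := hT k _ _ (ih l w hw)
      rwa [show l + (c : ℤ) * k + k = l + ((c + 1 : ℕ) : ℤ) * k by push_cast; ring] at this
  have hN : ∀ k l, ∀ w ∈ T l, E (-k) (E k w) ∈ T l := fun k l w hw => by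
    have := hT (-k) _ _ (hT k _ _ hw)
    rwa [add_neg_cancel_right] at this
  have hcomm : ∀ k l w, k + l ≠ 0 → E k (E l w) = E l (E k w) := fun k l w h => by
    rw [hE, if_neg h, zero_smul, zero_add]
  obtain ⟨ν₁, v₁, hv₁, hv₁0, hν₁⟩ := exists_eigenvector_mem (E (-1) * E 1) hl (hN 1 l)
  have hUfd : FiniteDimensional ℂ ↥(T l ⊓ Module.End.eigenspace (E (-1) * E 1) ν₁) :=
    Submodule.finiteDimensional_of_le (S₂ := T l) inf_le_left
  obtain ⟨ν₂, v, hv, hv0, hν₂⟩ := exists_eigenvector_mem (E (-2) * E 2)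
    (U := T l ⊓ Module.End.eigenspace (E (-1) * E 1) ν₁)
    ((Submodule.ne_bot_iff _).mpr ⟨v₁, ⟨hv₁, Module.End.mem_eigenspace_iff.mpr hν₁⟩, hv₁0⟩) (by
      rintro w ⟨hw, hw'⟩
      refine ⟨hN 2 l w hw, ?_⟩
      rw [SetLike.mem_coe, Module.End.mem_eigenspace_iff] at hw' ⊢
      rw [← map_smul, ← hw']
      simp only [Module.End.mul_apply]
      rw [hcomm 1 (-2) _ (by norm_num), hcomm (-1) (-2) _ (by norm_num), hcomm 1 2 _ (by norm_num),
        hcomm (-1) 2 _ (by norm_num)])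
  have hν₁' := Module.End.mem_eigenspace_iff.mp hv.2
  obtain ⟨ε₁, hε₁, h₁⟩ := exists_sign hE hμ one_ne_zero ν₁
  obtain ⟨ε₂, hε₂, h₂⟩ := exists_sign hE hμ two_ne_zero ν₂
  -- The exponents are chosen so that all vectors have the same degree.
  let c₁ : ℕ → ℕ := fun c => if ε₁ = ε₂ then 2 * (B - c) else 2 * c
  have hmid : ∀ n : ℕ, E (-2) (E 2 ((E (ε₁ * 1) ^ n) v)) = ν₂ • (E (ε₁ * 1) ^ n) v := by
    intro n
    induction n with
    | zero => simpa using hν₂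
    | succ n ih =>
      rw [pow_succ', Module.End.mul_apply, hcomm 2 _ _ (by omega), hcomm (-2) _ _ (by omega), ih,
        map_smul]
  let y : Fin (B + 1) → V := fun c => (E (ε₂ * 2) ^ (c : ℕ)) ((E (ε₁ * 1) ^ (c₁ c)) v)
  have hy0 : ∀ c, y c ≠ 0 := fun c => h₂ _ (h₁ v hv0 hν₁' _) (hmid _) _
  have hyN : ∀ c, (E (-2) * E 2) (y c) = (ν₂ - ε₂ * (c : ℕ) * (2 : ℤ) * μ) • y c := fun c =>
    number_op_pow hE hε₂ (hmid _) _
  have hli : LinearIndependent ℂ y := by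
    refine Module.End.eigenvectors_linearIndependent' (E (-2) * E 2)
      (fun c : Fin (B + 1) => ν₂ - ε₂ * (c : ℕ) * (2 : ℤ) * μ) (fun c c' hcc => ?_) y
      (fun c => ⟨Module.End.mem_eigenspace_iff.mpr (hyN c), hy0 c⟩)
    have hε : (ε₂ : ℂ) ≠ 0 := by rcases hε₂ with rfl | rfl <;> simp
    have h3 : (ε₂ : ℂ) * 2 * μ ≠ 0 := mul_ne_zero (mul_ne_zero hε two_ne_zero) hμ
    have h4 : ((ε₂ : ℂ) * 2 * μ) * ((c : ℕ) : ℂ) = ((ε₂ : ℂ) * 2 * μ) * ((c' : ℕ) : ℂ) := by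
      simp only at hcc
      push_cast at hcc
      linear_combination -hcc
    exact Fin.ext (by exact_mod_cast mul_left_cancel₀ h3 h4)
  set d : ℤ := if ε₁ = ε₂ then l + 2 * B * ε₂ else l with hd
  have hyT : ∀ c, y c ∈ T d := by
    intro c
    have h3 := hpow (ε₂ * 2) c _ _ (hpow (ε₁ * 1) (c₁ c) l v hv.1)
    convert h3 using 2
    have hc : (c : ℕ) ≤ B := Nat.lt_succ_iff.mp c.2
    simp only [hd, c₁]
    split_ifs with h4
    · rw [h4]; push_cast [hc]; ring
    · have : ε₁ = -ε₂ := by omega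
      rw [this]; push_cast; ring
  have hli' : LinearIndependent ℂ (fun c => (⟨y c, hyT c⟩ : T d)) :=
    LinearIndependent.of_comp (T d).subtype hli
  have := hli'.fintype_card_le_finrank
  rw [Fintype.card_fin] at this
  have := hB d
  omega

end Heisenberg

/-! ### Graded irreducible modules over commuting operators -/

section Commuting

variable {V : Type*} [AddCommGroup V] [Module ℂ V] {E : ℤ → Module.End ℂ V}

/-- Products of the operators `E x`, together with the sum of the indices of their factors. -/
inductive EWord (E : ℤ → Module.End ℂ V) : ℤ → Module.End ℂ V → Prop
  | one : EWord E 0 1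
  | mul (x k : ℤ) (X : Module.End ℂ V) (hX : EWord E k X) : EWord E (x + k) (E x * X)

/-- The span of the products of degree `k`. -/
def wordSpan (E : ℤ → Module.End ℂ V) (k : ℤ) : Submodule ℂ (Module.End ℂ V) :=
  Submodule.span ℂ {X | EWord E k X}

theorem EWord.append {k l : ℤ} {X Y : Module.End ℂ V} (hX : EWord E k X) (hY : EWord E l Y) :
    EWord E (k + l) (X * Y) := by
  induction hX with
  | one => simpa using hY
  | mul x k X _ ih => rw [add_assoc, mul_assoc]; exact .mul x _ _ ih

theorem wordSpan_mul {k l : ℤ} {X Y : Module.End ℂ V} (hX : X ∈ wordSpan E k)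
    (hY : Y ∈ wordSpan E l) : X * Y ∈ wordSpan E (k + l) := by
  induction hX, hY using Submodule.span_induction₂ with
  | mem_mem x y hx hy => exact Submodule.subset_span (EWord.append hx hy)
  | zero_left => rw [zero_mul]; exact zero_mem _
  | zero_right => rw [mul_zero]; exact zero_mem _
  | add_left x y z _ _ _ h1 h2 => rw [add_mul]; exact add_mem h1 h2
  | add_right x y z _ _ _ h1 h2 => rw [mul_add]; exact add_mem h1 h2
  | smul_left a x y _ _ h1 => rw [smul_mul_assoc]; exact Submodule.smul_mem _ _ h1
  | smul_right a x y _ _ h1 => rw [mul_smul_comm]; exact Submodule.smul_mem _ _ h1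

theorem single_mem_wordSpan (x : ℤ) : E x ∈ wordSpan E x := by
  have := EWord.mul (E := E) x 0 1 .one
  rw [add_zero, mul_one] at this
  exact Submodule.subset_span this

theorem wordSpan_pow {k : ℤ} {X : Module.End ℂ V} (hX : X ∈ wordSpan E k) (n : ℕ) :
    X ^ n ∈ wordSpan E (n * k) := by
  induction n with
  | zero => rw [pow_zero, Nat.cast_zero, zero_mul]; exact Submodule.subset_span .one
  | succ n ih =>
    rw [pow_succ', show ((n + 1 : ℕ) : ℤ) * k = k + n * k by push_cast; ring]
    exact wordSpan_mul hX ih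

theorem EWord.commute {k : ℤ} {X Y : Module.End ℂ V}
    (hX : EWord E k X) (hY : ∀ x, Commute (E x) Y) : Commute X Y := by
  induction hX with
  | one => exact Commute.one_left _
  | mul x k X _ ih => exact (hY x).mul_left ih

theorem wordSpan_commute_of {k : ℤ} {X Y : Module.End ℂ V}
    (hX : X ∈ wordSpan E k) (hY : ∀ x, Commute (E x) Y) : Commute X Y := by
  induction hX using Submodule.span_induction with
  | mem x hx => exact EWord.commute hx hY
  | zero => exact Commute.zero_left _
  | add x y _ _ hx hy => exact hx.add_left hy
  | smul c x _ hx => exact hx.smul_left c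

theorem wordSpan_commute (hE : ∀ k l, Commute (E k) (E l)) {k l : ℤ} {X Y : Module.End ℂ V}
    (hX : X ∈ wordSpan E k) (hY : Y ∈ wordSpan E l) : Commute X Y :=
  wordSpan_commute_of hX fun x =>
    (wordSpan_commute_of hY fun y => hE y x).symm

theorem wordSpan_apply_mem {T : ℤ → Submodule ℂ V} (hT : ∀ k l, ∀ w ∈ T l, E k w ∈ T (l + k))
    {k l : ℤ} {X : Module.End ℂ V} (hX : X ∈ wordSpan E k) {w : V} (hw : w ∈ T l) :
    X w ∈ T (l + k) := by
  have key : ∀ k X, EWord E k X → X w ∈ T (l + k) := by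
    intro k X hX
    induction hX with
    | one => simpa using hw
    | mul x k X _ ih =>
      have := hT x _ _ ih
      rwa [show l + k + x = l + (x + k) by ring] at this
  induction hX using Submodule.span_induction with
  | mem x hx => exact key k x hx
  | zero => exact zero_mem _
  | add x y _ _ hx hy => exact add_mem hx hy
  | smul c x _ hx => exact Submodule.smul_mem _ c hx

/-- A graded irreducible module over commuting operators `E x` of degree `x`, with finite
dimensional homogeneous subspaces, has a basis `u l`, `l ∈ sℤ`, on which `E x` acts as a scalar
multiple of the shift by `x`. Degree zero products act as scalars by Schur's lemma, so that products
of degree `s` and `-s` may be chosen inverse to each other; their powers generate the basis. -/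
theorem exists_shift_basis (hE : ∀ k l, Commute (E k) (E l)) {T : ℤ → Submodule ℂ V}
    (hfd : ∀ l, FiniteDimensional ℂ (T l)) (hT : ∀ k l, ∀ w ∈ T l, E k w ∈ T (l + k))
    (h0 : T 0 ≠ ⊥)
    (hirr : ∀ l, ∀ w ∈ T l, w ≠ 0 → ∀ m, ∀ y ∈ T m, ∃ X ∈ wordSpan E (m - l), X w = y) :
    ∃ (s : ℤ) (u : ℤ → V) (ψ : ℤ → ℂ), (∀ l, u l ∈ T l) ∧ (∀ l, T l ≤ ℂ ∙ u l) ∧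
      (∀ l, u l ≠ 0 ↔ s ∣ l) ∧ (∀ x l, E x (u l) = ψ x • u (l + x)) ∧ ∀ x, ψ x ≠ 0 → s ∣ x := by
  have hscal : ∀ X ∈ wordSpan E 0, ∃ c : ℂ, ∀ l, ∀ w ∈ T l, X w = c • w := by
    intro X hX
    obtain ⟨c, v, hv, hv0, hc⟩ := exists_eigenvector_mem X h0 fun w hw => by
      simpa using wordSpan_apply_mem hT hX hw
    refine ⟨c, fun l w hw => ?_⟩
    obtain ⟨Y, hY, rfl⟩ := hirr 0 v hv hv0 l w hw
    have := LinearMap.congr_fun (wordSpan_commute hE hX hY).eq v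
    simp only [Module.End.mul_apply] at this
    rw [this, hc, map_smul]
  have hinj : ∀ k, ∀ X ∈ wordSpan E k, ∀ l, ∀ w ∈ T l, w ≠ 0 → X w = 0 → ∀ m, ∀ y ∈ T m,
      X y = 0 := by
    intro k X hX l w hw hw0 hXw m y hy
    obtain ⟨Y, hY, rfl⟩ := hirr l w hw hw0 m y hy
    have := LinearMap.congr_fun (wordSpan_commute hE hX hY).eq w
    simp only [Module.End.mul_apply] at this
    rw [this, hXw, map_zero]
  obtain ⟨w₀, hw₀, hw₀0⟩ := (Submodule.ne_bot_iff _).mp h0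
  let Z : AddSubgroup ℤ :=
    { carrier := {l | T l ≠ ⊥}
      zero_mem' := h0
      add_mem' := by
        intro l m hl hm
        obtain ⟨y, hy, hy0⟩ := (Submodule.ne_bot_iff _).mp hl
        obtain ⟨y', hy', hy'0⟩ := (Submodule.ne_bot_iff _).mp hm
        obtain ⟨X, hX, hXy⟩ := hirr 0 w₀ hw₀ hw₀0 l y hy
        refine (Submodule.ne_bot_iff _).mpr ⟨X y', ?_, fun hcon => ?_⟩
        · have := wordSpan_apply_mem hT hX hy'
          rwa [sub_zero, add_comm] at this
        · exact hy0 (hXy ▸ hinj _ X hX m y' hy' hy'0 hcon 0 w₀ hw₀)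
      neg_mem' := by
        intro l hl
        obtain ⟨y, hy, hy0⟩ := (Submodule.ne_bot_iff _).mp hl
        obtain ⟨X, hX, hXy⟩ := hirr l y hy hy0 0 w₀ hw₀
        refine (Submodule.ne_bot_iff _).mpr ⟨X w₀, ?_, fun hcon => ?_⟩
        · have := wordSpan_apply_mem hT hX hw₀
          rwa [zero_add, zero_sub] at this
        · exact hw₀0 (hXy ▸ hinj _ X hX 0 w₀ hw₀ hw₀0 hcon l y hy) }
  obtain ⟨s, hs⟩ := Int.subgroup_cyclic Z
  have hdvd : ∀ l, T l ≠ ⊥ ↔ s ∣ l := fun l => by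
    rw [← Int.mem_zmultiples_iff, AddSubgroup.zmultiples_eq_closure, ← hs]; rfl
  obtain ⟨y, hy, hy0⟩ := (Submodule.ne_bot_iff _).mp ((hdvd s).mpr dvd_rfl)
  obtain ⟨X, hX, hXy⟩ := hirr 0 w₀ hw₀ hw₀0 s y hy
  obtain ⟨Y, hY, hYy⟩ := hirr s y hy hy0 0 w₀ hw₀
  rw [sub_zero] at hX
  rw [zero_sub] at hY
  have hYX : ∀ l, ∀ w ∈ T l, X (Y w) = w := by
    obtain ⟨c, hc⟩ := hscal (X * Y) (by simpa using wordSpan_mul hX hY)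
    have h1 := LinearMap.congr_fun (wordSpan_commute hE hX hY).eq w₀
    rw [hc 0 w₀ hw₀, Module.End.mul_apply, hXy, hYy] at h1
    have hc1 : c = 1 := by
      have : (c - 1) • w₀ = 0 := by rw [sub_smul, h1, one_smul, sub_self]
      exact sub_eq_zero.mp ((smul_eq_zero.mp this).resolve_right hw₀0)
    intro l w hw
    have := hc l w hw
    rwa [hc1, one_smul] at this
  let p : ℤ → V := fun n => if 0 ≤ n then (X ^ n.toNat) w₀ else (Y ^ (-n).toNat) w₀
  have hpT : ∀ n, p n ∈ T (n * s) := by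
    intro n
    simp only [p]
    split_ifs with hn
    · have := wordSpan_apply_mem hT (wordSpan_pow hX n.toNat) hw₀
      rwa [zero_add, Int.toNat_of_nonneg hn] at this
    · have := wordSpan_apply_mem hT (wordSpan_pow hY (-n).toNat) hw₀
      rwa [zero_add, Int.toNat_of_nonneg (by omega), neg_mul_neg] at this
  have hXp : ∀ n, X (p n) = p (n + 1) := by
    intro n
    rcases lt_trichotomy n (-1) with hn | rfl | hn
    · obtain ⟨k, rfl⟩ : ∃ k : ℕ, n = -(k + 2 : ℕ) := ⟨(-n - 2).toNat, by omega⟩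
      simp only [p]
      rw [if_neg (by omega), if_neg (by omega), show (-(-((k + 2 : ℕ) : ℤ))).toNat = k + 1 + 1 by omega,
        show (-(-((k + 2 : ℕ) : ℤ) + 1)).toNat = k + 1 by omega, pow_succ', Module.End.mul_apply]
      exact hYX _ _ (wordSpan_apply_mem hT (wordSpan_pow hY _) hw₀)
    · simpa [p] using hYX 0 w₀ hw₀
    · simp only [p]
      rw [if_pos (by omega), if_pos (by omega), show (n + 1).toNat = n.toNat + 1 by omega, pow_succ',
        Module.End.mul_apply]
  have hXinj : ∀ l, ∀ w ∈ T l, X w = 0 → w = 0 := by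
    intro l w hw hXw
    by_contra hw0
    exact hy0 (hXy ▸ hinj s X hX l w hw hw0 hXw 0 w₀ hw₀)
  have hp0 : ∀ n, p n ≠ 0 := by
    intro n
    induction n with
    | zero => simpa [p] using hw₀0
    | succ n ih => exact fun hcon => ih (hXinj _ _ (hpT _) (by rw [hXp, hcon]))
    | pred n ih =>
      intro hcon
      apply ih
      have := hXp (-n - 1)
      rwa [hcon, map_zero, sub_add_cancel, eq_comm] at this
  have hspan : ∀ n, T (n * s) ≤ ℂ ∙ p n := by
    intro n y hy
    obtain ⟨Z, hZ, rfl⟩ := hirr _ _ (hpT n) (hp0 n) _ y hy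
    rw [sub_self] at hZ
    obtain ⟨c, hc⟩ := hscal Z hZ
    rw [hc _ _ (hpT n)]
    exact Submodule.smul_mem _ _ (Submodule.mem_span_singleton_self _)
  have hpz : p 0 = w₀ := by simp [p]
  have hψ : ∀ m, ∃ c : ℂ, E (m * s) w₀ = c • p m := by
    intro m
    have h1 := hT (m * s) 0 _ hw₀
    rw [zero_add] at h1
    obtain ⟨c, hc⟩ := Submodule.mem_span_singleton.mp (hspan m h1)
    exact ⟨c, hc.symm⟩
  choose φ hφ using hψ
  have hEp : ∀ m n, E (m * s) (p n) = φ m • p (n + m) := by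
    intro m n
    have hcomm : ∀ w, E (m * s) (X w) = X (E (m * s) w) := fun w => by
      have := LinearMap.congr_fun (wordSpan_commute_of hX fun x => hE x (m * s)).eq w
      simpa only [Module.End.mul_apply] using this.symm
    induction n with
    | zero => rw [zero_add, hpz, hφ]
    | succ n ih => rw [← hXp, hcomm, ih, map_smul, hXp, add_right_comm]
    | pred n ih =>
      rw [← sub_eq_zero]
      have hmem : E (m * s) (p (-n - 1)) - φ m • p (-n - 1 + m) ∈ T ((-n - 1 + m) * s) := by
        refine sub_mem ?_ (Submodule.smul_mem _ _ (hpT _))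
        have := hT (m * s) _ _ (hpT (-n - 1))
        rwa [← add_mul] at this
      refine hXinj _ _ hmem ?_
      rw [map_sub, map_smul, ← hcomm, hXp, hXp, sub_add_cancel, ih,
        show -(n : ℤ) - 1 + m + 1 = -n + m by ring, sub_self]
  classical
  refine ⟨s, fun l => if s ∣ l then p (l / s) else 0, fun x => if s ∣ x then φ (x / s) else 0,
    fun l => ?_, fun l => ?_, fun l => ?_, fun x l => ?_, fun x => ?_⟩
  · simp only
    split_ifs with hl
    · have := hpT (l / s)
      rwa [Int.ediv_mul_cancel hl] at this
    · exact zero_mem _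
  · simp only
    split_ifs with hl
    · have := hspan (l / s)
      rwa [Int.ediv_mul_cancel hl] at this
    · rw [not_not.mp (mt (hdvd l).mp hl)]; exact bot_le
  · simp only
    split_ifs with hl
    · simp [hl, hp0]
    · simp [hl]
  · simp only
    by_cases hl : s ∣ l
    · rw [if_pos hl]
      by_cases hx : s ∣ x
      · rw [if_pos hx, if_pos (dvd_add hl hx), Int.add_ediv_of_dvd_left hl, ← hEp,
          Int.ediv_mul_cancel hx]
      · rw [if_neg hx, zero_smul]
        have h1 := hT x _ _ (hpT (l / s))
        rw [Int.ediv_mul_cancel hl] at h1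
        have h2 : T (l + x) = ⊥ := by
          by_contra hne
          exact hx ((Int.dvd_add_right hl).mp ((hdvd _).mp hne))
        rw [h2] at h1
        exact h1
    · rw [if_neg hl, map_zero]
      by_cases hx : s ∣ x
      · rw [if_neg (fun h => hl ((Int.dvd_add_left hx).mp h)), smul_zero]
      · rw [if_neg hx, zero_smul]
  · simp only
    split_ifs with hx
    · exact fun _ => hx
    · exact fun h => absurd rfl h

end Commuting

/-! ### Strings of highest weight vectors -/

section Strings

variable (b : Module.Basis (Fin 2) ℤ (ℤ × ℤ))
variable {M : Type*} [AddCommGroup M] [Module ℂ M] [LieRingModule L M] [LieModule ℂ L M]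

/-- The vectors `u k`, `k ∈ ℤ`, are annihilated by `L_+` and permuted up to scalars by `L_0`. The
scalars are encoded by one function `f`, with `f x / x` belonging to `D(x 𝐛₂)` for `x ≠ 0`, and
`f 0` to `h(𝐛₁)`; this normalisation makes `lie_pair` uniform. For `x = 0` the field `zero` is the
trivial identity `0 = 0`. -/
structure IsString (u : ℤ → M) (f : ℤ → ℂ) : Prop where
  pos : ∀ j x k, 0 < j → ⁅Db b j x, u k⁆ = 0
  zero : ∀ x k, ⁅Db b 0 x, u k⁆ = (f x / x) • u (k + x)
  h_zero : ∀ k, ⁅h (b 0), u k⁆ = -(bdet b * f 0) • u k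
  h_one : ∀ k, ⁅h (b 1), u k⁆ = 0

variable {b} {u : ℤ → M} {f : ℤ → ℂ}

theorem IsString.lie_pair (hu : IsString b u f) {a : ℤ} (ha : 0 < a) (x y k : ℤ) :
    ⁅Db b a x, ⁅Db b (-a) y, u k⁆⁆ = -(a * bdet b * f (x + y)) • u (k + (x + y)) := by
  rw [lie_Db_lie_Db, hu.pos a x k ha, lie_zero, add_zero, add_neg_cancel, hu.zero, hu.h_zero,
    hu.h_one, smul_zero, add_zero, smul_smul, smul_smul]
  by_cases hxy : x + y = 0
  · rw [if_pos ⟨rfl, hxy⟩, hxy]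
    simp only [Int.cast_zero, div_zero, mul_zero, zero_smul, zero_add, add_zero]
    congr 1
    ring
  · have hxy' : ((x + y : ℤ) : ℂ) ≠ 0 := by exact_mod_cast hxy
    rw [if_neg (fun h => hxy h.2), add_zero]
    congr 1
    rw [mul_div_assoc', div_eq_iff hxy']
    push_cast
    ring

end Strings

/-! ### The top level of a module that is not uniformly bounded -/

section Top

variable {V : Type*} [AddCommGroup V] [Module ℂ V] [LieRingModule L V] [LieModule ℂ L V]
  {G : ℤ × ℤ → Submodule ℂ V}

theorem lie_h_comp (hG : IsZ2Graded G) (m n : ℤ × ℤ) (w : V) :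
    comp hG.internal n ⁅h m, w⁆ = ⁅h m, comp hG.internal n w⁆ := by
  have h1 : ∀ m, comp hG.internal n ⁅D m, ⁅D (-m), w⁆⁆ = ⁅D m, ⁅D (-m), comp hG.internal n w⁆⁆ := by
    intro m
    rw [← lie_D_comp hG, ← lie_D_comp hG, add_neg_cancel_left]
  have h2 := h1 (-m)
  rw [neg_neg] at h2
  rw [lie_h_eq, map_sub, h1, h2, lie_h_eq]

/-- Schur's lemma for the centre. -/
theorem exists_h_eq_smul (hO : IsInO G) (m : ℤ × ℤ) : ∃ c : ℂ, ∀ w : V, ⁅h m, w⁆ = c • w := by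
  obtain ⟨n, hn⟩ := exists_ne_bot hO
  have := hO.finiteDimensional n
  obtain ⟨c, v, -, hv0, hc⟩ := exists_eigenvector_mem (LieModule.toEnd ℂ L V (h m)) hn
    (fun w hw => lie_h_mem hO.toIsZ2Graded m hw)
  refine ⟨c, fun w => ?_⟩
  let N := subOfD (V := V) (Module.End.eigenspace (LieModule.toEnd ℂ L V (h m)) c) (fun k w hw => by
    rw [Module.End.mem_eigenspace_iff, LieModule.toEnd_apply_apply] at hw ⊢
    rw [lie_h_comm, hw, lie_smul])
  have hN : ∀ w : V, w ∈ N ↔ ⁅h m, w⁆ = c • w := fun w => Module.End.mem_eigenspace_iff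
  have htop := eq_top_of_comp hO (N := N) (fun w hw k => by
    rw [hN] at hw ⊢
    rw [← lie_h_comp hO.toIsZ2Graded, hw, map_smul]) ((hN v).mpr hc) hv0
  exact (hN w).mp (htop ▸ LieSubmodule.mem_top w)

variable {b : Module.Basis (Fin 2) ℤ (ℤ × ℤ)} {n₀ : ℤ × ℤ}

theorem lie_Db_mem (hG : IsZ2Graded G) (j x : ℤ) {n : ℤ × ℤ} {w : V} (hw : w ∈ G n) :
    ⁅Db b j x, w⁆ ∈ G (j • b 0 + x • b 1 + n) := hG.lie_mem _ _ _ hw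

theorem lie_Db_zero_mem (hG : IsZ2Graded G) (x l : ℤ) {w : V} (hw : w ∈ G (n₀ + l • b 1)) :
    ⁅Db b 0 x, w⁆ ∈ G (n₀ + (l + x) • b 1) := by
  have := lie_Db_mem (b := b) hG 0 x hw
  rwa [show (0 : ℤ) • b 0 + x • b 1 + (n₀ + l • b 1) = n₀ + (l + x) • b 1 by module] at this

theorem lie_Db_pos_eq_zero (hG : IsZ2Graded G) (htop : ∀ n, b.repr n₀ 0 < b.repr n 0 → G n = ⊥)
    {j : ℤ} (hj : 0 < j) (x l : ℤ) {w : V} (hw : w ∈ G (n₀ + l • b 1)) : ⁅Db b j x, w⁆ = 0 := by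
  have := lie_Db_mem (b := b) hG j x hw
  rw [htop _ (by simpa [-zsmul_eq_mul] using hj)] at this
  exact (Submodule.mem_bot ℂ).mp this

/-- The sum of the homogeneous subspaces whose degrees have a given first coordinate. -/
def level (b : Module.Basis (Fin 2) ℤ (ℤ × ℤ)) (G : ℤ × ℤ → Submodule ℂ V) (j : ℤ) :
    Submodule ℂ V := ⨆ n : {n : ℤ × ℤ // b.repr n 0 = j}, G n

theorem mem_level {n : ℤ × ℤ} {w : V} (hw : w ∈ G n) : w ∈ level b G (b.repr n 0) :=
  Submodule.mem_iSup_of_mem (⟨n, rfl⟩ : {m : ℤ × ℤ // b.repr m 0 = b.repr n 0}) hw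

theorem lie_Db_mem_level (hG : IsZ2Graded G) (j x n : ℤ) {w : V} (hw : w ∈ level b G n) :
    ⁅Db b j x, w⁆ ∈ level b G (j + n) := by
  induction hw using Submodule.iSup_induction' with
  | mem m w hw =>
    have := mem_level (b := b) (lie_Db_mem (b := b) hG j x hw)
    rwa [map_add, Finsupp.add_apply, repr_add_smul, if_pos rfl, m.2] at this
  | zero => rw [lie_zero]; exact zero_mem _
  | add y z _ _ hy hz => rw [lie_add]; exact add_mem hy hz

theorem comp_lower_eq_zero (hG : IsZ2Graded G) {w : V} {r : ℤ}
    (hw : w ∈ ⨆ n : {n : ℤ // n < r}, level b G n) {n : ℤ × ℤ} (hn : r ≤ b.repr n 0) :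
    comp hG.internal n w = 0 := by
  induction hw using Submodule.iSup_induction' with
  | mem j w hw =>
    induction hw using Submodule.iSup_induction' with
    | mem m w hw =>
      refine comp_of_ne hG.internal ?_ hw
      intro hmn
      have h1 := m.2
      have h2 := j.2
      rw [hmn] at h1
      omega
    | zero => rw [map_zero]
    | add y z _ _ hy hz => rw [map_add, hy, hz, add_zero]
  | zero => rw [map_zero]
  | add y z _ _ hy hz => rw [map_add, hy, hz, add_zero]

/-- The operators `D(k 𝐛₂)`. -/
def heisOp (b : Module.Basis (Fin 2) ℤ (ℤ × ℤ)) (V : Type*) [AddCommGroup V] [Module ℂ V]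
    [LieRingModule L V] [LieModule ℂ L V] (k : ℤ) : Module.End ℂ V :=
  LieModule.toEnd ℂ L V (Db b 0 k)

theorem heisOp_apply (k : ℤ) (w : V) : heisOp b V k w = ⁅Db b 0 k, w⁆ := rfl

/-- The top level is graded irreducible over the Heisenberg algebra. -/
theorem top_irreducible (hO : IsInO G) (htop : ∀ n, b.repr n₀ 0 < b.repr n 0 → G n = ⊥) (l : ℤ)
    (w : V) (hw : w ∈ G (n₀ + l • b 1)) (hw0 : w ≠ 0) (m : ℤ) (y : V) (hy : y ∈ G (n₀ + m • b 1)) :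
    ∃ X ∈ wordSpan (heisOp b V) (m - l), X w = y := by
  have hG := hO.toIsZ2Graded
  have hT : ∀ k l, ∀ w ∈ G (n₀ + l • b 1), heisOp b V k w ∈ G (n₀ + (l + k) • b 1) :=
    fun k l w hw => lie_Db_zero_mem hG k l hw
  let F : ℤ → Submodule ℂ V := fun m =>
    (wordSpan (heisOp b V) (m - l)).map (LinearMap.applyₗ w)
  have hFT : ∀ m, F m ≤ G (n₀ + m • b 1) := by
    rintro m _ ⟨X, hX, rfl⟩
    have := wordSpan_apply_mem hT hX hw
    rwa [add_sub_cancel] at this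
  have hwF : w ∈ F l := ⟨1, by rw [sub_self]; exact Submodule.subset_span .one, rfl⟩
  have hrep : ∀ m : ℤ, b.repr (n₀ + m • b 1) 0 = b.repr n₀ 0 := fun m => by simp [-zsmul_eq_mul]
  have hind : ∀ {p : V → Prop}, (∀ m, ∀ z ∈ F m, p z) → p 0 → (∀ y z, p y → p z → p (y + z)) →
      ∀ z ∈ ⨆ m, F m, p z := fun h1 h2 h3 z hz =>
    Submodule.iSup_induction F (motive := _) hz h1 h2 h3
  have hle := lieSpan_le_of_top b (Lv := level b G) (n₀ := b.repr n₀ 0)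
    (fun j x n w hw => lie_Db_mem_level hG j x n hw) (S := ⨆ m, F m)
    (iSup_le fun m z hz => by
      have := mem_level (b := b) (hFT m hz)
      rwa [hrep] at this)
    (fun x z hz => by
      refine hind (p := fun z => ⁅Db b 0 x, z⁆ ∈ ⨆ m, F m) ?_ ?_ ?_ z hz
      · rintro m _ ⟨X, hX, rfl⟩
        refine Submodule.mem_iSup_of_mem (m + x) ⟨heisOp b V x * X, ?_, rfl⟩
        have := wordSpan_mul (single_mem_wordSpan (E := heisOp b V) x) hX
        rwa [show x + (m - l) = m + x - l by ring] at this
      · simp only [lie_zero, zero_mem]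
      · intro y z hy hz; simp only [lie_add]; exact add_mem hy hz)
    (fun k z hz => by
      obtain ⟨c, hc⟩ := exists_h_eq_smul hO k
      rw [hc]
      exact Submodule.smul_mem _ _ hz)
    (fun j x hj z hz => by
      refine hind (p := fun z => ⁅Db b j x, z⁆ = 0) ?_ ?_ ?_ z hz
      · intro m z hz
        exact lie_Db_pos_eq_zero hG htop hj x m (hFT m hz)
      · simp only [lie_zero]
      · intro y z hy hz; simp only [lie_add, hy, hz, add_zero])
  have hspan : LieSubmodule.lieSpan ℂ L ((⨆ m, F m : Submodule ℂ V) : Set V) = ⊤ := by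
    refine top_le_iff.mp ?_
    rw [← lieSpan_singleton_eq_top hO hw hw0]
    exact LieSubmodule.lieSpan_mono (Set.singleton_subset_iff.mpr (Submodule.mem_iSup_of_mem l hwF))
  rw [hspan] at hle
  obtain ⟨a, ha, c, hc, hac⟩ := Submodule.mem_sup.mp (hle (LieSubmodule.mem_top y))
  have h1 : comp hG.internal (n₀ + m • b 1) a = y := by
    rw [← comp_same hG.internal hy, ← hac, map_add,
      comp_lower_eq_zero hG hc (le_of_eq (hrep m).symm), add_zero]
  rw [← h1]
  refine hind (p := fun a => comp hG.internal (n₀ + m • b 1) a ∈ F m) ?_ ?_ ?_ a ha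
  · intro k z hz
    by_cases hkm : k = m
    · subst hkm
      rwa [comp_same hG.internal (hFT k hz)]
    · rw [comp_of_ne hG.internal _ (hFT k hz)]
      · exact zero_mem _
      · intro h0
        have := congrArg (fun z => b.repr z 1) h0
        simp [-zsmul_eq_mul] at this
        exact hkm this
  · simp only [map_zero, zero_mem]
  · intro y z hy hz; simp only [map_add]; exact add_mem hy hz

/-- If the centre acted on the top level by a nonzero scalar of `h(𝐛₂)`, then `D`'s of degree `-1`
would embed almost all homogeneous subspaces of the top level into one homogeneous subspace. -/
theorem h_one_eq_zero (hO : IsInO G) (hn₀ : G n₀ ≠ ⊥)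
    (htop : ∀ n, b.repr n₀ 0 < b.repr n 0 → G n = ⊥) (w : V) : ⁅h (b 1), w⁆ = 0 := by
  have hG := hO.toIsZ2Graded
  obtain ⟨κ, hκ⟩ := exists_h_eq_smul hO (b 0)
  obtain ⟨μ, hμ⟩ := exists_h_eq_smul hO (b 1)
  suffices h0 : μ = 0 by rw [hμ, h0, zero_smul]
  by_contra hμ0
  have hinj : ∀ l : ℤ, κ + l * μ ≠ 0 →
      Module.finrank ℂ (G (n₀ + l • b 1)) ≤ Module.finrank ℂ (G (-b 0 + n₀)) := by
    intro l hl
    have := hO.finiteDimensional (-b 0 + n₀)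
    have hmem : ∀ w ∈ G (n₀ + l • b 1), ⁅Db b (-1) (-l), w⁆ ∈ G (-b 0 + n₀) := fun w hw => by
      have := lie_Db_mem (b := b) hG (-1) (-l) hw
      rwa [show (-1 : ℤ) • b 0 + (-l) • b 1 + (n₀ + l • b 1) = -b 0 + n₀ by module] at this
    refine LinearMap.finrank_le_finrank_of_injective
      (f := (LieModule.toEnd ℂ L V (Db b (-1) (-l))).restrict hmem) ?_
    rw [injective_iff_map_eq_zero]
    rintro ⟨w, hw⟩ h0
    have h0' : ⁅Db b (-1) (-l), w⁆ = 0 := congrArg Subtype.val h0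
    have h1 := lie_Db_lie_Db b 1 l (-1) (-l) w
    rw [h0', lie_zero, lie_Db_pos_eq_zero hG htop one_pos l l hw, lie_zero, if_pos (by simp), hκ,
      hμ] at h1
    simp only [add_neg_cancel, Db_zero, zero_lie, smul_zero, zero_add, add_zero, Int.cast_one, one_mul,
      smul_smul, ← add_smul] at h1
    exact Subtype.ext ((smul_eq_zero.mp h1.symm).resolve_left hl)
  obtain ⟨B, hB⟩ : ∃ B : ℕ, ∀ l : ℤ, Module.finrank ℂ (G (n₀ + l • b 1)) ≤ B := by
    by_cases hex : ∃ l₀ : ℤ, κ + l₀ * μ = 0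
    · obtain ⟨l₀, hl₀⟩ := hex
      refine ⟨max (Module.finrank ℂ (G (-b 0 + n₀))) (Module.finrank ℂ (G (n₀ + l₀ • b 1))),
        fun l => ?_⟩
      by_cases hl : l = l₀
      · subst hl; exact le_max_right _ _
      · refine (hinj l fun h1 => hl ?_).trans (le_max_left _ _)
        have : ((l : ℂ) - l₀) * μ = 0 := by linear_combination h1 - hl₀
        have := (mul_eq_zero.mp this).resolve_right hμ0
        exact_mod_cast sub_eq_zero.mp this
    · push Not at hex
      exact ⟨_, fun l => hinj l (hex l)⟩
  refine hμ0 (heisenberg_level_eq_zero (E := heisOp b V) (T := fun l => G (n₀ + l • b 1))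
    (fun k l w => ?_) (fun l => hO.finiteDimensional _)
    (fun k l w hw => lie_Db_zero_mem hG k l hw) hB (l := 0) (by simpa using hn₀))
  simp only [heisOp_apply]
  rw [lie_Db_lie_Db, hμ]
  simp [smul_smul, ite_smul]

end Top

/-! ### The string formed by the top level -/

section TopString

variable {V : Type*} [AddCommGroup V] [Module ℂ V] [LieRingModule L V] [LieModule ℂ L V]
  {G : ℤ × ℤ → Submodule ℂ V} {b : Module.Basis (Fin 2) ℤ (ℤ × ℤ)} {n₀ : ℤ × ℤ}

/-- The top level consists of a string of highest weight vectors. The last clause says that the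
whole string is generated by each of its vectors. -/
theorem exists_isString (hO : IsInO G) (hn₀ : G n₀ ≠ ⊥)
    (htop : ∀ n, b.repr n₀ 0 < b.repr n 0 → G n = ⊥) :
    ∃ (s : ℕ) (u : ℤ → V) (f : ℤ → ℂ), IsString b u f ∧ (∀ l, u l ∈ G (n₀ + l • b 1)) ∧
      (∀ l, u l ≠ 0 ↔ (s : ℤ) ∣ l) ∧ (∀ x, f x ≠ 0 → (s : ℤ) ∣ x) ∧
      ∀ l, (s : ℤ) ∣ l → l ∈ AddSubmonoid.closure {x | x ≠ 0 ∧ f x ≠ 0} := by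
  have hG := hO.toIsZ2Graded
  have hδ := bdet_ne_zero' b
  have hT : ∀ k l, ∀ w ∈ G (n₀ + l • b 1), heisOp b V k w ∈ G (n₀ + (l + k) • b 1) :=
    fun k l w hw => lie_Db_zero_mem hG k l hw
  have hμ := h_one_eq_zero hO hn₀ htop
  obtain ⟨κ, hκ⟩ := exists_h_eq_smul hO (b 0)
  obtain ⟨s, u, ψ, huT, -, hus, hψ, hψs⟩ := exists_shift_basis (E := heisOp b V)
    (T := fun l => G (n₀ + l • b 1))
    (fun k l => LinearMap.ext fun w => by
      simp only [Module.End.mul_apply, heisOp_apply]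
      rw [lie_Db_lie_Db, hμ]
      simp)
    (fun l => hO.finiteDimensional _) hT (by simpa using hn₀) (top_irreducible hO htop)
  have hu0 : u 0 ≠ 0 := (hus 0).mpr (dvd_zero s)
  have hψ0 : ψ 0 = 0 := by
    have := hψ 0 0
    rw [heisOp_apply, Db_zero, zero_lie, add_zero] at this
    exact (smul_eq_zero.mp this.symm).resolve_right hu0
  refine ⟨s.natAbs, u, fun x => if x = 0 then -κ / bdet b else x * ψ x,
    ⟨?_, ?_, ?_, fun k => hμ _⟩, huT,
    fun l => by rw [Int.natAbs_dvd, hus], ?_, ?_⟩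
  · exact fun j x k hj => lie_Db_pos_eq_zero hG htop hj x k (huT k)
  · intro x k
    by_cases hx : x = 0
    · subst hx; simp [Db_zero]
    · have hx' : (x : ℂ) ≠ 0 := by exact_mod_cast hx
      rw [← heisOp_apply, hψ, if_neg hx, mul_div_cancel_left₀ _ hx']
  · intro k
    rw [hκ, if_pos rfl]
    congr 1
    field_simp
  · intro x
    by_cases hx : x = 0
    · simp [hx]
    · simp only [if_neg hx]
      exact fun h => Int.natAbs_dvd.mpr (hψs x (right_ne_zero_of_mul h))
  · intro l hl
    rw [Int.natAbs_dvd] at hl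
    have hset : {x : ℤ | x ≠ 0 ∧ (if x = 0 then -κ / bdet b else x * ψ x) ≠ 0} = {x | ψ x ≠ 0} := by
      ext x
      by_cases hx : x = 0
      · simp [hx, hψ0]
      · simp [hx]
    rw [hset]
    obtain ⟨X, hX, hXu⟩ := top_irreducible hO htop 0 (u 0) (huT 0) hu0 l (u l) (huT l)
    rw [sub_zero] at hX
    have hword : ∀ k Y, EWord (heisOp b V) k Y →
        k ∈ AddSubmonoid.closure {x | ψ x ≠ 0} ∧ Y (u 0) ∈ ℂ ∙ u k ∨ Y (u 0) = 0 := by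
      intro k Y hY
      induction hY with
      | one => exact .inl ⟨zero_mem _, Submodule.mem_span_singleton_self _⟩
      | mul x k Y _ ih =>
        rw [Module.End.mul_apply]
        rcases ih with ⟨hk, hY⟩ | hY
        · obtain ⟨c, hc⟩ := Submodule.mem_span_singleton.mp hY
          rw [← hc, map_smul, hψ]
          by_cases hx : ψ x = 0
          · right; rw [hx, zero_smul, smul_zero]
          · left
            refine ⟨add_mem (AddSubmonoid.subset_closure hx) hk, ?_⟩
            rw [add_comm]
            exact Submodule.smul_mem _ _ (Submodule.smul_mem _ _
              (Submodule.mem_span_singleton_self _))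
        · right; rw [hY, map_zero]
    by_contra hcl
    have hle : wordSpan (heisOp b V) l ≤ LinearMap.ker (LinearMap.applyₗ (R := ℂ) (u 0)) :=
      Submodule.span_le.mpr fun Y hY => (hword l Y hY).resolve_left fun h => hcl h.1
    have : X (u 0) = 0 := hle hX
    exact (hus l).mpr hl (hXu.symm.trans this)

variable {u : ℤ → V} {f : ℤ → ℂ} {s : ℕ}

/-- A linear dependence between the vectors obtained from the string in one degree of the second
level becomes a linear recurrence for `f` when `D(𝐛₁ + x 𝐛₂)` is applied to it. -/
theorem exists_recurrence (hO : IsInO G) (hu : IsString b u f)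
    (huT : ∀ l, u l ∈ G (n₀ + l • b 1)) (hus : ∀ l, u l ≠ 0 ↔ (s : ℤ) ∣ l)
    (hfs : ∀ x, f x ≠ 0 → (s : ℤ) ∣ x) :
    ∃ a : ℕ →₀ ℂ, a ≠ 0 ∧ ∀ x : ℤ, ∑ n ∈ a.support, a n * f (x + s * n) = 0 := by
  have hδ := bdet_ne_zero' b
  have hG := hO.toIsZ2Graded
  have hfd := hO.finiteDimensional (-b 0 + n₀)
  let v : ℕ → G (-b 0 + n₀) := fun n => ⟨⁅Db b (-1) (s * n), u (-(s * n))⁆, by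
    have := lie_Db_mem (b := b) hG (-1) (s * n) (huT (-(s * n)))
    rwa [show (-1 : ℤ) • b 0 + ((s : ℤ) * n) • b 1 + (n₀ + (-((s : ℤ) * n)) • b 1) = -b 0 + n₀ by
      module] at this⟩
  have hdep : ¬ LinearIndependent ℂ v := fun h => by
    have := h.cardinalMk_le_finrank
    simp only [Cardinal.mk_nat] at this
    exact Cardinal.natCast_lt_aleph0.not_ge this
  rw [linearIndependent_iff] at hdep
  push Not at hdep
  obtain ⟨a, ha, ha0⟩ := hdep
  refine ⟨a, ha0, fun x => ?_⟩
  by_cases hx : (s : ℤ) ∣ x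
  · have h1 : ∑ n ∈ a.support, a n • ⁅Db b (-1) (s * n), u (-(s * n))⁆ = 0 := by
      have := congrArg Subtype.val ha
      rw [Finsupp.linearCombination_apply, Finsupp.sum] at this
      simpa [v] using this
    have h2 := congrArg (fun w => ⁅Db b 1 x, w⁆) h1
    simp only [lie_sum, lie_smul, lie_zero] at h2
    have h3 : ∀ n : ℕ, ⁅Db b 1 x, ⁅Db b (-1) (s * n), u (-(s * n))⁆⁆ =
        (-(bdet b : ℂ) * f (x + s * n)) • u x := fun n => by
      rw [hu.lie_pair one_pos, neg_add_cancel_comm_assoc]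
      push_cast
      rw [one_mul, neg_mul]
    simp only [h3, smul_smul] at h2
    rw [← Finset.sum_smul] at h2
    have h4 := (smul_eq_zero.mp h2).resolve_right ((hus x).mpr hx)
    rw [Finset.sum_congr rfl fun n _ =>
      show a n * (-(bdet b : ℂ) * f (x + s * n)) = -(bdet b : ℂ) * (a n * f (x + s * n)) by ring,
      ← Finset.mul_sum] at h4
    exact (mul_eq_zero.mp h4).resolve_left (neg_ne_zero.mpr hδ)
  · refine Finset.sum_eq_zero fun n _ => ?_
    rw [not_not.mp (mt (hfs _) fun h => hx ?_), mul_zero]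
    exact (Int.dvd_add_left (dvd_mul_right _ _)).mp h

theorem lie_Db_ne_zero (hO : IsInO G) (hU : ¬ IsUniformlyBounded G)
    (hk : ∀ z, 0 < b.repr z 0 → IsKilling V z) {j : ℤ} (hj : j < 0) (x : ℤ) {w : V} (hw : w ≠ 0) :
    ⁅Db b j x, w⁆ ≠ 0 := by
  intro h0
  refine hw ((hk ((-j) • b 0 + (-x) • b 1) ?_).eq_zero hO hU ?_)
  · rw [repr_add_smul, if_pos rfl]; omega
  · rwa [show -((-j) • b 0 + (-x) • b 1) = j • b 0 + x • b 1 by module]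

/-- If the top level is concentrated in one degree and `h(𝐛₁)` acts by `0`, then the second level
generates a proper submodule. -/
theorem false_of_trivial_top (hO : IsInO G) (hU : ¬ IsUniformlyBounded G)
    (hk : ∀ z, 0 < b.repr z 0 → IsKilling V z) (hu : IsString b u f)
    (huT : ∀ l, u l ∈ G (n₀ + l • b 1)) (hu0 : u 0 ≠ 0) (hf : ∀ x, f x = 0) : False := by
  have hG := hO.toIsZ2Graded
  set r := b.repr n₀ 0 with hr
  let S : Submodule ℂ V := Submodule.span ℂ (Set.range fun y => ⁅Db b (-1) y, u 0⁆)
  have hmem : ∀ y, ⁅Db b (-1) y, u 0⁆ ∈ S := fun y => Submodule.subset_span ⟨y, rfl⟩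
  have hzero : ∀ x k, ⁅Db b 0 x, u k⁆ = 0 := fun x k => by rw [hu.zero, hf, zero_div, zero_smul]
  have hu0' : u 0 ∈ level b G r := by
    have := mem_level (b := b) (huT 0)
    rwa [zero_smul, add_zero] at this
  have hSl : S ≤ level b G (r - 1) := Submodule.span_le.mpr (by
    rintro _ ⟨y, rfl⟩
    have := lie_Db_mem_level hG (-1) y r hu0'
    rwa [neg_add_eq_sub] at this)
  have hle := lieSpan_le_of_top b (Lv := level b G) (n₀ := r - 1)
    (fun j x n w hw => lie_Db_mem_level hG j x n hw) hSl
    (fun x w hw => by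
      induction hw using Submodule.span_induction with
      | mem w hw =>
        obtain ⟨y, rfl⟩ := hw
        rw [lie_Db_lie_Db_of_ne b (by norm_num), hzero, lie_zero, add_zero, zero_add]
        exact Submodule.smul_mem _ _ (hmem _)
      | zero => rw [lie_zero]; exact zero_mem _
      | add y z _ _ hy hz => rw [lie_add]; exact add_mem hy hz
      | smul c y _ hy => rw [lie_smul]; exact Submodule.smul_mem _ _ hy)
    (fun m w hw => by
      obtain ⟨c, hc⟩ := exists_h_eq_smul hO m
      rw [hc]
      exact Submodule.smul_mem _ _ hw)
    (fun j x hj w hw => by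
      induction hw using Submodule.span_induction with
      | mem w hw =>
        obtain ⟨y, rfl⟩ := hw
        rcases eq_or_ne j 1 with rfl | hj1
        · rw [hu.lie_pair one_pos, hf, mul_zero, neg_zero, zero_smul]
        · rw [lie_Db_lie_Db_of_ne b (by omega), hu.pos _ _ _ hj, hu.pos _ _ _ (by omega), lie_zero,
            smul_zero, add_zero]
      | zero => rw [lie_zero]
      | add y z _ _ hy hz => rw [lie_add, hy, hz, add_zero]
      | smul c y _ hy => rw [lie_smul, hy, smul_zero])
  have htop : LieSubmodule.lieSpan ℂ L (S : Set V) = ⊤ := by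
    refine top_le_iff.mp ?_
    rw [← lieSpan_singleton_eq_top hO (lie_Db_mem (b := b) hG (-1) 0 (huT 0))
      (lie_Db_ne_zero hO hU hk (by norm_num) 0 hu0)]
    exact LieSubmodule.lieSpan_mono (Set.singleton_subset_iff.mpr (hmem 0))
  rw [htop] at hle
  have hlow : S ⊔ ⨆ n : {n : ℤ // n < r - 1}, level b G n ≤ ⨆ n : {n : ℤ // n < r}, level b G n :=
    sup_le (hSl.trans (le_iSup (fun n : {n : ℤ // n < r} => level b G n) ⟨r - 1, by omega⟩))
      (iSup_le fun n => le_iSup (fun n : {n : ℤ // n < r} => level b G n)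
        ⟨n, by have := n.2; omega⟩)
  have h1 := comp_lower_eq_zero (b := b) (n := n₀ + (0 : ℤ) • b 1) hG
    (hlow (hle (LieSubmodule.mem_top (u 0)))) (by simp [hr])
  rw [comp_same hG.internal (huT 0)] at h1
  exact hu0 h1

theorem lie_Db_one_pair (hu : IsString b u f) (hf : ∀ x, x ≠ 0 → f x = 0) {x y : ℤ} (hx : 0 < x)
    (hy : 0 < y) :
    ⁅Db b 1 x, ⁅Db b (-1) y, ⁅Db b (-1) (-y), u 0⁆⁆⁆ =
      (((x + y : ℂ)) ^ 2 * bdet b ^ 2 - if x = y then bdet b * f 0 else 0) •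
        ⁅Db b (-1) x, u 0⁆ := by
  have hzero : ⁅Db b 0 (x + y), u 0⁆ = 0 := by
    rw [hu.zero, hf _ (by omega), zero_div, zero_smul]
  rw [lie_Db_lie_Db, if_neg (by omega), hu.lie_pair one_pos, show (1 : ℤ) + -1 = 0 by norm_num,
    lie_Db_lie_Db_of_ne b (by norm_num), hzero]
  simp only [zero_add, lie_zero, add_zero, add_neg_cancel_right, lie_smul, smul_smul]
  split_ifs with hxy
  · subst hxy
    rw [add_neg_cancel, ← add_smul]
    congr 1
    push_cast
    ring
  · rw [hf _ (by omega), mul_zero, neg_zero, zero_smul, add_zero]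
    congr 1
    push_cast
    ring

/-- If the top level were concentrated in one degree and `h(𝐛₁)` did not act by `0`, then the
homogeneous subspace two levels below it would be infinite dimensional. -/
theorem false_of_singleton_top (hO : IsInO G) (hU : ¬ IsUniformlyBounded G)
    (hk : ∀ z, 0 < b.repr z 0 → IsKilling V z) (hu : IsString b u f)
    (huT : ∀ l, u l ∈ G (n₀ + l • b 1)) (hu0 : u 0 ≠ 0)
    (hf : ∀ x, x ≠ 0 → f x = 0) (hf0 : f 0 ≠ 0) : False := by
  have hδ := bdet_ne_zero' b
  have hG := hO.toIsZ2Graded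
  have hfd := hO.finiteDimensional ((-2 : ℤ) • b 0 + n₀)
  let v : ℕ → G ((-2 : ℤ) • b 0 + n₀) := fun n =>
    ⟨⁅Db b (-1) (n + 1), ⁅Db b (-1) (-(n + 1)), u 0⁆⁆, by
      have := lie_Db_mem (b := b) hG (-1) (n + 1) (lie_Db_mem (b := b) hG (-1) (-(n + 1)) (huT 0))
      rwa [show (-1 : ℤ) • b 0 + ((n : ℤ) + 1) • b 1 +
        ((-1 : ℤ) • b 0 + (-((n : ℤ) + 1)) • b 1 + (n₀ + (0 : ℤ) • b 1)) = (-2 : ℤ) • b 0 + n₀ by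
        module] at this⟩
  have hdep : ¬ LinearIndependent ℂ v := fun h => by
    have := h.cardinalMk_le_finrank
    simp only [Cardinal.mk_nat] at this
    exact Cardinal.natCast_lt_aleph0.not_ge this
  refine hdep (linearIndependent_iff.mpr fun a ha => ?_)
  let P : ℕ → ℂ := fun m => ∑ n ∈ a.support, a n * ((m + 1 : ℂ) + (n + 1)) ^ 2
  have hP : ∀ m : ℕ, P m * bdet b ^ 2 = bdet b * f 0 * a m := by
    intro m
    have h1 : ∑ n ∈ a.support, a n • ⁅Db b (-1) (n + 1), ⁅Db b (-1) (-(n + 1)), u 0⁆⁆ = 0 := by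
      have := congrArg Subtype.val ha
      rw [Finsupp.linearCombination_apply, Finsupp.sum] at this
      simpa [v] using this
    have h2 := congrArg (fun w => ⁅Db b 1 (m + 1), w⁆) h1
    simp only [lie_sum, lie_smul, lie_zero] at h2
    rw [Finset.sum_congr rfl fun n _ => by
      rw [lie_Db_one_pair hu hf (by omega) (by omega), smul_smul], ← Finset.sum_smul] at h2
    have h3 := (smul_eq_zero.mp h2).resolve_right (lie_Db_ne_zero hO hU hk (by norm_num) _ hu0)
    simp only [mul_sub, Finset.sum_sub_distrib, add_left_inj, Nat.cast_inj, mul_ite, mul_zero,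
      Finset.sum_ite_eq, Finsupp.mem_support_iff, ne_eq, ite_not] at h3
    have h4 : (if a m = 0 then 0 else a m * (bdet b * f 0)) = bdet b * f 0 * a m := by
      split_ifs with h
      · rw [h, mul_zero]
      · ring
    rw [h4, sub_eq_zero] at h3
    rw [← h3, Finset.sum_mul]
    refine Finset.sum_congr rfl fun n _ => ?_
    push_cast
    ring
  -- A quadratic polynomial is determined by three consecutive values.
  have hrec : ∀ m, P m = 3 * P (m + 1) - 3 * P (m + 2) + P (m + 3) := by
    intro m
    simp only [P, Finset.mul_sum, ← Finset.sum_sub_distrib, ← Finset.sum_add_distrib]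
    refine Finset.sum_congr rfl fun n _ => ?_
    push_cast
    ring
  have hlarge : ∀ m, a.support.sup id < m → P m = 0 := by
    intro m hm
    have h1 : a m = 0 := by
      by_contra h0
      exact absurd (Finset.le_sup (f := id) (Finsupp.mem_support_iff.mpr h0)) (not_le.mpr hm)
    have h2 := hP m
    rw [h1, mul_zero] at h2
    exact (mul_eq_zero.mp h2).resolve_right (pow_ne_zero 2 hδ)
  have hall : ∀ k m, a.support.sup id < m + k → P m = 0 := by
    intro k
    induction k with
    | zero => exact fun m hm => hlarge m hm
    | succ k ih =>
      intro m hm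
      rw [hrec, ih _ (by omega), ih _ (by omega), ih _ (by omega)]
      ring
  ext m
  have h2 := hP m
  rw [hall (a.support.sup id + 1) m (by omega), zero_mul] at h2
  exact (mul_eq_zero.mp h2.symm).resolve_left (mul_ne_zero hδ hf0)

/-- The top level is not concentrated in one degree: `s = 0` would mean that `f` vanishes outside
`0`, which contradicts `false_of_trivial_top` or `false_of_singleton_top`. -/
theorem period_ne_zero (hO : IsInO G) (hU : ¬ IsUniformlyBounded G)
    (hk : ∀ z, 0 < b.repr z 0 → IsKilling V z) (hu : IsString b u f)
    (huT : ∀ l, u l ∈ G (n₀ + l • b 1)) (hus : ∀ l, u l ≠ 0 ↔ (s : ℤ) ∣ l)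
    (hfs : ∀ x, f x ≠ 0 → (s : ℤ) ∣ x) : s ≠ 0 := by
  rintro rfl
  have hf : ∀ x, x ≠ 0 → f x = 0 := fun x hx => by
    by_contra h; exact hx (zero_dvd_iff.mp (hfs x h))
  have hu0 : u 0 ≠ 0 := (hus 0).mpr dvd_rfl
  by_cases hf0 : f 0 = 0
  · refine false_of_trivial_top hO hU hk hu huT hu0 fun x => ?_
    by_cases hx : x = 0
    · rw [hx, hf0]
    · exact hf x hx
  · exact false_of_singleton_top hO hU hk hu huT hu0 hf hf0

end TopString

/-! ### Exp-polynomial functions and linear recurrences -/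

section ExpPolynomial

open Polynomial

/-- The shift of functions on `ℤ`. -/
def shift : Module.End ℂ (ℤ → ℂ) := LinearMap.funLeft ℂ ℂ (· + 1)

theorem shift_apply (g : ℤ → ℂ) (k : ℤ) : shift g k = g (k + 1) := rfl

/-- The function `k ↦ k ^ n α ^ k`. -/
def expMon (n : ℕ) (α : ℂ) (k : ℤ) : ℂ := (k : ℂ) ^ n * α ^ k

/-- The functions `∑ p_j(k) α_j ^ k` with `α_j ≠ 0`. -/
def expSpan : Submodule ℂ (ℤ → ℂ) := Submodule.span ℂ {g | ∃ n α, α ≠ 0 ∧ g = expMon n α}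

theorem expMon_mem (n : ℕ) {α : ℂ} (hα : α ≠ 0) : expMon n α ∈ expSpan :=
  Submodule.subset_span ⟨n, α, hα, rfl⟩

theorem shift_expMon (n : ℕ) {α : ℂ} (hα : α ≠ 0) (β : ℂ) :
    (shift - algebraMap ℂ _ β) (expMon n α) = (α - β) • expMon n α +
      ∑ m ∈ Finset.range n, (n.choose m * α) • expMon m α := by
  ext k
  simp only [LinearMap.sub_apply, Module.algebraMap_end_apply, Pi.sub_apply, Pi.add_apply,
    Pi.smul_apply, shift_apply, Finset.sum_apply, smul_eq_mul, expMon, zpow_add_one₀ hα]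
  push_cast
  rw [add_pow, Finset.sum_range_succ, add_mul, Finset.sum_mul]
  simp only [one_pow, mul_one, Nat.choose_self, Nat.cast_one]
  rw [Finset.sum_congr rfl fun m _ => show (n.choose m : ℂ) * α * ((k : ℂ) ^ m * α ^ k) =
    (k : ℂ) ^ m * n.choose m * (α ^ k * α) by ring]
  ring

/-- The operator `shift - β` maps the exp-polynomial functions onto themselves, by induction on
the degree of the polynomial coefficient. -/
theorem expSpan_le_map (β : ℂ) : expSpan ≤ expSpan.map (shift - algebraMap ℂ _ β) := by
  refine Submodule.span_le.mpr ?_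
  rintro _ ⟨n, α, hα, rfl⟩
  induction n using Nat.strong_induction_on with
  | _ n ih =>
    by_cases hαβ : α = β
    · subst hαβ
      have h1 := shift_expMon (n + 1) hα α
      rw [sub_self, zero_smul, zero_add, Finset.sum_range_succ] at h1
      have h2 : (((n + 1).choose n : ℂ) * α) • expMon n α ∈
          expSpan.map (shift - algebraMap ℂ _ α) := by
        rw [← add_sub_cancel_left (∑ m ∈ Finset.range n, ((n + 1).choose m * α) • expMon m α)
          ((((n + 1).choose n : ℂ) * α) • expMon n α), ← h1]
        exact sub_mem ⟨_, expMon_mem _ hα, rfl⟩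
          (sum_mem fun m hm => Submodule.smul_mem _ _ (ih m (Finset.mem_range.mp hm)))
      refine (Submodule.smul_mem_iff _ (mul_ne_zero ?_ hα)).mp h2
      rw [Nat.choose_succ_self_right]
      exact_mod_cast Nat.succ_ne_zero n
    · have h1 := shift_expMon n hα β
      have h2 : (α - β) • expMon n α ∈ expSpan.map (shift - algebraMap ℂ _ β) := by
        rw [← add_sub_cancel_right ((α - β) • expMon n α)
          (∑ m ∈ Finset.range n, (n.choose m * α) • expMon m α), ← h1]
        exact sub_mem ⟨_, expMon_mem _ hα, rfl⟩
          (sum_mem fun m hm => Submodule.smul_mem _ _ (ih m (Finset.mem_range.mp hm)))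
      exact (Submodule.smul_mem_iff _ (sub_ne_zero.mpr hαβ)).mp h2

theorem eq_smul_of_shift_eq {β : ℂ} {g : ℤ → ℂ} (hg : (shift - algebraMap ℂ _ β) g = 0) :
    g ∈ expSpan := by
  have h1 : ∀ k, g (k + 1) = β * g k := fun k => by
    have := congrFun hg k
    simpa only [LinearMap.sub_apply, Module.algebraMap_end_apply, Pi.sub_apply, Pi.smul_apply,
      shift_apply, smul_eq_mul, Pi.zero_apply, sub_eq_zero] using this
  by_cases hβ : β = 0
  · have : g = 0 := by
      ext k
      have := h1 (k - 1)
      rwa [sub_add_cancel, hβ, zero_mul] at this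
    rw [this]
    exact zero_mem _
  · have : g = g 0 • expMon 0 β := by
      ext k
      simp only [Pi.smul_apply, expMon, pow_zero, one_mul, smul_eq_mul]
      induction k with
      | zero => simp
      | succ n ih => rw [h1, ih, zpow_add_one₀ hβ]; ring
      | pred n ih =>
        have h2 := h1 (-n - 1)
        rw [sub_add_cancel, ih] at h2
        refine mul_left_cancel₀ hβ ?_
        rw [← h2, zpow_sub_one₀ hβ]
        field_simp
    rw [this]
    exact Submodule.smul_mem _ _ (expMon_mem 0 hβ)

theorem mem_expSpan_of_aeval (f : ℤ → ℂ) {Q : ℂ[X]} (hQ : Q ≠ 0) (hf : aeval shift Q f = 0) :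
    f ∈ expSpan := by
  induction hn : Q.natDegree generalizing Q f with
  | zero =>
    obtain ⟨c, rfl⟩ := natDegree_eq_zero.mp hn
    have hc : c ≠ 0 := fun h => hQ (by rw [h, C_0])
    rw [aeval_C, Module.algebraMap_end_apply] at hf
    rw [(smul_eq_zero.mp hf).resolve_left hc]
    exact zero_mem _
  | succ n ih =>
    obtain ⟨β, hβ⟩ := IsAlgClosed.exists_root Q (by
      rw [degree_eq_natDegree hQ, hn]; exact_mod_cast Nat.succ_ne_zero n)
    obtain ⟨P, rfl⟩ := dvd_iff_isRoot.mpr hβ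
    have hP : P ≠ 0 := right_ne_zero_of_mul hQ
    rw [natDegree_mul (X_sub_C_ne_zero β) hP, natDegree_X_sub_C, add_comm, Nat.succ_inj] at hn
    rw [mul_comm, map_mul, Module.End.mul_apply, map_sub, aeval_X, aeval_C] at hf
    obtain ⟨g, hg, hgf⟩ := expSpan_le_map β (ih _ hP hf hn)
    have h1 := eq_smul_of_shift_eq (β := β) (g := f - g) (by rw [map_sub, hgf, sub_self])
    have := add_mem h1 hg
    rwa [sub_add_cancel] at this

theorem shift_pow_apply (g : ℤ → ℂ) (n : ℕ) (k : ℤ) : (shift ^ n) g k = g (k + n) := by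
  induction n generalizing g with
  | zero => simp
  | succ n ih => rw [pow_succ, Module.End.mul_apply, ih, shift_apply]; congr 1; push_cast; ring

/-- A function on `ℤ` satisfying a linear recurrence is exp-polynomial. -/
theorem mem_expSpan_of_recurrence (f : ℤ → ℂ) {s : ℕ} (hs : s ≠ 0) {a : ℕ →₀ ℂ} (ha : a ≠ 0)
    (hf : ∀ x : ℤ, ∑ n ∈ a.support, a n * f (x + s * n) = 0) : f ∈ expSpan := by
  refine mem_expSpan_of_aeval f (Q := ∑ n ∈ a.support, monomial (s * n) (a n)) ?_ ?_
  · obtain ⟨m, hm⟩ := Finsupp.ne_iff.mp ha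
    intro h0
    have h1 := congrArg (fun Q => coeff Q (s * m)) h0
    simp only [finsetSum_coeff, coeff_monomial, coeff_zero, mul_right_inj' hs, Finset.sum_ite_eq',
      Finsupp.mem_support_iff] at h1
    rw [Finsupp.zero_apply] at hm
    rw [if_pos hm] at h1
    exact hm h1
  · ext x
    rw [map_sum, LinearMap.sum_apply, Finset.sum_apply, Pi.zero_apply, ← hf x]
    refine Finset.sum_congr rfl fun n _ => ?_
    rw [aeval_monomial, Module.End.mul_apply, Module.algebraMap_end_apply, Pi.smul_apply,
      shift_pow_apply, smul_eq_mul]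
    push_cast
    rfl

theorem exists_polynomials {f : ℤ → ℂ} (hf : f ∈ expSpan) :
    ∃ (r : ℕ) (p : Fin r → ℂ[X]) (α : Fin r → ℂ), (∀ j, α j ≠ 0) ∧
      ∀ k : ℤ, f k = ∑ j, (p j).eval (k : ℂ) * α j ^ k := by
  obtain ⟨r, c, g, rfl⟩ := Submodule.mem_span_set'.mp hf
  choose n α hα hg using fun i => (g i).2
  refine ⟨r, fun j => C (c j) * X ^ n j, α, hα, fun k => ?_⟩
  simp [hg, expMon, mul_assoc]

variable (b : Module.Basis (Fin 2) ℤ (ℤ × ℤ))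

/-- The linear function on `L` with values `f k / k` on `D(j 𝐛₁ + k 𝐛₂)` and
`-det(𝐛₁, 𝐛₂) f 0` on `h(𝐛₁)`, and vanishing on `h(𝐛₂)`. -/
def psiLin (f : ℤ → ℂ) : L →ₗ[ℂ] ℂ :=
  (Finsupp.linearCombination ℂ fun m : {m : ℤ × ℤ // m ≠ 0} =>
      f (b.repr m 1) / (b.repr m 1 : ℂ)) ∘ₗ dPart +
    (-f 0) • ((((b 1).2 : ℂ) • LinearMap.fst ℂ ℂ ℂ - ((b 1).1 : ℂ) • LinearMap.snd ℂ ℂ ℂ) ∘ₗ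
      cPart)

/-- The linear function on `L_0` with prescribed values `f k / k` on `D(k 𝐛₂)` and
`-det(𝐛₁, 𝐛₂) f 0` on `h(𝐛₁)`, and vanishing on `h(𝐛₂)`. -/
def psiOf (f : ℤ → ℂ) : Ldeg b 0 →ₗ[ℂ] ℂ := (psiLin b f).domRestrict (Ldeg b 0)

theorem psiOf_D0 (f : ℤ → ℂ) {k : ℤ} (hk : k ≠ 0) : psiOf b f (D0 b k) = f k / k := by
  have hne : k • b 1 ≠ 0 := fun h => hk (by
    have := congrArg (fun z => b.repr z 1) h
    simpa [-zsmul_eq_mul] using this)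
  have hc : cPart (D (k • b 1)) = 0 := by simp only [D, dif_neg hne]; rfl
  simp [psiOf, psiLin, D0, hc, dPart_D_of_ne hne, -zsmul_eq_mul]

theorem psiOf_h0 (f : ℤ → ℂ) (m : ℤ × ℤ) :
    psiOf b f (h0 b m) = -((det m (b 1) : ℂ) * f 0) := by
  have hc : cPart (h m) = ((m.1 : ℂ), (m.2 : ℂ)) := rfl
  simp only [psiOf, psiLin, h0, LinearMap.domRestrict_apply, LinearMap.add_apply, LinearMap.comp_apply,
    dPart_h, map_zero, LinearMap.smul_apply, LinearMap.sub_apply, hc, LinearMap.fst_apply,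
    LinearMap.snd_apply, smul_eq_mul, det]
  push_cast
  ring

theorem isExpPolynomial_psiOf {f : ℤ → ℂ} (hf : f ∈ expSpan) (hf0 : f ≠ 0) :
    IsExpPolynomial b (psiOf b f) := by
  obtain ⟨r, p, α, hα, hp⟩ := exists_polynomials hf
  refine ⟨fun h => hf0 ?_, by rw [psiOf_h0, det_self]; simp, r, p, α, hα,
    fun k hk => by rw [psiOf_D0 b f hk, hp], ?_⟩
  · ext k
    by_cases hk : k = 0
    · subst hk
      have h1 := psiOf_h0 b f (b 0)
      rw [h, LinearMap.zero_apply] at h1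
      exact (mul_eq_zero.mp (neg_eq_zero.mp h1.symm)).resolve_left (bdet_ne_zero' b)
    · have h1 := psiOf_D0 b f hk
      rw [h, LinearMap.zero_apply, eq_comm, div_eq_zero_iff] at h1
      exact h1.resolve_right (by exact_mod_cast hk)
  · rw [psiOf_h0, hp 0]
    simp [Polynomial.coeff_zero_eq_eval_zero]

end ExpPolynomial

/-! ### Direct sum decompositions and quotients -/

section Decompositions

variable {V : Type*} [AddCommGroup V] [Module ℂ V] {ι : Type*} [DecidableEq ι]
  {G : ι → Submodule ℂ V}

theorem isInternal_of_proj (hG : ⨆ n, G n = ⊤) (π : ι → V →ₗ[ℂ] V)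
    (hπ : ∀ n, ∀ w ∈ G n, π n w = w) (hπ' : ∀ m n, m ≠ n → ∀ w ∈ G m, π n w = 0) :
    DirectSum.IsInternal G := by
  refine (DirectSum.isInternal_submodule_iff_iSupIndep_and_iSup_eq_top G).mpr ⟨fun n => ?_, hG⟩
  refine Submodule.disjoint_def.mpr fun w hw hw' => ?_
  have hle : ⨆ m, ⨆ (_ : m ≠ n), G m ≤ LinearMap.ker (π n) :=
    iSup₂_le fun m hm w hw => hπ' m n hm w hw
  rw [← hπ n w hw]
  exact hle hw'

theorem comp_map {N : Type*} [AddCommGroup N] [Module ℂ N] {H : ι → Submodule ℂ N}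
    (hG : DirectSum.IsInternal G) (hH : DirectSum.IsInternal H) (F : V →ₗ[ℂ] N)
    (hF : ∀ n, ∀ w ∈ G n, F w ∈ H n) (n : ι) (w : V) : comp hH n (F w) = F (comp hG n w) := by
  have hw : w ∈ ⨆ i, G i := by rw [hG.submodule_iSup_eq_top]; trivial
  induction hw using Submodule.iSup_induction' with
  | mem k w hw =>
    by_cases hk : k = n
    · subst hk
      rw [comp_same hG hw, comp_same hH (hF k w hw)]
    · rw [comp_of_ne hG hk hw, comp_of_ne hH hk (hF k w hw), map_zero]
  | zero => simp only [map_zero]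
  | add x y _ _ hx hy => simp only [map_add, hx, hy]

variable [LieRingModule L V] [LieModule ℂ L V]

theorem comp_mem_of_isGradedSub (hG : DirectSum.IsInternal G) {N : LieSubmodule ℂ L V}
    (hN : IsGradedSub G N) {w : V} (hw : w ∈ N) (n : ι) : comp hG n w ∈ N := by
  have hle : N.toSubmodule ≤ N.toSubmodule.comap (comp hG n) := by
    conv_lhs => rw [hN]
    refine iSup_le fun k w hw => ?_
    by_cases hk : k = n
    · subst hk
      rw [Submodule.mem_comap, comp_same hG hw.2]
      exact hw.1
    · rw [Submodule.mem_comap, comp_of_ne hG hk hw.2]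
      exact zero_mem _
  exact hle hw

theorem isGradedSub_sSup {S : Set (LieSubmodule ℂ L V)} (hS : ∀ N ∈ S, IsGradedSub G N) :
    IsGradedSub G (sSup S) := by
  refine le_antisymm ?_ (iSup_le fun k => inf_le_left)
  have hle : ∀ N ∈ S, N.toSubmodule ≤ (sSup S).toSubmodule := fun N hN =>
    LieSubmodule.toSubmodule_le_toSubmodule _ _ |>.mpr (le_sSup hN)
  conv_lhs => rw [LieSubmodule.sSup_toSubmodule_eq_iSup]
  refine iSup₂_le fun N hN => ?_
  rw [hS N hN]
  exact iSup_mono fun k => inf_le_inf_right _ (hle N hN)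

/-- The images of the homogeneous subspaces decompose the quotient by a graded submodule. -/
theorem isInternal_quotient (hG : DirectSum.IsInternal G) {N : LieSubmodule ℂ L V}
    (hN : IsGradedSub G N) : DirectSum.IsInternal fun n =>
      (G n).map (LieSubmodule.Quotient.mk' N : V →ₗ[ℂ] V ⧸ N) := by
  have hsurj : Function.Surjective (LieSubmodule.Quotient.mk' N : V →ₗ[ℂ] V ⧸ N) :=
    LieSubmodule.Quotient.surjective_mk' N
  refine isInternal_of_proj ?_
    (fun n => N.toSubmodule.mapQ N.toSubmodule (comp hG n) fun w hw =>
      comp_mem_of_isGradedSub hG hN hw n) ?_ ?_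
  · rw [← Submodule.map_iSup, hG.submodule_iSup_eq_top, Submodule.map_top]
    exact LinearMap.range_eq_top.mpr hsurj
  · rintro n _ ⟨w, hw, rfl⟩
    exact (Submodule.mapQ_apply _ _ _ _).trans (congrArg _ (comp_same hG hw))
  · rintro m n hmn _ ⟨w, hw, rfl⟩
    refine (Submodule.mapQ_apply _ _ _ _).trans ?_
    rw [comp_of_ne hG hmn hw]
    exact Submodule.Quotient.mk_zero _

end Decompositions

/-! ### The induced module -/

section Verma

attribute [local instance] LieRing.ofAssociativeRing

variable (b : Module.Basis (Fin 2) ℤ (ℤ × ℤ)) (ψ : Ldeg b 0 →ₗ[ℂ] ℂ)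

theorem Db_mem_Ldeg (j x : ℤ) : Db b j x ∈ Ldeg b j :=
  Submodule.mem_sup_left (Submodule.subset_span ⟨x, rfl⟩)

/-- The universal property of the induced module. -/
theorem exists_vermaLift {M : Type*} [AddCommGroup M] [Module ℂ M] [LieRingModule L M]
    [LieModule ℂ L M] {m : M} (hpos : ∀ j, 0 < j → ∀ x ∈ Ldeg b j, ⁅x, m⁆ = 0)
    (hzero : ∀ x : Ldeg b 0, ⁅(x : L), m⁆ = ψ x • m) :
    ∃ F : Verma b ψ →ₗ⁅ℂ,L⁆ M, F (vermaVec b ψ) = m := by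
  let A := UniversalEnvelopingAlgebra.lift ℂ (LieModule.toEnd ℂ L M)
  have hA : ∀ x w, A (UniversalEnvelopingAlgebra.ι ℂ x) w = ⁅x, w⁆ := fun x w => by
    simp only [A, UniversalEnvelopingAlgebra.lift_ι_apply, LieModule.toEnd_apply_apply]
  let _ : Module (UniversalEnvelopingAlgebra ℂ L) M := Module.compHom M A.toRingHom
  have hsm : ∀ (u : UniversalEnvelopingAlgebra ℂ L) (w : M), u • w = A u w := fun _ _ => rfl
  have hle : vermaIdeal b ψ ≤ LinearMap.ker (LinearMap.toSpanSingleton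
      (UniversalEnvelopingAlgebra ℂ L) M m) := by
    refine Submodule.span_le.mpr ?_
    rintro _ (⟨j, hj, x, hx, rfl⟩ | ⟨x, rfl⟩)
    · rw [SetLike.mem_coe, LinearMap.mem_ker, LinearMap.toSpanSingleton_apply, hsm, hA,
        hpos j hj x hx]
    · rw [SetLike.mem_coe, LinearMap.mem_ker, LinearMap.toSpanSingleton_apply, hsm, map_sub,
        LinearMap.sub_apply, hA, hzero, AlgHom.commutes, Module.algebraMap_end_apply, sub_self]
  let F := (vermaIdeal b ψ).liftQ (LinearMap.toSpanSingleton
      (UniversalEnvelopingAlgebra ℂ L) M m) hle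
  have hF : ∀ (u : UniversalEnvelopingAlgebra ℂ L) (w : Verma b ψ), F (u • w) = A u (F w) :=
    fun u w => F.map_smul u w
  refine ⟨{ toFun := F, map_add' := F.map_add, map_smul' := fun c w => ?_, map_lie' := ?_ }, ?_⟩
  · rw [← algebraMap_smul (UniversalEnvelopingAlgebra ℂ L) c w]
    refine (hF _ _).trans ?_
    rw [AlgHom.commutes, Module.algebraMap_end_apply]
    rfl
  · intro x w
    exact (hF _ _).trans (hA _ _)
  · change F (Submodule.Quotient.mk 1) = m
    refine (Submodule.liftQ_apply _ _ _).trans ?_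
    rw [LinearMap.toSpanSingleton_apply, one_smul]

theorem lieSpan_vermaVec : LieSubmodule.lieSpan ℂ L {vermaVec b ψ} = ⊤ := by
  refine top_le_iff.mp fun w _ => ?_
  set N := LieSubmodule.lieSpan ℂ L {vermaVec b ψ} with hN
  let S : Subalgebra ℂ (UniversalEnvelopingAlgebra ℂ L) :=
    { carrier := {u | ∀ w ∈ N, u • w ∈ N}
      mul_mem' := fun {u v} hu hv w hw => by rw [mul_smul]; exact hu _ (hv _ hw)
      add_mem' := fun {u v} hu hv w hw => by rw [add_smul]; exact add_mem (hu _ hw) (hv _ hw)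
      algebraMap_mem' := fun c w hw => by
        rw [algebraMap_smul]; exact Submodule.smul_mem N.toSubmodule c hw }
  let f : L →ₗ⁅ℂ⁆ S :=
    { toFun := fun x => ⟨UniversalEnvelopingAlgebra.ι ℂ x, fun w hw => N.lie_mem hw⟩
      map_add' := fun x y => Subtype.ext (map_add _ _ _)
      map_smul' := fun c x => Subtype.ext (map_smul _ _ _)
      map_lie' := fun {x y} => Subtype.ext (LieHom.map_lie _ _ _) }
  have hf : S.val.comp (UniversalEnvelopingAlgebra.lift ℂ f) =
      AlgHom.id ℂ (UniversalEnvelopingAlgebra ℂ L) := by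
    refine UniversalEnvelopingAlgebra.hom_ext ℂ ?_
    ext x
    simp only [LieHom.comp_apply, AlgHom.coe_toLieHom, AlgHom.comp_apply,
      UniversalEnvelopingAlgebra.lift_ι_apply, AlgHom.id_apply]
    rfl
  obtain ⟨u, rfl⟩ := Submodule.Quotient.mk_surjective _ w
  have h1 : u ∈ S := by
    have := (UniversalEnvelopingAlgebra.lift ℂ f u).2
    have h2 := DFunLike.congr_fun hf u
    rwa [show ((UniversalEnvelopingAlgebra.lift ℂ f u : S) : UniversalEnvelopingAlgebra ℂ L) = u
      from h2] at this
  have h2 := h1 (vermaVec b ψ) (LieSubmodule.subset_lieSpan rfl)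
  have h3 : u • vermaVec b ψ = Submodule.Quotient.mk u :=
    (Submodule.Quotient.mk_smul (vermaIdeal b ψ) u 1).symm.trans (congrArg _ (mul_one u))
  rwa [h3] at h2

theorem lie_mem_vermaDeg {j n : ℤ} {x : L} (hx : x ∈ Ldeg b j) {w : Verma b ψ}
    (hw : w ∈ vermaDeg b ψ n) : ⁅x, w⁆ ∈ vermaDeg b ψ (j + n) := by
  induction hw using Submodule.span_induction with
  | mem w hw =>
    obtain ⟨l, hl, rfl, rfl⟩ := hw
    refine Submodule.subset_span ⟨(j, x) :: l, ?_, by simp, ?_⟩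
    · intro p hp
      rcases List.mem_cons.mp hp with rfl | hp
      · exact hx
      · exact hl p hp
    · rw [List.map_cons, List.prod_cons, mul_smul]
      rfl
  | zero => rw [lie_zero]; exact zero_mem _
  | add y z _ _ hy hz => rw [lie_add]; exact add_mem hy hz
  | smul c y _ hy => rw [lie_smul]; exact Submodule.smul_mem _ _ hy

theorem vermaVec_mem : vermaVec b ψ ∈ vermaDeg b ψ 0 :=
  Submodule.subset_span ⟨[], by simp, rfl, by simp⟩

theorem iSup_vermaDeg : ⨆ n, vermaDeg b ψ n = ⊤ := by
  have hD : ∀ m, ∀ w ∈ ⨆ n, vermaDeg b ψ n, ⁅D m, w⁆ ∈ ⨆ n, vermaDeg b ψ n := by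
    intro m w hw
    rw [D_eq_Db b]
    induction hw using Submodule.iSup_induction' with
    | mem n w hw => exact Submodule.mem_iSup_of_mem _ (lie_mem_vermaDeg b ψ (Db_mem_Ldeg b _ _) hw)
    | zero => rw [lie_zero]; exact zero_mem _
    | add y z _ _ hy hz => rw [lie_add]; exact add_mem hy hz
  have hle : LieSubmodule.lieSpan ℂ L {vermaVec b ψ} ≤ subOfD _ hD :=
    LieSubmodule.lieSpan_le.mpr (Set.singleton_subset_iff.mpr
      (Submodule.mem_iSup_of_mem 0 (vermaVec_mem b ψ)))
  rw [lieSpan_vermaVec b ψ] at hle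
  exact top_le_iff.mp fun w _ => hle (LieSubmodule.mem_top w)

theorem lie_vermaVec_of_pos {j : ℤ} (hj : 0 < j) {x : L} (hx : x ∈ Ldeg b j) :
    ⁅x, vermaVec b ψ⁆ = 0 := by
  change UniversalEnvelopingAlgebra.ι ℂ x • Submodule.Quotient.mk 1 = _
  refine (Submodule.Quotient.mk_smul _ _ _).symm.trans ((Submodule.Quotient.mk_eq_zero _).mpr ?_)
  rw [smul_eq_mul, mul_one]
  exact Ideal.subset_span (.inl ⟨j, hj, x, hx, rfl⟩)

theorem lie_vermaVec (x : Ldeg b 0) : ⁅(x : L), vermaVec b ψ⁆ = ψ x • vermaVec b ψ := by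
  rw [← algebraMap_smul (UniversalEnvelopingAlgebra ℂ L) (ψ x)]
  change UniversalEnvelopingAlgebra.ι ℂ (x : L) • Submodule.Quotient.mk 1 =
    algebraMap ℂ (UniversalEnvelopingAlgebra ℂ L) (ψ x) • Submodule.Quotient.mk 1
  refine sub_eq_zero.mp ((sub_smul _ _ _).symm.trans ?_)
  refine (Submodule.Quotient.mk_smul _ _ _).symm.trans ((Submodule.Quotient.mk_eq_zero _).mpr ?_)
  rw [smul_eq_mul, mul_one]
  exact Ideal.subset_span (.inr ⟨x, rfl⟩)

end Verma

/-! ### Coefficients of Laurent polynomials with values in a module -/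

section Coefficients

variable (b : Module.Basis (Fin 2) ℤ (ℤ × ℤ))
variable (M : Type*) [AddCommGroup M] [Module ℂ M] [LieRingModule L M] [LieModule ℂ L M]

/-- The coefficient of `t ^ k`. -/
def loopCoeff (k : ℤ) : Loop b M →ₗ[ℂ] M :=
  (TensorProduct.rid ℂ M).toLinearMap ∘ₗ
    TensorProduct.map LinearMap.id (Finsupp.lapply k ∘ₗ
      (AddMonoidAlgebra.coeffLinearEquiv (S := ℂ) (M := ℤ) ℂ).toLinearMap)

variable {M}

theorem loopCoeff_loopTmul (k l : ℤ) (v : M) :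
    loopCoeff b M l (loopTmul b M k v) = if k = l then v else 0 := by
  have h1 : (LaurentPolynomial.T k : LaurentPolynomial ℂ).coeff l = if k = l then 1 else 0 := by
    rw [LaurentPolynomial.T, AddMonoidAlgebra.coeff_single, Finsupp.single_apply]
  have h2 : loopCoeff b M l (loopTmul b M k v) =
      (LaurentPolynomial.T k : LaurentPolynomial ℂ).coeff l • v := rfl
  rw [h2, h1, ite_smul, one_smul, zero_smul]

theorem loopTmul_injective (k : ℤ) : Function.Injective (loopTmul b M k) := by
  refine Function.LeftInverse.injective (g := loopCoeff b M k) fun v => ?_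
  rw [loopCoeff_loopTmul, if_pos rfl]

theorem lie_Db_loopTmul (j x k : ℤ) (v : M) :
    ⁅Db b j x, loopTmul b M k v⁆ = loopTmul b M (k + x) ⁅Db b j x, v⁆ := lie_D_loopTmul b j x k v

/-- With the two basis vectors exchanged, the exponent of `t` records the `ℤ`-grading of `L`. -/
theorem lie_loopTmul_swap {j : ℤ} {x : L} (hx : x ∈ Ldeg b j) (k : ℤ) (v : M) :
    ⁅x, loopTmul (b.reindex (Equiv.swap 0 1)) M k v⁆ =
      loopTmul (b.reindex (Equiv.swap 0 1)) M (k + j) ⁅x, v⁆ := by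
  obtain ⟨y, hy, z, hz, rfl⟩ := Submodule.mem_sup.mp hx
  clear hx
  rw [add_lie, add_lie, map_add]
  congr 1
  · induction hy using Submodule.span_induction with
    | mem y hy =>
      obtain ⟨m, rfl⟩ := hy
      have := lie_D_loopTmul (b.reindex (Equiv.swap 0 1)) m j k v
      simp only [Module.Basis.reindex_apply, Equiv.symm_swap, Equiv.swap_apply_left,
        Equiv.swap_apply_right] at this
      rwa [add_comm (m • b 1)] at this
    | zero => rw [zero_lie, zero_lie, map_zero]
    | add y z _ _ hy hz =>
      rw [add_lie, add_lie, map_add, hy, hz]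
    | smul c y _ hy => rw [smul_lie, smul_lie, map_smul, hy]
  · split_ifs at hz with hj
    · obtain ⟨z, rfl⟩ := hz
      rw [lie_cen_loopTmul, hj, add_zero]
    · rw [(Submodule.mem_bot ℂ).mp hz, zero_lie, zero_lie, map_zero]

end Coefficients

/-! ### The gradings of the highest weight modules -/

section HighestWeight

variable (b : Module.Basis (Fin 2) ℤ (ℤ × ℤ)) (ψ : Ldeg b 0 →ₗ[ℂ] ℂ)

/-- The induced module is the direct sum of its homogeneous subspaces: the universal property gives
a homomorphism to a loop module that sends `w` of degree `n` to `w ⊗ t ^ n`, and its Laurent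
coefficients are the projections. -/
theorem isInternal_vermaDeg : DirectSum.IsInternal (vermaDeg b ψ) := by
  obtain ⟨F, hF⟩ := exists_vermaLift b ψ
    (m := loopTmul (b.reindex (Equiv.swap 0 1)) (Verma b ψ) 0 (vermaVec b ψ))
    (fun j hj x hx => by
      rw [lie_loopTmul_swap b hx, lie_vermaVec_of_pos b ψ hj hx, map_zero])
    (fun x => by rw [lie_loopTmul_swap b x.2, lie_vermaVec, map_smul, add_zero])
  have hFn : ∀ n, ∀ w ∈ vermaDeg b ψ n,
      F w = loopTmul (b.reindex (Equiv.swap 0 1)) (Verma b ψ) n w := by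
    intro n w hw
    induction hw using Submodule.span_induction with
    | mem w hw =>
      obtain ⟨l, hl, rfl, rfl⟩ := hw
      induction l with
      | nil => simpa using hF
      | cons p l ih =>
        have h1 := ih fun q hq => hl q (List.mem_cons_of_mem p hq)
        rw [List.map_cons, List.prod_cons, mul_smul, List.map_cons, List.sum_cons]
        refine (LieModuleHom.map_lie F p.2 _).trans ?_
        rw [h1, lie_loopTmul_swap b (hl p List.mem_cons_self), add_comm]
        rfl
    | zero => rw [map_zero, map_zero]
    | add y z _ _ hy hz => rw [map_add, map_add, hy, hz]
    | smul c y _ hy => rw [map_smul, map_smul, hy]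
  refine isInternal_of_proj (iSup_vermaDeg b ψ)
    (fun n => loopCoeff (b.reindex (Equiv.swap 0 1)) (Verma b ψ) n ∘ₗ (F : Verma b ψ →ₗ[ℂ] _)) ?_ ?_
  · intro n w hw
    refine (congrArg (loopCoeff (b.reindex (Equiv.swap 0 1)) (Verma b ψ) n) (hFn n w hw)).trans ?_
    rw [loopCoeff_loopTmul, if_pos rfl]
  · intro m n hmn w hw
    refine (congrArg (loopCoeff (b.reindex (Equiv.swap 0 1)) (Verma b ψ) n) (hFn m w hw)).trans ?_
    rw [loopCoeff_loopTmul, if_neg hmn]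

theorem mem_Ldeg_zero_h (m : ℤ × ℤ) : h m ∈ Ldeg b 0 := (h0 b m).2

theorem vermaDeg_zero_le : vermaDeg b ψ 0 ≤ ℂ ∙ vermaVec b ψ := by
  have hI := isInternal_vermaDeg b ψ
  have hle := lieSpan_le_of_top b (Lv := vermaDeg b ψ) (n₀ := 0) (S := ℂ ∙ vermaVec b ψ)
    (fun j x n w hw => lie_mem_vermaDeg b ψ (Db_mem_Ldeg b j x) hw)
    ((Submodule.span_singleton_le_iff_mem _ _).mpr (vermaVec_mem b ψ))
    (fun x w hw => by
      obtain ⟨c, rfl⟩ := Submodule.mem_span_singleton.mp hw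
      rw [lie_smul, lie_vermaVec b ψ ⟨Db b 0 x, Db_mem_Ldeg b 0 x⟩]
      exact Submodule.smul_mem _ _ (Submodule.smul_mem _ _ (Submodule.mem_span_singleton_self _)))
    (fun m w hw => by
      obtain ⟨c, rfl⟩ := Submodule.mem_span_singleton.mp hw
      rw [lie_smul, lie_vermaVec b ψ ⟨h m, mem_Ldeg_zero_h b m⟩]
      exact Submodule.smul_mem _ _ (Submodule.smul_mem _ _ (Submodule.mem_span_singleton_self _)))
    (fun j x hj w hw => by
      obtain ⟨c, rfl⟩ := Submodule.mem_span_singleton.mp hw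
      rw [lie_smul, lie_vermaVec_of_pos b ψ hj (Db_mem_Ldeg b j x), smul_zero])
  have htop : LieSubmodule.lieSpan ℂ L
      ((ℂ ∙ vermaVec b ψ : Submodule ℂ (Verma b ψ)) : Set (Verma b ψ)) = ⊤ := by
    refine top_le_iff.mp ?_
    rw [← lieSpan_vermaVec b ψ]
    exact LieSubmodule.lieSpan_mono
      (Set.singleton_subset_iff.mpr (Submodule.mem_span_singleton_self _))
  rw [htop] at hle
  intro w hw
  obtain ⟨a, ha, c, hc, hac⟩ := Submodule.mem_sup.mp (hle (LieSubmodule.mem_top w))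
  have hlow : ⨆ k : {k : ℤ // k < 0}, vermaDeg b ψ k ≤ LinearMap.ker (comp hI 0) :=
    iSup_le fun k w hw => comp_of_ne hI (by have := k.2; omega) hw
  have hc0 : comp hI 0 c = 0 := hlow hc
  have ha0 : a ∈ vermaDeg b ψ 0 :=
    (Submodule.span_singleton_le_iff_mem _ _).mpr (vermaVec_mem b ψ) ha
  rwa [← comp_same hI hw, ← hac, map_add, hc0, add_zero, comp_same hI ha0]

/-- The component of degree `0` vanishes on the largest proper graded submodule, because the
homogeneous subspace of degree `0` is spanned by the generator. -/
theorem comp_zero_of_mem_vermaMax {w : Verma b ψ} (hw : w ∈ vermaMax b ψ) :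
    comp (isInternal_vermaDeg b ψ) 0 w = 0 := by
  have hI := isInternal_vermaDeg b ψ
  have hle : (vermaMax b ψ).toSubmodule ≤ LinearMap.ker (comp hI 0) := by
    rw [vermaMax, LieSubmodule.sSup_toSubmodule_eq_iSup]
    refine iSup₂_le fun N hN w hw => ?_
    have h1 := comp_mem_of_isGradedSub hI hN.1 hw 0
    obtain ⟨c, hc⟩ := Submodule.mem_span_singleton.mp
      (vermaDeg_zero_le b ψ (comp_mem hI 0 w))
    rw [LinearMap.mem_ker, ← hc]
    by_cases hc0 : c = 0
    · rw [hc0, zero_smul]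
    · exfalso
      rw [← hc] at h1
      have h2 : vermaVec b ψ ∈ N := (Submodule.smul_mem_iff N.toSubmodule hc0).mp h1
      refine hN.2 (top_le_iff.mp ?_)
      rw [← lieSpan_vermaVec b ψ]
      exact LieSubmodule.lieSpan_le.mpr (Set.singleton_subset_iff.mpr h2)
  exact hle hw

theorem hwVec_ne_zero (h0 : vermaVec b ψ ≠ 0) : hwVec b ψ ≠ 0 := by
  intro h1
  have h2 : vermaVec b ψ ∈ vermaMax b ψ := (LieSubmodule.Quotient.mk_eq_zero'.mp h1)
  refine h0 ?_
  rw [← comp_same (isInternal_vermaDeg b ψ) (vermaVec_mem b ψ), comp_zero_of_mem_vermaMax b ψ h2]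

theorem isGradedSub_vermaMax : IsGradedSub (vermaDeg b ψ) (vermaMax b ψ) :=
  isGradedSub_sSup fun _ hN => hN.1

theorem isInternal_hwDeg : DirectSum.IsInternal (hwDeg b ψ) :=
  isInternal_quotient (isInternal_vermaDeg b ψ) (isGradedSub_vermaMax b ψ)

theorem hwVec_mem : hwVec b ψ ∈ hwDeg b ψ 0 := ⟨_, vermaVec_mem b ψ, rfl⟩

theorem lie_mem_hwDeg {j n : ℤ} {x : L} (hx : x ∈ Ldeg b j) {w : HW b ψ}
    (hw : w ∈ hwDeg b ψ n) : ⁅x, w⁆ ∈ hwDeg b ψ (j + n) := by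
  obtain ⟨w, hw, rfl⟩ := hw
  exact ⟨⁅x, w⁆, lie_mem_vermaDeg b ψ hx hw, LieModuleHom.map_lie _ x w⟩

theorem hwDeg_zero_le : hwDeg b ψ 0 ≤ ℂ ∙ hwVec b ψ := by
  rintro _ ⟨w, hw, rfl⟩
  obtain ⟨c, rfl⟩ := Submodule.mem_span_singleton.mp (vermaDeg_zero_le b ψ hw)
  rw [map_smul]
  exact Submodule.smul_mem _ _ (Submodule.mem_span_singleton_self _)

theorem lie_hwVec (x : Ldeg b 0) : ⁅(x : L), hwVec b ψ⁆ = ψ x • hwVec b ψ := by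
  refine (LieModuleHom.map_lie (LieSubmodule.Quotient.mk' (vermaMax b ψ)) _ _).symm.trans ?_
  rw [lie_vermaVec, map_smul]
  rfl

theorem lie_hwVec_of_pos {j : ℤ} (hj : 0 < j) {x : L} (hx : x ∈ Ldeg b j) :
    ⁅x, hwVec b ψ⁆ = 0 := by
  refine (LieModuleHom.map_lie (LieSubmodule.Quotient.mk' (vermaMax b ψ)) _ _).symm.trans ?_
  rw [lie_vermaVec_of_pos b ψ hj hx, map_zero]

end HighestWeight

/-! ### The `ℤ²`-gradings -/

section LoopGrading

variable (b : Module.Basis (Fin 2) ℤ (ℤ × ℤ))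
variable {M : Type*} [AddCommGroup M] [Module ℂ M] [LieRingModule L M] [LieModule ℂ L M]

theorem iSup_range_loopTmul : ⨆ k, LinearMap.range (loopTmul b M k) = ⊤ := by
  let t : M →ₗ[ℂ] LaurentPolynomial ℂ →ₗ[ℂ] Loop b M := TensorProduct.mk ℂ M (LaurentPolynomial ℂ)
  have key : ∀ v p, t v p ∈ ⨆ k, LinearMap.range (loopTmul b M k) := by
    intro v p
    induction p using LaurentPolynomial.induction_on' with
    | add p q hp hq => rw [map_add]; exact add_mem hp hq
    | C_mul_T n a =>
      rw [← LaurentPolynomial.smul_eq_C_mul, map_smul]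
      exact Submodule.smul_mem _ a (Submodule.mem_iSup_of_mem n ⟨v, rfl⟩)
  refine top_le_iff.mp fun w _ => ?_
  exact TensorProduct.induction_on (motive := fun w => w ∈ ⨆ k, LinearMap.range (loopTmul b M k))
    w (zero_mem _) key (fun _ _ hx hy => add_mem hx hy)

theorem basis_repr_ext {m n : ℤ × ℤ} (h0 : b.repr m 0 = b.repr n 0)
    (h1 : b.repr m 1 = b.repr n 1) : m = n := by
  rw [eq_repr b m, eq_repr b n, h0, h1]

theorem isInternal_loopDeg {G : ℤ → Submodule ℂ M} (hG : DirectSum.IsInternal G) :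
    DirectSum.IsInternal (loopDeg b G) := by
  refine isInternal_of_proj ?_
    (fun γ => loopTmul b M (b.repr γ 1) ∘ₗ comp hG (b.repr γ 0) ∘ₗ loopCoeff b M (b.repr γ 1)) ?_ ?_
  · rw [← top_le_iff, ← iSup_range_loopTmul b]
    refine iSup_le fun k => ?_
    rintro _ ⟨v, rfl⟩
    obtain ⟨t, ht⟩ := exists_sum_comp hG v
    rw [ht, map_sum]
    refine sum_mem fun n _ => Submodule.mem_iSup_of_mem (n • b 0 + k • b 1) ?_
    rw [loopDeg, repr_add_smul, repr_add_smul, if_pos rfl, if_neg (by norm_num)]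
    exact ⟨_, comp_mem hG n v, rfl⟩
  · rintro γ _ ⟨v, hv, rfl⟩
    simp only [LinearMap.comp_apply, loopCoeff_loopTmul, if_pos]
    rw [comp_same hG hv]
  · rintro γ γ' hne _ ⟨v, hv, rfl⟩
    simp only [LinearMap.comp_apply, loopCoeff_loopTmul]
    split_ifs with h1
    · rw [comp_of_ne hG (fun h0 => hne (basis_repr_ext b h0 h1)) hv, map_zero]
    · rw [map_zero, map_zero]

theorem isZ2Graded_loopDeg {G : ℤ → Submodule ℂ M} (hG : DirectSum.IsInternal G)
    (hGL : ∀ j x n, ∀ w ∈ G n, ⁅Db b j x, w⁆ ∈ G (j + n)) : IsZ2Graded (loopDeg b G) := by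
  refine ⟨isInternal_loopDeg b hG, ?_⟩
  rintro m n _ ⟨v, hv, rfl⟩
  rw [D_eq_Db b, lie_Db_loopTmul, loopDeg, map_add, Finsupp.add_apply, Finsupp.add_apply,
    add_comm (b.repr m 1)]
  exact ⟨_, hGL _ _ _ v hv, rfl⟩

variable {b}

theorem IsString.map {N : Type*} [AddCommGroup N] [Module ℂ N] [LieRingModule L N]
    [LieModule ℂ L N] {u : ℤ → M} {f : ℤ → ℂ} (hu : IsString b u f) (F : M →ₗ⁅ℂ,L⁆ N) :
    IsString b (fun k => F (u k)) f := by
  refine ⟨fun j x k hj => ?_, fun x k => ?_, fun k => ?_, fun k => ?_⟩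
  · rw [← LieModuleHom.map_lie, hu.pos j x k hj, map_zero]
  · rw [← LieModuleHom.map_lie, hu.zero, map_smul]
  · rw [← LieModuleHom.map_lie, hu.h_zero, map_smul]
  · rw [← LieModuleHom.map_lie, hu.h_one, map_zero]

end LoopGrading

section Bar

variable (b : Module.Basis (Fin 2) ℤ (ℤ × ℤ)) (ψ : Ldeg b 0 →ₗ[ℂ] ℂ) (i : ℤ)

/-- The function encoding `ψ` in the sense of `IsString`. -/
def psiFun (k : ℤ) : ℂ := if k = 0 then -ψ (h0 b (b 0)) / bdet b else k * ψ (D0 b k)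

theorem isString_topVec (hψ : ψ (h0 b (b 1)) = 0) : IsString b (topVec b ψ) (psiFun b ψ) := by
  have hh : ∀ m k, ⁅h m, topVec b ψ k⁆ = ψ (h0 b m) • topVec b ψ k := fun m k => by
    rw [topVec, h, lie_cen_loopTmul, ← map_smul]
    exact congrArg _ (lie_hwVec b ψ (h0 b m))
  have hδ := bdet_ne_zero' b
  refine ⟨fun j x k hj => ?_, fun x k => ?_, fun k => ?_, fun k => ?_⟩
  · rw [topVec, lie_Db_loopTmul, lie_hwVec_of_pos b ψ hj (Db_mem_Ldeg b j x), map_zero]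
  · rw [topVec, lie_Db_loopTmul, psiFun]
    by_cases hx : x = 0
    · subst hx
      rw [Db_zero, zero_lie, map_zero, Int.cast_zero, div_zero, zero_smul]
    · have hx' : (x : ℂ) ≠ 0 := by exact_mod_cast hx
      have hD : Db b 0 x = (D0 b x : L) := by simp [Db, D0]
      rw [if_neg hx, mul_div_cancel_left₀ _ hx', hD, lie_hwVec, map_smul]
      rfl
  · rw [hh, psiFun, if_pos rfl]
    congr 1
    field_simp
  · rw [hh, hψ, zero_smul]

theorem isZ2Graded_loop : IsZ2Graded (loopDeg b (hwDeg b ψ)) :=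
  isZ2Graded_loopDeg b (isInternal_hwDeg b ψ)
    fun j x _ _ hw => lie_mem_hwDeg b ψ (Db_mem_Ldeg b j x) hw

theorem topVec_mem (k : ℤ) : topVec b ψ k ∈ loopDeg b (hwDeg b ψ) (k • b 1) := by
  have h0 : b.repr (k • b 1) 0 = 0 := by simp [-zsmul_eq_mul]
  have h1 : b.repr (k • b 1) 1 = k := by simp [-zsmul_eq_mul]
  rw [loopDeg, h0, h1]
  exact ⟨_, hwVec_mem b ψ, rfl⟩

theorem loopDeg_le_of_repr_eq_zero {γ : ℤ × ℤ} (hγ : b.repr γ 0 = 0) :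
    loopDeg b (hwDeg b ψ) γ ≤ ℂ ∙ topVec b ψ (b.repr γ 1) := by
  rintro _ ⟨v, hv, rfl⟩
  rw [hγ] at hv
  obtain ⟨c, rfl⟩ := Submodule.mem_span_singleton.mp (hwDeg_zero_le b ψ hv)
  rw [map_smul]
  exact Submodule.smul_mem _ _ (Submodule.mem_span_singleton_self _)

theorem topVec_ne_zero (h0 : hwVec b ψ ≠ 0) (k : ℤ) : topVec b ψ k ≠ 0 := fun h =>
  h0 (loopTmul_injective b k (h.trans (map_zero _).symm))

theorem isGradedSub_WMax : IsGradedSub (loopDeg b (hwDeg b ψ)) (WMax b ψ i) :=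
  isGradedSub_sSup fun _ hN => hN.1

/-- A vector of `W_i` of the form `v₀ ⊗ t ^ n` spans a homogeneous subspace, so that its degree does
not occur in graded submodules that intersect `W_i` trivially. -/
theorem comp_of_mem_WMax {n : ℤ} (hn : topVec b ψ n ∈ W b ψ i) {w : VLoop b ψ}
    (hw : w ∈ WMax b ψ i) : comp (isZ2Graded_loop b ψ).internal (n • b 1) w = 0 := by
  have hI := (isZ2Graded_loop b ψ).internal
  have h1 : b.repr (n • b 1) 1 = n := by simp [-zsmul_eq_mul]
  have hle : (WMax b ψ i).toSubmodule ≤ LinearMap.ker (comp hI (n • b 1)) := by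
    rw [WMax, LieSubmodule.sSup_toSubmodule_eq_iSup]
    refine iSup₂_le fun N hN w hw => ?_
    have h2 := comp_mem_of_isGradedSub hI hN.1 hw (n • b 1)
    have h3 := loopDeg_le_of_repr_eq_zero b ψ (by simp [-zsmul_eq_mul]) (comp_mem hI (n • b 1) w)
    rw [h1] at h3
    have h4 : comp hI (n • b 1) w ∈ N.toSubmodule ⊓ (W b ψ i).toSubmodule :=
      ⟨h2, (Submodule.span_singleton_le_iff_mem _ _).mpr hn h3⟩
    rw [hN.2] at h4
    exact (Submodule.mem_bot ℂ).mp h4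
  exact hle hw

/-- The projection to `V̄(ψ, i, s)`. -/
def toBar : VLoop b ψ →ₗ⁅ℂ,L⁆ VBar b ψ i := LieSubmodule.Quotient.mk' (WMax b ψ i)

theorem toBar_surjective : Function.Surjective (toBar b ψ i) :=
  LieSubmodule.Quotient.surjective_mk' _

theorem toBar_eq_zero {w : VLoop b ψ} : toBar b ψ i w = 0 ↔ w ∈ WMax b ψ i :=
  LieSubmodule.Quotient.mk_eq_zero'

theorem toBar_mem {γ : ℤ × ℤ} {w : VLoop b ψ} (hw : w ∈ loopDeg b (hwDeg b ψ) γ) :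
    toBar b ψ i w ∈ vBarDeg b ψ i γ := ⟨w, hw, rfl⟩

theorem isZ2Graded_vBarDeg : IsZ2Graded (vBarDeg b ψ i) := by
  refine ⟨isInternal_quotient (isZ2Graded_loop b ψ).internal (isGradedSub_WMax b ψ i), ?_⟩
  rintro m n _ ⟨w, hw, rfl⟩
  exact ⟨⁅D m, w⁆, (isZ2Graded_loop b ψ).lie_mem m n w hw, LieModuleHom.map_lie _ _ _⟩

theorem toBar_topVec_ne_zero (h0 : hwVec b ψ ≠ 0) {n : ℤ} (hn : topVec b ψ n ∈ W b ψ i) :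
    toBar b ψ i (topVec b ψ n) ≠ 0 := fun h => by
  have h1 := comp_of_mem_WMax b ψ i hn ((toBar_eq_zero b ψ i).mp h)
  rw [comp_same _ (topVec_mem b ψ n)] at h1
  exact topVec_ne_zero b ψ h0 n h1

theorem topVec_mem_W : topVec b ψ i ∈ W b ψ i := LieSubmodule.subset_lieSpan rfl

theorem topVec_add_mem_W (hψ : ψ (h0 b (b 1)) = 0) {l x : ℤ} (hl : topVec b ψ l ∈ W b ψ i)
    (hx : x ≠ 0) (hfx : psiFun b ψ x ≠ 0) : topVec b ψ (l + x) ∈ W b ψ i := by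
  have hmem : Db b 0 x ∈ heis b :=
    Submodule.subset_span (.inl ⟨x, by simp [Db]⟩)
  have h1 : ⁅Db b 0 x, topVec b ψ l⁆ ∈ W b ψ i :=
    (W b ψ i).lie_mem (x := (⟨Db b 0 x, hmem⟩ : heis b)) hl
  rw [(isString_topVec b ψ hψ).zero] at h1
  exact (Submodule.smul_mem_iff (W b ψ i).toSubmodule
    (div_ne_zero hfx (by exact_mod_cast hx))).mp h1

theorem W_le (hψ : ψ (h0 b (b 1)) = 0) {C : Set ℤ} (hi : i ∈ C)
    (hC : ∀ c ∈ C, ∀ x, x ≠ 0 → psiFun b ψ x ≠ 0 → c + x ∈ C) :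
    (W b ψ i).toSubmodule ≤ Submodule.span ℂ (topVec b ψ '' C) := by
  have hu := isString_topVec b ψ hψ
  have hstab : ∀ x ∈ heis b, ∀ w ∈ Submodule.span ℂ (topVec b ψ '' C),
      ⁅x, w⁆ ∈ Submodule.span ℂ (topVec b ψ '' C) := by
    intro x hx w hw
    change x ∈ Submodule.span ℂ (Set.range (fun k : ℤ => D (k • b 1)) ∪ {h (b 1)}) at hx
    induction hx, hw using Submodule.span_induction₂ with
    | mem_mem x w hx hw =>
      obtain ⟨c, hc, rfl⟩ := hw
      rcases hx with ⟨k, rfl⟩ | hx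
      · have h1 : D (k • b 1) = Db b 0 k := by simp [Db]
        simp only [h1]
        rw [hu.zero]
        by_cases hk : k = 0
        · rw [hk, Int.cast_zero, div_zero, zero_smul]; exact zero_mem _
        by_cases hf : psiFun b ψ k = 0
        · rw [hf, zero_div, zero_smul]; exact zero_mem _
        · exact Submodule.smul_mem _ _ (Submodule.subset_span ⟨_, hC c hc k hk hf, rfl⟩)
      · rw [Set.mem_singleton_iff.mp hx, hu.h_one]; exact zero_mem _
    | zero_left y hy => rw [zero_lie]; exact zero_mem _
    | zero_right x hx => rw [lie_zero]; exact zero_mem _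
    | add_left x y z _ _ _ h1 h2 => rw [add_lie]; exact add_mem h1 h2
    | add_right x y z _ _ _ h1 h2 => rw [lie_add]; exact add_mem h1 h2
    | smul_left a x y _ _ h1 => rw [smul_lie]; exact Submodule.smul_mem _ _ h1
    | smul_right a x y _ _ h1 => rw [lie_smul]; exact Submodule.smul_mem _ _ h1
  let N : LieSubmodule ℂ (heis b) (VLoop b ψ) :=
    { Submodule.span ℂ (topVec b ψ '' C) with lie_mem := fun {x w} hw => hstab x x.2 w hw }
  have : W b ψ i ≤ N := LieSubmodule.lieSpan_le.mpr
    (Set.singleton_subset_iff.mpr (Submodule.subset_span ⟨i, hi, rfl⟩))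
  exact this

theorem mem_of_topVec_mem_span (h0 : hwVec b ψ ≠ 0) {C : Set ℤ} {n : ℤ}
    (hn : topVec b ψ n ∈ Submodule.span ℂ (topVec b ψ '' C)) : n ∈ C := by
  by_contra hnC
  have hI := (isZ2Graded_loop b ψ).internal
  have hle : Submodule.span ℂ (topVec b ψ '' C) ≤ LinearMap.ker (comp hI (n • b 1)) := by
    refine Submodule.span_le.mpr ?_
    rintro _ ⟨c, hc, rfl⟩
    refine comp_of_ne hI (fun h => hnC ?_) (topVec_mem b ψ c)
    have := congrArg (fun z => b.repr z 1) h
    simp only [map_zsmul, Module.Basis.repr_self] at this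
    simp at this
    rwa [← this]
  have h1 := hle hn
  rw [LinearMap.mem_ker, comp_same hI (topVec_mem b ψ n)] at h1
  exact topVec_ne_zero b ψ h0 n h1

/-- The index set of `W_i` is a coset of the submonoid generated by the support of `ψ`. -/
theorem isPeriod_of_closure (hψ : ψ (h0 b (b 1)) = 0) {s : ℕ}
    (hs : ∀ x, psiFun b ψ x ≠ 0 → (s : ℤ) ∣ x)
    (hcl : ∀ l, (s : ℤ) ∣ l → l ∈ AddSubmonoid.closure {x | x ≠ 0 ∧ psiFun b ψ x ≠ 0}) :
    IsPeriod b ψ i s := by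
  refine le_antisymm ?_ (Submodule.span_le.mpr ?_)
  · have := W_le b ψ i hψ (C := Set.range fun n : ℤ => i + n * s) ⟨0, by simp⟩ (by
      rintro _ ⟨n, rfl⟩ x - hx
      obtain ⟨k, rfl⟩ := hs x hx
      exact ⟨n + k, by ring⟩)
    rwa [← Set.range_comp] at this
  · rintro _ ⟨n, rfl⟩
    have h1 : ∀ x ∈ AddSubmonoid.closure {x | x ≠ 0 ∧ psiFun b ψ x ≠ 0},
        ∀ l, topVec b ψ l ∈ W b ψ i → topVec b ψ (l + x) ∈ W b ψ i := by
      intro x hx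
      induction hx using AddSubmonoid.closure_induction with
      | mem x hx => exact fun l hl => topVec_add_mem_W b ψ i hψ hl hx.1 hx.2
      | zero => intro l hl; rwa [add_zero]
      | add x y _ _ hx hy => intro l hl; rw [← add_assoc]; exact hy _ (hx _ hl)
    exact h1 _ (hcl _ (dvd_mul_left _ _)) i (topVec_mem_W b ψ i)

theorem mem_closure_of_isPeriod (hψ : ψ (h0 b (b 1)) = 0) (h0 : hwVec b ψ ≠ 0) {s : ℕ}
    (hs : IsPeriod b ψ i s) (n : ℤ) :
    n * s ∈ AddSubmonoid.closure {x | x ≠ 0 ∧ psiFun b ψ x ≠ 0} := by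
  have h1 : topVec b ψ (i + n * s) ∈ (W b ψ i).toSubmodule := by
    rw [hs]; exact Submodule.subset_span ⟨n, rfl⟩
  have h2 := mem_of_topVec_mem_span b ψ h0 (W_le b ψ i hψ
    (C := {c | c - i ∈ AddSubmonoid.closure {x | x ≠ 0 ∧ psiFun b ψ x ≠ 0}})
    (by simp) (by
      intro c hc x hx hfx
      rw [Set.mem_ofPred_eq, add_sub_right_comm]
      exact add_mem hc (AddSubmonoid.subset_closure ⟨hx, hfx⟩)) h1)
  rwa [Set.mem_ofPred_eq, add_sub_cancel_left] at h2

end Bar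

/-! ### Nontriviality of the induced module -/

section Nontrivial

variable (b : Module.Basis (Fin 2) ℤ (ℤ × ℤ))

theorem psiFun_psiOf (f : ℤ → ℂ) : psiFun b (psiOf b f) = f := by
  have hδ := bdet_ne_zero' b
  ext k
  rw [psiFun]
  split_ifs with hk
  · subst hk
    rw [psiOf_h0, show (det (b 0) (b 1) : ℂ) = bdet b from rfl]
    field_simp
  · have hk' : (k : ℂ) ≠ 0 := by exact_mod_cast hk
    rw [psiOf_D0 b f hk, mul_div_cancel₀ _ hk']

theorem psiOf_h0_one (f : ℤ → ℂ) : psiOf b f (h0 b (b 1)) = 0 := by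
  rw [psiOf_h0, det_self, Int.cast_zero, zero_mul, neg_zero]

theorem mem_Ldeg_induction {j : ℤ} {p : L → Prop} (hD : ∀ x, p (Db b j x))
    (hh : j = 0 → ∀ m, p (h m)) (h_zero : p 0) (h_add : ∀ x y, p x → p y → p (x + y))
    (h_smul : ∀ (c : ℂ) x, p x → p (c • x)) {x : L} (hx : x ∈ Ldeg b j) : p x := by
  obtain ⟨y, hy, z, hz, rfl⟩ := Submodule.mem_sup.mp hx
  clear hx
  refine h_add _ _ ?_ ?_
  · induction hy using Submodule.span_induction with
    | mem y hy => obtain ⟨m, rfl⟩ := hy; exact hD m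
    | zero => exact h_zero
    | add y z _ _ hy hz => exact h_add _ _ hy hz
    | smul c y _ hy => exact h_smul _ _ hy
  · split_ifs at hz with hj
    · obtain ⟨z, rfl⟩ := hz
      rw [cen_eq]
      exact h_add _ _ (h_smul _ _ (hh hj _)) (h_smul _ _ (hh hj _))
    · rw [(Submodule.mem_bot ℂ).mp hz]; exact h_zero

variable {M : Type*} [AddCommGroup M] [Module ℂ M] [LieRingModule L M] [LieModule ℂ L M]

theorem lie_eq_zero_of_mem_Ldeg {m : M} {j : ℤ} (hj : 0 < j) (hm : ∀ x, ⁅Db b j x, m⁆ = 0) {x : L}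
    (hx : x ∈ Ldeg b j) : ⁅x, m⁆ = 0 := by
  refine mem_Ldeg_induction b (p := fun x => ⁅x, m⁆ = 0) hm (fun h => by omega) (zero_lie m)
    (fun x y hx hy => by rw [add_lie, hx, hy, add_zero])
    (fun c x hx => by rw [smul_lie, hx, smul_zero]) hx

theorem lie_eq_psiOf_smul {f : ℤ → ℂ} {m : M} (hD : ∀ x, ⁅Db b 0 x, m⁆ = (f x / x) • m)
    (hh₀ : ⁅h (b 0), m⁆ = -(bdet b * f 0) • m) (hh₁ : ⁅h (b 1), m⁆ = 0) (x : Ldeg b 0) :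
    ⁅(x : L), m⁆ = psiOf b f x • m := by
  change ⁅(x : L), m⁆ = psiLin b f x • m
  refine mem_Ldeg_induction b (p := fun x => ⁅x, m⁆ = psiLin b f x • m) (fun k => ?_)
    (fun _ n => ?_) (by rw [zero_lie, map_zero, zero_smul])
    (fun x y hx hy => by rw [add_lie, hx, hy, map_add, add_smul])
    (fun c x hx => by rw [smul_lie, hx, map_smul, smul_assoc]) x.2
  · by_cases hk : k = 0
    · rw [hk, Db_zero, zero_lie, map_zero, zero_smul]
    · rw [hD, ← psiOf_D0 b f hk, show (Db b 0 k) = (D0 b k : L) by simp [D0, Db]]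
      rfl
  · have h1 : psiLin b f (h n) = -((det n (b 1) : ℂ) * f 0) := psiOf_h0 b f n
    have h2 : det n (b 1) = b.repr n 0 * bdet b := by
      conv_lhs => rw [eq_repr b n]
      rw [det_add_left, det_zsmul_left, det_zsmul_left, det_self, mul_zero, add_zero, bdet]
    rw [h1, h2]
    conv_lhs => rw [eq_repr b n]
    rw [h_add, h_zsmul, h_zsmul, add_lie, smul_lie, smul_lie, hh₀, hh₁, smul_zero, add_zero,
      smul_smul]
    congr 1
    push_cast
    ring

variable {b} {V : Type*} [AddCommGroup V] [Module ℂ V] [LieRingModule L V] [LieModule ℂ L V]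
  {G : ℤ × ℤ → Submodule ℂ V} {n₀ : ℤ × ℤ} {u : ℤ → V} {f : ℤ → ℂ} {s : ℕ}

theorem comp_level_eq_zero (hG : IsZ2Graded G) {w : V} {r : ℤ} (hw : w ∈ level b G r) {n : ℤ × ℤ}
    (hn : b.repr n 0 ≠ r) : comp hG.internal n w = 0 := by
  have hle : level b G r ≤ LinearMap.ker (comp hG.internal n) :=
    iSup_le fun m w hw => comp_of_ne hG.internal (fun h => hn (by rw [← h]; exact m.2)) hw
  exact hle hw

/-- The top level of a submodule generated by vectors of one level, on which `L_+` acts as `0` and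
which `L_0` preserves, consists of these vectors. -/
theorem mem_of_mem_lieSpan (hG : IsZ2Graded G) {S : Submodule ℂ V} {r : ℤ} (hS : S ≤ level b G r)
    (hS₀ : ∀ x, ∀ w ∈ S, ⁅Db b 0 x, w⁆ ∈ S) (hSh : ∀ m, ∀ w ∈ S, ⁅h m, w⁆ ∈ S)
    (hSp : ∀ j x, 0 < j → ∀ w ∈ S, ⁅Db b j x, w⁆ = 0) {w : V} (hw : w ∈ level b G r)
    (hwS : w ∈ LieSubmodule.lieSpan ℂ L (S : Set V)) : w ∈ S := by
  have hle := lieSpan_le_of_top b (Lv := level b G) (n₀ := r)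
    (fun j x n w hw => lie_Db_mem_level hG j x n hw) hS hS₀ hSh hSp
  obtain ⟨a, ha, c, hc, rfl⟩ := Submodule.mem_sup.mp (hle hwS)
  have hc0 : c = 0 := by
    refine eq_zero_of_comp hG.internal fun n => ?_
    by_cases hn : b.repr n 0 = r
    · exact comp_lower_eq_zero hG hc hn.ge
    · have := comp_level_eq_zero hG (sub_mem hw (hS ha)) hn
      rwa [add_sub_cancel_left] at this
  rw [hc0, add_zero]
  exact ha

theorem repr_add_zsmul_one (n₀ : ℤ × ℤ) (l : ℤ) : b.repr (n₀ + l • b 1) 0 = b.repr n₀ 0 := by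
  simp [-zsmul_eq_mul]

theorem add_zsmul_one_injective (n₀ : ℤ × ℤ) : Function.Injective fun l : ℤ => n₀ + l • b 1 := by
  intro k l hkl
  have := congrArg (fun z => b.repr z 1) hkl
  simpa [-zsmul_eq_mul] using this

theorem IsString.lie_h (hu : IsString b u f) (m : ℤ × ℤ) :
    ∃ c : ℂ, ∀ k, ⁅h m, u k⁆ = c • u k := by
  refine ⟨b.repr m 0 * -(bdet b * f 0), fun k => ?_⟩
  conv_lhs => rw [eq_repr b m]
  rw [h_add, h_zsmul, h_zsmul, add_lie, smul_lie, smul_lie, hu.h_zero, hu.h_one, smul_zero,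
    add_zero, smul_smul]

/-- The top level of the submodule generated by part of a string. -/
theorem mem_span_of_mem_lieSpan (hG : IsZ2Graded G) (hu : IsString b u f)
    {r : ℤ} (hu' : ∀ l, u l ∈ level b G r) {C : Set ℤ} (hC : ∀ c ∈ C, ∀ x, f x ≠ 0 → c + x ∈ C)
    {w : V} (hw : w ∈ level b G r) (hwS : w ∈ LieSubmodule.lieSpan ℂ L (u '' C)) :
    w ∈ Submodule.span ℂ (u '' C) := by
  refine mem_of_mem_lieSpan (b := b) (r := r) hG
    (Submodule.span_le.mpr (by rintro _ ⟨l, -, rfl⟩; exact hu' l)) ?_ ?_ ?_ hw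
    (LieSubmodule.lieSpan_mono Submodule.subset_span hwS)
  · intro x w hw
    induction hw using Submodule.span_induction with
    | mem w hw =>
      obtain ⟨l, hl, rfl⟩ := hw
      rw [hu.zero]
      by_cases hfx : f x = 0
      · rw [hfx, zero_div, zero_smul]; exact zero_mem _
      · exact Submodule.smul_mem _ _ (Submodule.subset_span ⟨_, hC l hl x hfx, rfl⟩)
    | zero => rw [lie_zero]; exact zero_mem _
    | add y z _ _ hy hz => rw [lie_add]; exact add_mem hy hz
    | smul c y _ hy => rw [lie_smul]; exact Submodule.smul_mem _ _ hy
  · intro m w hw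
    obtain ⟨c, hc⟩ := hu.lie_h m
    induction hw using Submodule.span_induction with
    | mem w hw =>
      obtain ⟨l, hl, rfl⟩ := hw
      rw [hc]
      exact Submodule.smul_mem _ _ (Submodule.subset_span ⟨_, hl, rfl⟩)
    | zero => rw [lie_zero]; exact zero_mem _
    | add y z _ _ hy hz => rw [lie_add]; exact add_mem hy hz
    | smul c y _ hy => rw [lie_smul]; exact Submodule.smul_mem _ _ hy
  · intro j x hj w hw
    induction hw using Submodule.span_induction with
    | mem w hw => obtain ⟨l, -, rfl⟩ := hw; exact hu.pos j x _ hj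
    | zero => rw [lie_zero]
    | add y z _ _ hy hz => rw [lie_add, hy, hz, add_zero]
    | smul c y _ hy => rw [lie_smul, hy, smul_zero]

/-- The induced module is not `0` if there is a string with the same function: identifying the
vectors of the string with each other gives a highest weight vector of weight `ψ`. -/
theorem vermaVec_psiOf_ne_zero (hG : IsZ2Graded G) (hu : IsString b u f)
    (huT : ∀ l, u l ∈ G (n₀ + l • b 1)) (hus : ∀ l, u l ≠ 0 ↔ (s : ℤ) ∣ l)
    (hfs : ∀ x, f x ≠ 0 → (s : ℤ) ∣ x) : vermaVec b (psiOf b f) ≠ 0 := by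
  have hd : IsString b (fun l => u (l + s) - u l) f :=
    ⟨fun j x k hj => by rw [lie_sub, hu.pos j x _ hj, hu.pos j x _ hj, sub_zero],
      fun x k => by rw [lie_sub, hu.zero, hu.zero, ← smul_sub, add_right_comm],
      fun k => by rw [lie_sub, hu.h_zero, hu.h_zero, ← smul_sub],
      fun k => by rw [lie_sub, hu.h_one, hu.h_one, sub_zero]⟩
  -- A functional that takes the value 1 on all nonzero vectors of the string.
  obtain ⟨g, hg⟩ : ∃ g : V →ₗ[ℂ] ℂ, ∀ l, (s : ℤ) ∣ l → g (u l) = 1 := by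
    have hli : LinearIndependent ℂ fun l : {l : ℤ // (s : ℤ) ∣ l} => u l := by
      refine iSupIndep.linearIndependent (fun l : {l : ℤ // (s : ℤ) ∣ l} => G (n₀ + (l : ℤ) • b 1))
        ?_ (fun l => huT l) (fun l => (hus l).mpr l.2)
      exact hG.internal.submodule_iSupIndep.comp
        ((add_zsmul_one_injective n₀).comp Subtype.val_injective)
    obtain ⟨g, hg⟩ := LinearMap.exists_extend
      (Finsupp.linearCombination ℂ (fun _ => (1 : ℂ)) ∘ₗ hli.repr)
    refine ⟨g, fun l hl => ?_⟩
    have h1 := LinearMap.congr_fun hg ⟨u l, Submodule.subset_span ⟨⟨l, hl⟩, rfl⟩⟩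
    have h2 := hli.repr_eq_single ⟨l, hl⟩ ⟨u l, Submodule.subset_span ⟨⟨l, hl⟩, rfl⟩⟩ rfl
    simp only [LinearMap.comp_apply, h2, Finsupp.linearCombination_single,
      smul_eq_mul, mul_one, Submodule.subtype_apply] at h1
    exact h1
  have hgS : Submodule.span ℂ ((fun l => u (l + s) - u l) '' Set.univ) ≤ LinearMap.ker g :=
    Submodule.span_le.mpr (by
      rintro _ ⟨l, -, rfl⟩
      rw [SetLike.mem_coe, LinearMap.mem_ker, map_sub]
      by_cases hl : (s : ℤ) ∣ l
      · rw [hg l hl, hg _ (dvd_add hl dvd_rfl), sub_self]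
      · rw [not_not.mp (mt (hus l).mp hl),
          not_not.mp (mt (hus (l + s)).mp fun h => hl ((Int.dvd_add_left dvd_rfl).mp h)), sub_self])
  have hu' : ∀ l, u l ∈ level b G (b.repr n₀ 0) := fun l => by
    have := mem_level (b := b) (huT l)
    rwa [repr_add_zsmul_one] at this
  set K := LieSubmodule.lieSpan ℂ L ((fun l => u (l + s) - u l) '' Set.univ) with hK
  have hu0 : u 0 ∉ K := fun h0 => by
    have h2 := hgS (mem_span_of_mem_lieSpan (r := b.repr n₀ 0) hG hd
      (fun l => sub_mem (hu' _) (hu' _)) (fun _ _ _ _ => Set.mem_univ _) (hu' 0) h0)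
    rw [LinearMap.mem_ker, hg 0 (dvd_zero _)] at h2
    exact one_ne_zero h2
  let q := LieSubmodule.Quotient.mk' K
  have hqu := hu.map q
  have hq : ∀ n : ℤ, q (u (n * s)) = q (u 0) := by
    have hstep : ∀ l, q (u (l + s)) = q (u l) := fun l => by
      rw [← sub_eq_zero, ← map_sub]
      exact LieSubmodule.Quotient.mk_eq_zero'.mpr (LieSubmodule.subset_lieSpan ⟨l, trivial, rfl⟩)
    intro n
    induction n with
    | zero => rw [zero_mul]
    | succ n ih => rw [add_mul, one_mul, hstep, ih]
    | pred n ih => rw [← hstep, sub_mul, one_mul, sub_add_cancel, ih]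
  obtain ⟨F, hF⟩ := exists_vermaLift b (psiOf b f) (m := q (u 0))
    (fun j hj x hx => lie_eq_zero_of_mem_Ldeg b hj (fun x => hqu.pos j x 0 hj) hx)
    (lie_eq_psiOf_smul b (fun x => by
      rw [hqu.zero]
      by_cases hfx : f x = 0
      · rw [hfx, zero_div, zero_smul, zero_smul]
      · obtain ⟨k, rfl⟩ := hfs x hfx
        rw [zero_add, mul_comm, hq, mul_comm]) (hqu.h_zero 0) (hqu.h_one 0))
  intro h0
  rw [h0, map_zero] at hF
  exact hu0 (LieSubmodule.Quotient.mk_eq_zero'.mp hF.symm)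

end Nontrivial

/-! ### Products of graded modules -/

section Products

variable {V : Type*} [AddCommGroup V] [Module ℂ V] [LieRingModule L V] [LieModule ℂ L V]
  {N : Type*} [AddCommGroup N] [Module ℂ N] [LieRingModule L N] [LieModule ℂ L N]

/-- The diagonal action on a product. -/
instance prodLieRingModule : LieRingModule L (V × N) where
  bracket x p := (⁅x, p.1⁆, ⁅x, p.2⁆)
  add_lie x y p := Prod.ext (add_lie x y p.1) (add_lie x y p.2)
  lie_add x p q := Prod.ext (lie_add x p.1 q.1) (lie_add x p.2 q.2)
  leibniz_lie x y p := Prod.ext (leibniz_lie x y p.1) (leibniz_lie x y p.2)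

instance prodLieModule : LieModule ℂ L (V × N) where
  smul_lie c x p := Prod.ext (smul_lie c x p.1) (smul_lie c x p.2)
  lie_smul c x p := Prod.ext (lie_smul c x p.1) (lie_smul c x p.2)

theorem lie_prod (x : L) (p : V × N) : ⁅x, p⁆ = (⁅x, p.1⁆, ⁅x, p.2⁆) := rfl

variable {G : ℤ × ℤ → Submodule ℂ V} {H : ℤ × ℤ → Submodule ℂ N}

/-- The homogeneous subspaces of a product. -/
def prodDeg (G : ℤ × ℤ → Submodule ℂ V) (H : ℤ × ℤ → Submodule ℂ N) (γ : ℤ × ℤ) :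
    Submodule ℂ (V × N) := (G γ).prod (H γ)

theorem isZ2Graded_prodDeg (hG : IsZ2Graded G) (hH : IsZ2Graded H) :
    IsZ2Graded (prodDeg G H) := by
  refine ⟨isInternal_of_proj ?_
    (fun γ => (comp hG.internal γ).prodMap (comp hH.internal γ)) ?_ ?_, ?_⟩
  · refine top_le_iff.mp fun w _ => ?_
    obtain ⟨t, ht⟩ := exists_sum_comp hG.internal w.1
    obtain ⟨t', ht'⟩ := exists_sum_comp hH.internal w.2
    have hw : w = ∑ n ∈ t, (comp hG.internal n w.1, (0 : N)) +
        ∑ n ∈ t', ((0 : V), comp hH.internal n w.2) := by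
      refine Prod.ext ?_ ?_
      · simpa [Prod.fst_sum] using ht
      · simpa [Prod.snd_sum] using ht'
    rw [hw]
    exact add_mem
      (sum_mem fun n _ => Submodule.mem_iSup_of_mem n ⟨comp_mem _ n _, zero_mem _⟩)
      (sum_mem fun n _ => Submodule.mem_iSup_of_mem n ⟨zero_mem _, comp_mem _ n _⟩)
  · intro n w hw
    exact Prod.ext (comp_same _ hw.1) (comp_same _ hw.2)
  · intro m n hmn w hw
    exact Prod.ext (comp_of_ne _ hmn hw.1) (comp_of_ne _ hmn hw.2)
  · intro m n w hw
    exact ⟨hG.lie_mem m n _ hw.1, hH.lie_mem m n _ hw.2⟩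

theorem comp_prod (hG : IsZ2Graded G) (hH : IsZ2Graded H) (γ : ℤ × ℤ) (w : V × N) :
    comp (isZ2Graded_prodDeg hG hH).internal γ w =
      (comp hG.internal γ w.1, comp hH.internal γ w.2) := by
  have hw : w ∈ ⨆ i, prodDeg G H i := by
    rw [(isZ2Graded_prodDeg hG hH).internal.submodule_iSup_eq_top]; trivial
  induction hw using Submodule.iSup_induction' with
  | mem k w hw =>
    by_cases hk : k = γ
    · subst hk
      rw [comp_same _ hw, comp_same _ hw.1, comp_same _ hw.2]
    · rw [comp_of_ne _ hk hw, comp_of_ne _ hk hw.1, comp_of_ne _ hk hw.2]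
      rfl
  | zero => simp only [map_zero, Prod.fst_zero, Prod.snd_zero]; rfl
  | add x y _ _ hx hy =>
    rw [map_add, hx, hy, Prod.fst_add, Prod.snd_add, map_add, map_add, Prod.mk_add_mk]

variable {b : Module.Basis (Fin 2) ℤ (ℤ × ℤ)}

theorem IsString.prod {u : ℤ → V} {t : ℤ → N} {f : ℤ → ℂ} (hu : IsString b u f)
    (ht : IsString b t f) : IsString b (fun k => (u k, t k)) f :=
  ⟨fun j x k hj => Prod.ext (hu.pos j x k hj) (ht.pos j x k hj),
    fun x k => Prod.ext (hu.zero x k) (ht.zero x k),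
    fun k => Prod.ext (hu.h_zero k) (ht.h_zero k), fun k => Prod.ext (hu.h_one k) (ht.h_one k)⟩

end Products

/-! ### Submodules generated by strings -/

section StringSpan

variable {b : Module.Basis (Fin 2) ℤ (ℤ × ℤ)}
  {V : Type*} [AddCommGroup V] [Module ℂ V] [LieRingModule L V] [LieModule ℂ L V]
  {G : ℤ × ℤ → Submodule ℂ V} {n₀ : ℤ × ℤ} {u : ℤ → V} {f : ℤ → ℂ}

theorem comp_mem_lieSpan_string (hG : IsZ2Graded G) (huT : ∀ l, u l ∈ G (n₀ + l • b 1)) {C : Set ℤ}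
    {w : V} (hw : w ∈ LieSubmodule.lieSpan ℂ L (u '' C)) (n : ℤ × ℤ) :
    comp hG.internal n w ∈ LieSubmodule.lieSpan ℂ L (u '' C) :=
  comp_mem_lieSpan hG (by rintro _ ⟨l, -, rfl⟩; exact ⟨_, huT l⟩) hw n

/-- The components of vectors in the span of part of a string. -/
theorem comp_span_string (hG : IsZ2Graded G) (huT : ∀ l, u l ∈ G (n₀ + l • b 1)) {C : Set ℤ}
    {w : V} (hw : w ∈ Submodule.span ℂ (u '' C)) (l : ℤ) :
    ∃ c : ℂ, comp hG.internal (n₀ + l • b 1) w = c • u l ∧ (l ∉ C → c = 0) := by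
  induction hw using Submodule.span_induction with
  | mem w hw =>
    obtain ⟨k, hk, rfl⟩ := hw
    by_cases hkl : k = l
    · subst hkl
      exact ⟨1, by rw [comp_same _ (huT k), one_smul], fun h => absurd hk h⟩
    · exact ⟨0, by rw [comp_of_ne _ (fun h => hkl (add_zsmul_one_injective n₀ h)) (huT k),
        zero_smul], fun _ => rfl⟩
  | zero => exact ⟨0, by rw [map_zero, zero_smul], fun _ => rfl⟩
  | add y z _ _ hy hz =>
    obtain ⟨c, hc, hc'⟩ := hy
    obtain ⟨d, hd, hd'⟩ := hz
    exact ⟨c + d, by rw [map_add, hc, hd, add_smul], fun h => by rw [hc' h, hd' h, add_zero]⟩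
  | smul a y _ hy =>
    obtain ⟨c, hc, hc'⟩ := hy
    exact ⟨a * c, by rw [map_smul, hc, smul_smul], fun h => by rw [hc' h, mul_zero]⟩

theorem comp_span_string_of_ne (hG : IsZ2Graded G) (huT : ∀ l, u l ∈ G (n₀ + l • b 1)) {C : Set ℤ}
    {w : V} (hw : w ∈ Submodule.span ℂ (u '' C)) {γ : ℤ × ℤ} (hγ : ∀ l : ℤ, γ ≠ n₀ + l • b 1) :
    comp hG.internal γ w = 0 := by
  have hle : Submodule.span ℂ (u '' C) ≤ LinearMap.ker (comp hG.internal γ) :=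
    Submodule.span_le.mpr (by
      rintro _ ⟨l, -, rfl⟩
      exact comp_of_ne _ (Ne.symm (hγ l)) (huT l))
  exact hle hw

variable {N : Type*} [AddCommGroup N] [Module ℂ N] [LieRingModule L N] [LieModule ℂ L N]
  {H : ℤ × ℤ → Submodule ℂ N} {t : ℤ → N}

/-- The submodule of `V × N` generated by two strings with the same function is, in the degrees of
the strings, the graph of an injective relation as long as the vectors `u l` do not vanish. -/
theorem eq_zero_of_zero_mem_lieSpan (hG : IsZ2Graded G) (hH : IsZ2Graded H) (hu : IsString b u f)
    (ht : IsString b t f) (huT : ∀ l, u l ∈ G (n₀ + l • b 1)) (htT : ∀ l, t l ∈ H (n₀ + l • b 1))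
    {C : Set ℤ} (hC : ∀ c ∈ C, ∀ x, f x ≠ 0 → c + x ∈ C) (huC : ∀ l ∈ C, u l ≠ 0) {l : ℤ} {x : N}
    (hx : x ∈ H (n₀ + l • b 1))
    (hxX : ((0 : V), x) ∈ LieSubmodule.lieSpan ℂ L ((fun k => (u k, t k)) '' C)) : x = 0 := by
  have hP := isZ2Graded_prodDeg hG hH
  have hxP : ((0 : V), x) ∈ prodDeg G H (n₀ + l • b 1) := ⟨zero_mem _, hx⟩
  have hw := mem_level (b := b) hxP
  rw [repr_add_zsmul_one] at hw
  have hlev : ∀ l, (u l, t l) ∈ level b (prodDeg G H) (b.repr n₀ 0) := fun l => by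
    have := mem_level (b := b) (show (u l, t l) ∈ prodDeg G H (n₀ + l • b 1) from ⟨huT l, htT l⟩)
    rwa [repr_add_zsmul_one] at this
  have h1 := mem_span_of_mem_lieSpan (b := b) hP (hu.prod ht) hlev hC hw hxX
  obtain ⟨c, hc, hc'⟩ := comp_span_string (b := b) (n₀ := n₀) hP (fun l => ⟨huT l, htT l⟩) h1 l
  rw [comp_same _ hxP] at hc
  have h2 : 0 = c • u l := congrArg Prod.fst hc
  have h3 : x = c • t l := congrArg Prod.snd hc
  have h4 : c = 0 := by
    by_cases hl : l ∈ C
    · exact (smul_eq_zero.mp h2.symm).resolve_right (huC l hl)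
    · exact hc' hl
  rw [h3, h4, zero_smul]

end StringSpan

/-! ### Comparison of a module with its model -/

section Model

variable (b : Module.Basis (Fin 2) ℤ (ℤ × ℤ)) (ψ : Ldeg b 0 →ₗ[ℂ] ℂ)

/-- The loop module `V(ψ)` is generated by its top level. -/
theorem lieSpan_topVec : LieSubmodule.lieSpan ℂ L (Set.range (topVec b ψ)) = ⊤ := by
  set K := LieSubmodule.lieSpan ℂ L (Set.range (topVec b ψ)) with hK
  let N : Submodule ℂ (HW b ψ) := ⨅ k, K.toSubmodule.comap (loopTmul b (HW b ψ) k)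
  have hN : ∀ v, v ∈ N ↔ ∀ k, loopTmul b (HW b ψ) k v ∈ K := fun v => by
    simp only [N, Submodule.mem_iInf, Submodule.mem_comap, LieSubmodule.mem_toSubmodule]
  have hD : ∀ m, ∀ v ∈ N, ⁅D m, v⁆ ∈ N := by
    intro m v hv
    rw [hN] at hv ⊢
    intro k
    have h1 := K.lie_mem (x := D m) (hv (k - b.repr m 1))
    rwa [D_eq_Db b m, lie_Db_loopTmul, sub_add_cancel, ← D_eq_Db] at h1
  have hcomap : (subOfD N hD).comap (LieSubmodule.Quotient.mk' (vermaMax b ψ)) = ⊤ := by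
    refine top_le_iff.mp ?_
    rw [← lieSpan_vermaVec b ψ]
    refine LieSubmodule.lieSpan_le.mpr (Set.singleton_subset_iff.mpr ?_)
    exact (hN _).mpr fun k => LieSubmodule.subset_lieSpan ⟨k, rfl⟩
  have hNtop : ∀ v, v ∈ N := fun v => by
    obtain ⟨w, rfl⟩ := LieSubmodule.Quotient.surjective_mk' (vermaMax b ψ) v
    exact LieSubmodule.mem_comap.mp (hcomap ▸ LieSubmodule.mem_top w)
  refine top_le_iff.mp fun w _ => ?_
  have hle : ⨆ k, LinearMap.range (loopTmul b (HW b ψ) k) ≤ K.toSubmodule :=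
    iSup_le fun k => by rintro _ ⟨v, rfl⟩; exact (hN v).mp (hNtop v) k
  rw [iSup_range_loopTmul] at hle
  exact hle trivial

theorem topVec_mem' (l : ℤ) : topVec b ψ l ∈ loopDeg b (hwDeg b ψ) (0 + l • b 1) := by
  rw [zero_add]; exact topVec_mem b ψ l

theorem topVec_mem_level (l : ℤ) : topVec b ψ l ∈ level b (loopDeg b (hwDeg b ψ)) 0 := by
  have := mem_level (b := b) (topVec_mem' b ψ l)
  rwa [repr_add_zsmul_one, show b.repr 0 0 = 0 by simp] at this

theorem le_WMax (i : ℤ) {N : LieSubmodule ℂ L (VLoop b ψ)}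
    (hN : IsGradedSub (loopDeg b (hwDeg b ψ)) N)
    (hNW : N.toSubmodule ⊓ (W b ψ i).toSubmodule = ⊥) : N ≤ WMax b ψ i := le_sSup ⟨hN, hNW⟩

variable {b ψ} {s : ℕ}

theorem W_zero_eq (hs : IsPeriod b ψ 0 s) :
    (W b ψ 0).toSubmodule = Submodule.span ℂ (topVec b ψ '' {k | (s : ℤ) ∣ k}) := by
  rw [hs]
  congr 1
  ext w
  constructor
  · rintro ⟨n, rfl⟩
    exact ⟨0 + n * s, by simp, rfl⟩
  · rintro ⟨_, ⟨n, rfl⟩, rfl⟩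
    exact ⟨n, by simp [mul_comm]⟩

/-- The vectors `v₀ ⊗ t ^ l` outside `W_0` vanish in `V̄(ψ, 0, s)`, since the submodule generated by
them meets the top level only in their span. -/
theorem mem_WMax_of_not_dvd (hψ : ψ (h0 b (b 1)) = 0) (hs : IsPeriod b ψ 0 s)
    (hfs : ∀ x, psiFun b ψ x ≠ 0 → (s : ℤ) ∣ x) {l : ℤ} (hl : ¬ (s : ℤ) ∣ l) :
    topVec b ψ l ∈ WMax b ψ 0 := by
  have hG := isZ2Graded_loop b ψ
  set C : Set ℤ := {k | ¬ (s : ℤ) ∣ k} with hC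
  set K := LieSubmodule.lieSpan ℂ L (topVec b ψ '' C) with hK
  have hKG : IsGradedSub (loopDeg b (hwDeg b ψ)) K :=
    isGradedSub_of_comp hG fun w hw n =>
      comp_mem_lieSpan_string (b := b) (n₀ := 0) hG (topVec_mem' b ψ) hw n
  refine le_WMax b ψ 0 hKG ?_ (LieSubmodule.subset_lieSpan ⟨l, hl, rfl⟩)
  refine (Submodule.eq_bot_iff _).mpr fun w hw => ?_
  have hw₂ : w ∈ Submodule.span ℂ (topVec b ψ '' {k | (s : ℤ) ∣ k}) := W_zero_eq hs ▸ hw.2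
  have hlev : w ∈ level b (loopDeg b (hwDeg b ψ)) 0 :=
    (Submodule.span_le (p := level b (loopDeg b (hwDeg b ψ)) 0)).mpr
      (by rintro _ ⟨k, -, rfl⟩; exact topVec_mem_level b ψ k) hw₂
  have hw₁ := mem_span_of_mem_lieSpan (b := b) hG (isString_topVec b ψ hψ) (topVec_mem_level b ψ)
    (C := C) (fun c hc x hfx hcx => hc ((Int.dvd_add_left (hfs x hfx)).mp hcx)) hlev hw.1
  refine eq_zero_of_comp hG.internal fun γ => ?_
  by_cases hγ : ∃ k : ℤ, γ = 0 + k • b 1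
  · obtain ⟨k, rfl⟩ := hγ
    obtain ⟨c, hc, hc'⟩ := comp_span_string (b := b) (n₀ := 0) hG (topVec_mem' b ψ) hw₁ k
    obtain ⟨d, hd, hd'⟩ := comp_span_string (b := b) (n₀ := 0) hG (topVec_mem' b ψ) hw₂ k
    by_cases hk : (s : ℤ) ∣ k
    · rw [hc, hc' (not_not.mpr hk), zero_smul]
    · rw [hd, hd' hk, zero_smul]
  · push Not at hγ
    exact comp_span_string_of_ne (b := b) (n₀ := 0) hG (topVec_mem' b ψ) hw₁ hγ

variable {V : Type*} [AddCommGroup V] [Module ℂ V] [LieRingModule L V] [LieModule ℂ L V]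
  {G : ℤ × ℤ → Submodule ℂ V} {u : ℤ → V}

/-- The submodule of `V × V(ψ)` generated by the pairs of corresponding vectors of two strings. -/
def graph (b : Module.Basis (Fin 2) ℤ (ℤ × ℤ)) (ψ : Ldeg b 0 →ₗ[ℂ] ℂ) (u : ℤ → V) (s : ℕ) :
    LieSubmodule ℂ L (V × VLoop b ψ) :=
  LieSubmodule.lieSpan ℂ L ((fun k => (u k, topVec b ψ k)) '' {k | (s : ℤ) ∣ k})

theorem comp_mem_graph (hG : IsZ2Graded G) (huT : ∀ l, u l ∈ G (0 + l • b 1)) {v : V}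
    {x : VLoop b ψ} (hvx : (v, x) ∈ graph b ψ u s) (γ : ℤ × ℤ) :
    (comp hG.internal γ v, comp (isZ2Graded_loop b ψ).internal γ x) ∈ graph b ψ u s := by
  have h1 := comp_mem_lieSpan_string (b := b) (n₀ := 0)
    (isZ2Graded_prodDeg hG (isZ2Graded_loop b ψ)) (fun l => ⟨huT l, topVec_mem' b ψ l⟩) hvx γ
  rwa [comp_prod hG (isZ2Graded_loop b ψ)] at h1

/-- The elements of the graph over `0` form a graded submodule of `V(ψ)` that meets `W_0` trivially.
Hence the graph defines a homomorphism to `V̄(ψ, 0, s)`. -/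
theorem mem_WMax_of_zero_mem (hψ : ψ (h0 b (b 1)) = 0) (hs : IsPeriod b ψ 0 s)
    (hfs : ∀ x, psiFun b ψ x ≠ 0 → (s : ℤ) ∣ x) (hG : IsZ2Graded G)
    (hu : IsString b u (psiFun b ψ)) (huT : ∀ l, u l ∈ G (0 + l • b 1))
    (hus : ∀ l, u l ≠ 0 ↔ (s : ℤ) ∣ l) {x : VLoop b ψ} (hx : ((0 : V), x) ∈ graph b ψ u s) :
    x ∈ WMax b ψ 0 := by
  have hH := isZ2Graded_loop b ψ
  let Y : LieSubmodule ℂ L (VLoop b ψ) :=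
    subOfD ((graph b ψ u s).toSubmodule.comap (LinearMap.inr ℂ V (VLoop b ψ))) (fun m y hy => by
      have := (graph b ψ u s).lie_mem (x := D m) hy
      rw [LinearMap.inr_apply, lie_prod, lie_zero] at this
      exact this)
  have hY : ∀ y, y ∈ Y ↔ ((0 : V), y) ∈ graph b ψ u s := fun y => Iff.rfl
  have hYc : ∀ y ∈ Y, ∀ γ, comp hH.internal γ y ∈ Y := fun y hy γ => by
    have := comp_mem_graph hG huT ((hY y).mp hy) γ
    rwa [map_zero] at this
  refine le_WMax b ψ 0 (isGradedSub_of_comp hH hYc) ?_ hx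
  refine (Submodule.eq_bot_iff _).mpr fun y hy => eq_zero_of_comp hH.internal fun γ => ?_
  by_cases hγ : ∃ k : ℤ, γ = 0 + k • b 1
  · obtain ⟨k, rfl⟩ := hγ
    exact eq_zero_of_zero_mem_lieSpan (b := b) (n₀ := 0) hG hH hu (isString_topVec b ψ hψ) huT
      (topVec_mem' b ψ) (C := {k | (s : ℤ) ∣ k}) (fun c hc x hfx => dvd_add hc (hfs x hfx))
      (fun l hl => (hus l).mpr hl) (comp_mem _ _ y) (hYc y hy.1 _)
  · push Not at hγ
    exact comp_span_string_of_ne (b := b) (n₀ := 0) hH (topVec_mem' b ψ) (W_zero_eq hs ▸ hy.2) hγ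

/-- A module with a top level formed by a string is isomorphic to its model. -/
theorem exists_model_equiv (hψ : ψ (h0 b (b 1)) = 0) (hs : IsPeriod b ψ 0 s)
    (hfs : ∀ x, psiFun b ψ x ≠ 0 → (s : ℤ) ∣ x) (h0 : hwVec b ψ ≠ 0) (hO : IsInO G)
    (hu : IsString b u (psiFun b ψ)) (huT : ∀ l, u l ∈ G (0 + l • b 1))
    (hus : ∀ l, u l ≠ 0 ↔ (s : ℤ) ∣ l) : GradedIso G (vBarDeg b ψ 0) := by
  have hG := hO.toIsZ2Graded
  have hH := isZ2Graded_loop b ψ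
  set X := graph b ψ u s with hX
  have hmem : ∀ l, (s : ℤ) ∣ l → (u l, topVec b ψ l) ∈ X := fun l hl =>
    LieSubmodule.subset_lieSpan ⟨l, hl, rfl⟩
  have hfst : ∀ v, ∃ x, (v, x) ∈ X := by
    let P : LieSubmodule ℂ L V :=
      subOfD (X.toSubmodule.map (LinearMap.fst ℂ V (VLoop b ψ))) (by
        rintro m _ ⟨p, hp, rfl⟩
        exact ⟨⁅D m, p⁆, X.lie_mem hp, rfl⟩)
    have hP : LieSubmodule.lieSpan ℂ L {u 0} ≤ P :=
      LieSubmodule.lieSpan_le.mpr (Set.singleton_subset_iff.mpr ⟨_, hmem 0 (dvd_zero _), rfl⟩)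
    rw [lieSpan_singleton_eq_top hO (huT 0) ((hus 0).mpr (dvd_zero _))] at hP
    intro v
    obtain ⟨p, hp, rfl⟩ := hP (LieSubmodule.mem_top v)
    exact ⟨p.2, hp⟩
  choose g hg using hfst
  have key : ∀ v x, (v, x) ∈ X → toBar b ψ 0 (g v) = toBar b ψ 0 x := by
    intro v x hvx
    rw [← sub_eq_zero, ← map_sub, toBar_eq_zero]
    refine mem_WMax_of_zero_mem hψ hs hfs hG hu huT hus ?_
    have := X.toSubmodule.sub_mem (hg v) hvx
    rwa [Prod.mk_sub_mk, sub_self] at this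
  let e : V →ₗ⁅ℂ,L⁆ VBar b ψ 0 :=
    { toFun := fun v => toBar b ψ 0 (g v)
      map_add' := fun v w => by
        rw [key _ _ (X.toSubmodule.add_mem (hg v) (hg w)), map_add]
      map_smul' := fun c v => by
        rw [key _ _ (X.toSubmodule.smul_mem c (hg v)), map_smul, RingHom.id_apply]
      map_lie' := fun {x v} => by
        rw [key _ _ (X.lie_mem (x := x) (hg v))]
        exact LieModuleHom.map_lie _ _ _ }
  have he : ∀ v x, (v, x) ∈ X → e v = toBar b ψ 0 x := key
  have heu : ∀ l, (s : ℤ) ∣ l → e (u l) = toBar b ψ 0 (topVec b ψ l) := fun l hl =>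
    he _ _ (hmem l hl)
  have hecomp : ∀ γ v, e (comp hG.internal γ v) = toBar b ψ 0 (comp hH.internal γ (g v)) :=
    fun γ v => he _ _ (comp_mem_graph hG huT (hg v) γ)
  have hinj : Function.Injective e := by
    refine (injective_iff_map_eq_zero e).mpr fun v hv => ?_
    by_contra hv0
    have htop := eq_top_of_comp hO (N := e.ker) (fun w hw γ => by
      rw [LieModuleHom.mem_ker] at hw ⊢
      rw [hecomp, toBar_eq_zero]
      exact comp_mem_of_isGradedSub hH.internal (isGradedSub_WMax b ψ 0)
        ((toBar_eq_zero b ψ 0).mp hw) γ) (LieModuleHom.mem_ker.mpr hv) hv0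
    have h1 : e (u 0) = 0 := LieModuleHom.mem_ker.mp (htop ▸ LieSubmodule.mem_top (u 0))
    rw [heu 0 (dvd_zero _)] at h1
    exact toBar_topVec_ne_zero b ψ 0 h0 (topVec_mem_W b ψ 0) h1
  have hsurj : Function.Surjective e := by
    intro y
    obtain ⟨x, rfl⟩ := toBar_surjective b ψ 0 y
    have hR : LieSubmodule.lieSpan ℂ L (Set.range (topVec b ψ)) ≤ e.range.comap (toBar b ψ 0) := by
      refine LieSubmodule.lieSpan_le.mpr ?_
      rintro _ ⟨l, rfl⟩
      rw [SetLike.mem_coe, LieSubmodule.mem_comap, LieModuleHom.mem_range]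
      by_cases hl : (s : ℤ) ∣ l
      · exact ⟨u l, heu l hl⟩
      · exact ⟨0, by
          rw [map_zero, eq_comm, toBar_eq_zero]
          exact mem_WMax_of_not_dvd hψ hs hfs hl⟩
    rw [lieSpan_topVec] at hR
    exact (LieModuleHom.mem_range e _).mp (LieSubmodule.mem_comap.mp (hR (LieSubmodule.mem_top x)))
  have hmap : ∀ γ, ∀ v ∈ G γ, e v ∈ vBarDeg b ψ 0 γ := fun γ v hv => by
    have := hecomp γ v
    rw [comp_same _ hv] at this
    rw [this]
    exact toBar_mem b ψ 0 (comp_mem _ _ _)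
  have hB := isZ2Graded_vBarDeg b ψ 0
  refine ⟨{ e, LinearEquiv.ofBijective (e : V →ₗ[ℂ] VBar b ψ 0) ⟨hinj, hsurj⟩ with }, 0,
    fun γ => ?_⟩
  rw [add_zero]
  refine le_antisymm ?_ fun y hy => ?_
  · rintro _ ⟨v, hv, rfl⟩
    exact hmap γ v hv
  · obtain ⟨v, rfl⟩ := hsurj y
    have h1 := comp_map hG.internal hB.internal (e : V →ₗ[ℂ] VBar b ψ 0) hmap γ v
    change comp hB.internal γ (e v) = _ at h1
    rw [comp_same _ hy] at h1
    exact ⟨_, comp_mem _ γ v, h1.symm⟩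

end Model

/-! ### The models are not uniformly bounded -/

section Unbounded

variable {b : Module.Basis (Fin 2) ℤ (ℤ × ℤ)}
  {M : Type*} [AddCommGroup M] [Module ℂ M] [LieRingModule L M] [LieModule ℂ L M]
  {u : ℤ → M} {f : ℤ → ℂ}

theorem IsString.lie_pair_of_lt (hu : IsString b u f) {m m' : ℤ} (hm : 0 < m') (hmm : m' < m)
    (x y k : ℤ) : ⁅Db b m x, ⁅Db b (-m') y, u k⁆⁆ = 0 := by
  rw [lie_Db_lie_Db_of_ne b (by omega), hu.pos _ _ _ (by omega), hu.pos _ _ _ (by omega), lie_zero,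
    smul_zero, add_zero]

theorem IsString.lie_pair_of_gt (hu : IsString b u f) {m m' : ℤ} (hm : 0 < m) (hmm : m < m')
    (x y k : ℤ) :
    ∃ c : ℂ, ⁅Db b m x, ⁅Db b (-m') y, u k⁆⁆ = c • ⁅Db b (-(m' - m)) (x + y), u k⁆ := by
  rw [lie_Db_lie_Db_of_ne b (by omega), hu.pos m x k hm, lie_zero, add_zero,
    show m + -m' = -(m' - m) by ring]
  exact ⟨_, rfl⟩

/-- The pairing of the vectors `D(-a 𝐛₁) D(-(N - a) 𝐛₁) u k` with the elements
`D((N - c) 𝐛₁ + q 𝐛₂) D(c 𝐛₁ + p 𝐛₂)` is diagonal, if `p` and `q` are chosen suitably. -/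
theorem IsString.lie_quadruple (hu : IsString b u f) {p q : ℤ}
    (hpq : p = 0 ∧ q = 0 ∨ p ≠ 0 ∧ f (p + q) = 0) {N a c : ℤ} (ha : 0 < a)
    (haN : 2 * a < N) (hc : 0 < c) (hcN : 2 * c < N) (k : ℤ) :
    ⁅Db b (N - c) q, ⁅Db b c p, ⁅Db b (-a) 0, ⁅Db b (-(N - a)) 0, u k⁆⁆⁆⁆ =
      if a = c then (a * (N - a) * bdet b ^ 2 * (f p * f q) : ℂ) • u (k + (p + q)) else 0 := by
  rcases hpq with ⟨rfl, rfl⟩ | ⟨hp, hf⟩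
  · have h1 : ⁅Db b c 0, ⁅Db b (-(N - a)) 0, u k⁆⁆ = 0 := by
      rw [lie_Db_lie_Db_of_ne b (by omega), hu.pos _ _ _ hc]
      simp
    rw [lie_Db_lie_Db b c 0 (-a) 0, h1]
    split_ifs with h2 h3 h3
    · subst h3
      rw [lie_h_comm, hu.h_zero]
      simp only [lie_zero, add_zero, mul_zero, sub_self, zero_mul, Int.cast_zero, neg_zero,
        zero_smul, zero_add, lie_smul, smul_smul]
      rw [hu.lie_pair (by omega), smul_smul, add_zero, add_zero]
      congr 1
      push_cast
      ring
    · exact absurd (by omega) h3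
    · exact absurd ⟨by omega, rfl⟩ h2
    · simp
  · have hpair : ∀ m, 0 < m → ∀ x y, x + y = p + q → ⁅Db b m x, ⁅Db b (-m) y, u k⁆⁆ = 0 := by
      intro m hm x y hxy
      rw [hu.lie_pair hm, hxy, hf, mul_zero, neg_zero, zero_smul]
    have hlast : ⁅Db b (N - c) q, ⁅Db b (-a) 0, ⁅Db b c p, ⁅Db b (-(N - a)) 0, u k⁆⁆⁆⁆ = 0 := by
      obtain ⟨d, hd⟩ := hu.lie_pair_of_gt hc (show c < N - a by omega) p 0 k
      rw [hd, lie_smul, lie_smul, lie_Db_lie_Db_of_ne b (by omega),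
        hu.lie_pair_of_lt (m := N - c) (m' := N - a - c) (by omega) (by omega), lie_zero, add_zero,
        show N - c + -a = N - a - c by ring, hpair _ (by omega) _ _ (by ring), smul_zero, smul_zero]
    rw [lie_Db_lie_Db b c p (-a) 0, if_neg (fun h => hp (by simpa using h.2)), add_zero, lie_add,
      hlast, add_zero, lie_smul]
    split_ifs with hac
    · subst hac
      rw [add_neg_cancel, add_zero, lie_Db_lie_Db_of_ne b (j := 0) (by omega), zero_add, lie_add,
        lie_smul, hpair _ (by omega) _ _ (by ring), smul_zero, zero_add, hu.zero, lie_smul, lie_smul,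
        hu.lie_pair (by omega), smul_smul, smul_smul, add_zero, add_assoc]
      congr 1
      have hp' : (p : ℂ) ≠ 0 := by exact_mod_cast hp
      field_simp
      push_cast
      ring
    · rcases lt_or_gt_of_ne hac with h | h
      · obtain ⟨d, hd⟩ := hu.lie_pair_of_gt (show 0 < c + -a by omega)
          (show c + -a < N - a by omega) (p + 0) 0 k
        rw [hd, lie_smul, show N - a - (c + -a) = N - c by ring, hpair _ (by omega) _ _ (by ring),
          smul_zero, smul_zero]
      · rw [lie_Db_lie_Db_of_ne b (by omega),
          hu.lie_pair_of_lt (m := N - c) (m' := N - a) (by omega) (by omega), lie_zero, add_zero,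
          show N - c + (c + -a) = N - a by ring, hpair _ (by omega) _ _ (by ring), smul_zero,
          smul_zero]

/-- By `IsString.lie_quadruple` the vectors `D(-a 𝐛₁) D(-(N - a) 𝐛₁) u k` with `0 < a < N / 2`,
all of the same degree, are linearly independent. -/
theorem not_isUniformlyBounded_of_string {H : ℤ × ℤ → Submodule ℂ M} (hH : IsZ2Graded H)
    (hu : IsString b u f) (huT : ∀ l, u l ∈ H (l • b 1)) {p q k : ℤ}
    (hpq : p = 0 ∧ q = 0 ∨ p ≠ 0 ∧ f (p + q) = 0) (hp : f p ≠ 0) (hq : f q ≠ 0)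
    (hne : u (k + (p + q)) ≠ 0) : ¬ IsUniformlyBounded H := by
  rintro ⟨n, hn⟩
  set N : ℤ := 2 * n + 3 with hN
  obtain ⟨hfd, hrank⟩ := hn ((-N) • b 0 + k • b 1)
  let v : Fin (n + 1) → H ((-N) • b 0 + k • b 1) := fun a =>
    ⟨⁅Db b (-((a : ℕ) + 1)) 0, ⁅Db b (-(N - ((a : ℕ) + 1))) 0, u k⁆⁆, by
      have := lie_Db_mem (b := b) hH (-((a : ℕ) + 1)) 0
        (lie_Db_mem (b := b) hH (-(N - ((a : ℕ) + 1))) 0 (huT k))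
      rwa [show (-(((a : ℕ) : ℤ) + 1)) • b 0 + (0 : ℤ) • b 1 +
        ((-(N - (((a : ℕ) : ℤ) + 1))) • b 0 + (0 : ℤ) • b 1 + k • b 1) = (-N) • b 0 + k • b 1 by
        module] at this⟩
  have hli : LinearIndependent ℂ v := by
    refine Fintype.linearIndependent_iff.mpr fun g hg c => ?_
    have h1 : ∑ a, g a • ⁅Db b (-((a : ℕ) + 1)) 0, ⁅Db b (-(N - ((a : ℕ) + 1))) 0, u k⁆⁆ = 0 := by
      have := congrArg Subtype.val hg
      simpa [v] using this
    have h2 := congrArg (fun w => ⁅Db b (N - ((c : ℕ) + 1)) q, ⁅Db b ((c : ℕ) + 1) p, w⁆⁆) h1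
    simp only [lie_sum, lie_smul, lie_zero] at h2
    have h3 : ∀ a : Fin (n + 1), ⁅Db b (N - ((c : ℕ) + 1)) q, ⁅Db b ((c : ℕ) + 1) p,
        ⁅Db b (-((a : ℕ) + 1)) 0, ⁅Db b (-(N - ((a : ℕ) + 1))) 0, u k⁆⁆⁆⁆ =
        if a = c then (((c : ℕ) + 1 : ℤ) * (N - ((c : ℕ) + 1 : ℤ)) * bdet b ^ 2 * (f p * f q) : ℂ) •
          u (k + (p + q)) else 0 := by
      intro a
      have ha := a.2
      have hc := c.2
      rw [hu.lie_quadruple hpq (by omega) (by omega) (by omega) (by omega)]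
      by_cases hac : a = c
      · subst hac
        rw [if_pos rfl, if_pos rfl]
      · rw [if_neg hac, if_neg (fun h => hac (Fin.ext (by omega)))]
    simp only [h3, smul_ite, smul_zero, Finset.sum_ite_eq', Finset.mem_univ,
      if_true, smul_smul] at h2
    have h4 := (smul_eq_zero.mp h2).resolve_right hne
    refine (mul_eq_zero.mp h4).resolve_right ?_
    have hc := c.2
    have h5 : (((c : ℕ) + 1 : ℤ) : ℂ) ≠ 0 := by exact_mod_cast Nat.succ_ne_zero (c : ℕ)
    have h6 : ((N : ℂ) - ((c : ℕ) + 1 : ℤ)) ≠ 0 := by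
      rw [← Int.cast_sub]
      exact_mod_cast show N - ((c : ℕ) + 1 : ℤ) ≠ 0 by omega
    exact mul_ne_zero (mul_ne_zero (mul_ne_zero h5 h6) (pow_ne_zero 2 (bdet_ne_zero' b)))
      (mul_ne_zero hp hq)
  have := hli.fintype_card_le_finrank
  rw [Fintype.card_fin] at this
  omega

variable (b) in
theorem not_isUniformlyBounded_vBarDeg (ψ : Ldeg b 0 →ₗ[ℂ] ℂ) (i : ℤ) {s : ℕ}
    (hψ : ψ (h0 b (b 1)) = 0) (hs0 : 0 < s) (hs : IsPeriod b ψ i s) (h0 : hwVec b ψ ≠ 0) :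
    ¬ IsUniformlyBounded (vBarDeg b ψ i) := by
  have hu := (isString_topVec b ψ hψ).map (toBar b ψ i)
  have huT : ∀ l, toBar b ψ i (topVec b ψ l) ∈ vBarDeg b ψ i (l • b 1) := fun l =>
    toBar_mem b ψ i (topVec_mem b ψ l)
  have hH := isZ2Graded_vBarDeg b ψ i
  by_cases hf0 : psiFun b ψ 0 = 0
  · -- The support of `ψ` is not closed under addition, since otherwise it would contain `s`, `-s`
    -- and hence `0`.
    obtain ⟨p, q, hp, hq, hpq⟩ : ∃ p q, psiFun b ψ p ≠ 0 ∧ psiFun b ψ q ≠ 0 ∧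
        psiFun b ψ (p + q) = 0 := by
      by_contra! hcl
      have h1 : ∀ x ∈ AddSubmonoid.closure {x | x ≠ 0 ∧ psiFun b ψ x ≠ 0},
          x = 0 ∨ psiFun b ψ x ≠ 0 := by
        intro x hx
        induction hx using AddSubmonoid.closure_induction with
        | mem x hx => exact .inr hx.2
        | zero => exact .inl rfl
        | add x y _ _ hx hy =>
          rcases hx with rfl | hx
          · rwa [zero_add]
          · rcases hy with rfl | hy
            · rw [add_zero]; exact .inr hx
            · exact .inr (hcl x y hx hy)
      have h2 := (h1 _ (mem_closure_of_isPeriod b ψ i hψ h0 hs 1)).resolve_left (by omega)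
      have h3 := (h1 _ (mem_closure_of_isPeriod b ψ i hψ h0 hs (-1))).resolve_left (by omega)
      have h4 := hcl _ _ h2 h3
      rw [show (1 : ℤ) * s + -1 * s = 0 by ring] at h4
      exact h4 hf0
    have hp0 : p ≠ 0 := by rintro rfl; exact hp hf0
    have hq0 : q ≠ 0 := by rintro rfl; exact hq hf0
    refine not_isUniformlyBounded_of_string hH hu huT (k := i) (.inr ⟨hp0, hpq⟩) hp hq
      (toBar_topVec_ne_zero b ψ i h0 ?_)
    rw [← add_assoc]
    exact topVec_add_mem_W b ψ i hψ (topVec_add_mem_W b ψ i hψ (topVec_mem_W b ψ i) hp0 hp) hq0 hq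
  · refine not_isUniformlyBounded_of_string hH hu huT (k := i) (.inl ⟨rfl, rfl⟩) hf0 hf0
      (toBar_topVec_ne_zero b ψ i h0 ?_)
    rw [add_zero, add_zero]
    exact topVec_mem_W b ψ i

end Unbounded

/-! ### The two directions of the classification -/

section Classification

variable {V : Type*} [AddCommGroup V] [Module ℂ V] [LieRingModule L V] [LieModule ℂ L V]
  {G : ℤ × ℤ → Submodule ℂ V}

theorem IsInO.shift (hO : IsInO G) (n₀ : ℤ × ℤ) : IsInO fun n => G (n + n₀) where
  internal := by
    refine isInternal_of_proj ?_ (fun n => comp hO.internal (n + n₀)) (fun n w hw => comp_same _ hw)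
      (fun m n hmn w hw => comp_of_ne _ (by simpa using hmn) hw)
    rw [← hO.internal.submodule_iSup_eq_top]
    exact (Equiv.addRight n₀).iSup_comp (g := G)
  lie_mem m n v hv := by rw [add_assoc]; exact hO.lie_mem m _ v hv
  nontrivial := hO.nontrivial
  irreducible N hN := by
    refine hO.irreducible N ?_
    rw [IsGradedSub] at hN ⊢
    conv_lhs => rw [hN]
    exact (Equiv.addRight n₀).iSup_comp (g := fun n => N.toSubmodule ⊓ G n)
  finiteDimensional m := hO.finiteDimensional _

/-- Existence of the model. After a shift of the degrees the top level lies over `ℤ 𝐛₂`, so that the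
index `i` may be taken to be `0`. -/
theorem exists_model (hO : IsInO G) (hU : ¬ IsUniformlyBounded G) :
    ∃ (b : Module.Basis (Fin 2) ℤ (ℤ × ℤ)) (ψ : Ldeg b 0 →ₗ[ℂ] ℂ) (i : ℤ) (s : ℕ),
      IsExpPolynomial b ψ ∧ 0 < s ∧ IsPeriod b ψ i s ∧ GradedIso G (vBarDeg b ψ i) := by
  obtain ⟨b, n₀, hn₀, htop, hk⟩ := exists_top hO hU
  have hO' := hO.shift n₀
  have hU' : ¬ IsUniformlyBounded fun n => G (n + n₀) := by
    rintro ⟨n, hn⟩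
    exact hU ⟨n, fun m => by
      obtain ⟨k, rfl⟩ : ∃ k, k + n₀ = m := ⟨m - n₀, sub_add_cancel m n₀⟩
      exact hn k⟩
  obtain ⟨s, u, f, hu, huT, hus, hfs, hcl⟩ := exists_isString (b := b) (n₀ := 0) hO'
    (by rwa [zero_add]) (fun n hn => htop _ (by simpa using hn))
  have hs := period_ne_zero hO' hU' hk hu huT hus hfs
  obtain ⟨a, ha, hrec⟩ := exists_recurrence hO' hu huT hus hfs
  have hf0 : f ≠ 0 := by
    rintro rfl
    have h1 := hcl s dvd_rfl
    simp only [Pi.zero_apply, ne_eq, not_true_eq_false, and_false] at h1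
    have h2 : AddSubmonoid.closure {x : ℤ | False} = ⊥ := AddSubmonoid.closure_empty
    rw [h2, AddSubmonoid.mem_bot] at h1
    exact hs (by exact_mod_cast h1)
  have hψ := psiOf_h0_one b f
  have hpf := psiFun_psiOf b f
  have hper : IsPeriod b (psiOf b f) 0 s :=
    isPeriod_of_closure b (psiOf b f) 0 hψ (by rwa [hpf]) (by rwa [hpf])
  have hne := hwVec_ne_zero b (psiOf b f)
    (vermaVec_psiOf_ne_zero hO'.toIsZ2Graded hu huT hus hfs)
  obtain ⟨e, d, he⟩ := exists_model_equiv hψ hper (by rwa [hpf]) hne hO' (by rwa [hpf]) huT hus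
  refine ⟨b, psiOf b f, 0, s, isExpPolynomial_psiOf b
    (mem_expSpan_of_recurrence f hs ha hrec) hf0, Nat.pos_of_ne_zero hs, hper, e, d - n₀,
    fun m => ?_⟩
  have : (G (m - n₀ + n₀)).map (e : V →ₗ[ℂ] VBar b (psiOf b f) 0) = _ := he (m - n₀)
  rwa [sub_add_cancel, show m - n₀ + d = m + (d - n₀) by abel] at this

theorem not_isUniformlyBounded_of_gradedIso (hO : IsInO G) {b : Module.Basis (Fin 2) ℤ (ℤ × ℤ)}
    {ψ : Ldeg b 0 →ₗ[ℂ] ℂ} {i : ℤ} {s : ℕ} (hψ : IsExpPolynomial b ψ) (hs0 : 0 < s)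
    (hs : IsPeriod b ψ i s) (he : GradedIso G (vBarDeg b ψ i)) : ¬ IsUniformlyBounded G := by
  obtain ⟨e, d, he⟩ := he
  have h0 : hwVec b ψ ≠ 0 := by
    intro h0
    have htv : ∀ k, topVec b ψ k = 0 := fun k => by rw [topVec, h0, map_zero]
    have htop := lieSpan_topVec b ψ
    have hle : LieSubmodule.lieSpan ℂ L (Set.range (topVec b ψ)) ≤ ⊥ :=
      LieSubmodule.lieSpan_le.mpr (by rintro _ ⟨k, rfl⟩; exact htv k)
    rw [htop] at hle
    have hzero : ∀ v : V, v = 0 := fun v => by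
      obtain ⟨w, hw⟩ := toBar_surjective b ψ i (e v)
      have hw0 : w = 0 := hle (LieSubmodule.mem_top w)
      rw [hw0, map_zero] at hw
      exact e.injective (hw.symm.trans (map_zero e).symm)
    obtain ⟨v, w, hvw⟩ := hO.nontrivial
    exact hvw ((hzero v).trans (hzero w).symm)
  rintro ⟨n, hn⟩
  refine not_isUniformlyBounded_vBarDeg b ψ i hψ.2.1 hs0 hs h0 ⟨n, fun m => ?_⟩
  obtain ⟨hfd, hrank⟩ := hn (m - d)
  have h1 := he (m - d)
  rw [sub_add_cancel] at h1
  rw [← h1]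
  exact ⟨inferInstance, (Submodule.finrank_map_le _ _).trans hrank⟩

end Classification

end VirLike
end

theorem theorem4p7 {V : Type*} [AddCommGroup V] [Module ℂ V] [LieRingModule VirLike.L V]
    [LieModule ℂ VirLike.L V] (G : ℤ × ℤ → Submodule ℂ V) (hV : VirLike.IsInO G) :
    Xor (VirLike.IsUniformlyBounded G)
      (∃ (b : Module.Basis (Fin 2) ℤ (ℤ × ℤ)) (ψ : VirLike.Ldeg b 0 →ₗ[ℂ] ℂ) (i : ℤ) (s : ℕ),
        VirLike.IsExpPolynomial b ψ ∧ 0 < s ∧ VirLike.IsPeriod b ψ i s ∧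
        VirLike.GradedIso G (VirLike.vBarDeg b ψ i)) := by
  by_cases hU : VirLike.IsUniformlyBounded G
  · exact .inl ⟨hU, fun ⟨_, _, _, _, hψ, hs0, hs, he⟩ =>
      VirLike.not_isUniformlyBounded_of_gradedIso hV hψ hs0 hs he hU⟩
  · exact .inr ⟨VirLike.exists_model hV hU, hU⟩
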